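/- **Conventions.** Let $k$ be a field and $X$ a separated scheme of finite type over $k$. An étale sheaf of abelian groups on $X$ is *naively locally constant* if it is constant on some étale covering of $X$, and *locally constant* if it is a direct limit of naively locally constant sheaves. For an integer $i$, let $X_{(i)}$ be the set of points of $X$ whose closure has dimension $i$. For a locally constant étale sheaf $E$ on $X$, the twisted Chow group $CH_i(X,E)$ is the cokernel of the residue map on Galois cohomology $$\bigoplus_{x\in X_{(i+1)}} H^1(k(x),E(1))\to \bigoplus_{x\in X_{(i)}} H^0(k(x),E),\qquad E(1)=E\otimes^L_{\mathbf Z}\mathbf{G}_m[-1].$$ The component of this map from $x$ to $y$ is the sum, over the points $v$ above $y$ of the normalization of the closure of $x$, of the residue at $v$ followed by the transfer $H^0(k(v),E)\to H^0(k(y),E)$. Let $R$ be a Dedekind domain that is $\mathbf Z$-torsion-free. For a finite group $G$, an *$RG$-lattice* is a finitely generated $RG$-module that is projective over $R$. It is *invertible* if it is a direct summand of a permutation module $R[S]$, with $S$ a finite $G$-set, and *coflasque* if $H^1(H,M)=0$ for every subgroup $H$ of $G$. A locally constant étale sheaf on $X$ is *coflasque* (resp. *invertible*) over $R$ if on each connected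 component $X'$ of $X$ it corresponds to a coflasque (resp. invertible) $RG$-lattice for some finite quotient group $G$ of $\pi_1^{\text{ét}}(X')$. **Theorem 3.1.** Let $0\to A\to B\to C\to 0$ be an exact sequence of locally constant étale sheaves of abelian groups on $X$, and let $i$ be an integer. (1) If $A$ is coflasque over some such $R$, then $CH_i(X,B)\to CH_i(X,C)$ is surjective. (2) If $A$ is invertible over some such $R$, then $CH_i(X,A)\to CH_i(X,B)\to CH_i(X,C)\to 0$ is exact. -/

import Mathlib

open CategoryTheory AlgebraicGeometry Opposite
open scoped TensorProduct

universe u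

noncomputable section

namespace TwistedChow

/-! ### Galois hypercohomology of a field with coefficients in `M ⊗ᴸ 𝔾ₘ` -/

section Galois

variable (F : Type u) [Field F]

/-- The absolute Galois group of `F`, realised as the automorphism group of an algebraic closure
(restriction to the separable closure identifies it with the Galois group of the latter). -/
abbrev Gam : Type u := AlgebraicClosure F ≃ₐ[F] AlgebraicClosure F

/-- The multiplicative group of the separable closure of `F`. -/
abbrev SepUnits : Type u := (separableClosure F (AlgebraicClosure F))ˣ

/-- The Galois action on the multiplicative group of the separable closure. -/
def galUnits : Gam F →* Monoid.End (SepUnits F) where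
  toFun σ := Units.map
    (AlgEquiv.restrictNormalHom (separableClosure F (AlgebraicClosure F)) σ : _ →* _)
  map_one' := by
    refine MonoidHom.ext fun a => Units.ext ?_
    simp only [map_one]
    rfl
  map_mul' σ τ := by
    refine MonoidHom.ext fun a => Units.ext ?_
    simp only [map_mul]
    rfl

/-- The free abelian group on the set `SepUnits F`. -/
abbrev ResZero : Type u := SepUnits F →₀ ℤ

/-- The tautological surjection from the free abelian group on `SepUnits F` onto `SepUnits F`. -/
def resAug : ResZero F →ₗ[ℤ] Additive (SepUnits F) :=
  Finsupp.linearCombination ℤ (fun a : SepUnits F => Additive.ofMul a)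

/-- The kernel of `resAug`. Thus `0 → ResOne → ResZero → SepUnits → 0` is a resolution of
`SepUnits F` by free abelian groups, and for every abelian group `M` the complex
`M ⊗ ResOne → M ⊗ ResZero` (in degrees `-1, 0`) represents `M ⊗ᴸ SepUnits F`. -/
abbrev ResOne : Type u := LinearMap.ker (resAug F)

/-- The Galois action on `ResZero F`. -/
def resZeroRep : Representation ℤ (Gam F) (ResZero F) where
  toFun σ := Finsupp.lmapDomain ℤ ℤ (galUnits F σ)
  map_one' := by
    ext a : 2
    simp
  map_mul' σ τ := by
    ext a : 2
    simp

lemma resAug_resZeroRep (σ : Gam F) (r : ResZero F) :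
    resAug F (resZeroRep F σ r) = MonoidHom.toAdditive (galUnits F σ) (resAug F r) := by
  induction r using Finsupp.induction_linear with
  | zero => simp
  | add f g hf hg => simp only [map_add, hf, hg]
  | single a n =>
    simp only [resAug, resZeroRep, MonoidHom.coe_mk, OneHom.coe_mk, Finsupp.lmapDomain_apply,
      Finsupp.mapDomain_single, Finsupp.linearCombination_single, map_zsmul]
    rfl

/-- The Galois action on `ResOne F`. -/
def resOneRep : Representation ℤ (Gam F) (ResOne F) where
  toFun σ := (resZeroRep F σ).restrict (fun r hr => by
    rw [LinearMap.mem_ker] at hr ⊢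
    rw [resAug_resZeroRep, hr, map_zero])
  map_one' := by ext; simp
  map_mul' σ τ := by ext; simp

variable {F}
variable {M : Type u} [AddCommGroup M] (ρ : Representation ℤ (Gam F) M)

/-- The differential `M ⊗ ResOne → M ⊗ ResZero`. -/
def resDiff (F : Type u) [Field F] (M : Type u) [AddCommGroup M] :
    (M ⊗[ℤ] ResOne F) →ₗ[ℤ] (M ⊗[ℤ] ResZero F) :=
  (LinearMap.ker (resAug F)).subtype.lTensor M

/-- Continuous `0`-hypercocycles of the Galois group with values in the complex of discrete Galois
modules `M ⊗ ResOne → M ⊗ ResZero`: pairs `(p, c)` with `p` in `M ⊗ ResZero` and `c` a continuous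
`1`-cocycle with values in `M ⊗ ResOne`, such that the image of `c` in `M ⊗ ResZero` is the
coboundary of `p`. -/
def hyperCocycles : AddSubgroup ((M ⊗[ℤ] ResZero F) × (Gam F → M ⊗[ℤ] ResOne F)) where
  carrier := {z | IsLocallyConstant z.2 ∧
    (∀ σ τ, z.2 (σ * τ) = z.2 σ + (ρ.tprod (resOneRep F)) σ (z.2 τ)) ∧
    ∀ σ, resDiff F M (z.2 σ) = (ρ.tprod (resZeroRep F)) σ z.1 - z.1}
  zero_mem' := ⟨IsLocallyConstant.const 0, by simp, by simp⟩
  add_mem' := by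
    rintro a b ⟨h1, h2, h3⟩ ⟨h1', h2', h3'⟩
    refine ⟨h1.add h1', fun σ τ => ?_, fun σ => ?_⟩
    · simp only [Prod.snd_add, Pi.add_apply, h2, h2', map_add]; abel
    · simp only [Prod.snd_add, Prod.fst_add, Pi.add_apply, h3, h3', map_add]; abel
  neg_mem' := by
    rintro a ⟨h1, h2, h3⟩
    refine ⟨h1.neg, fun σ τ => ?_, fun σ => ?_⟩
    · simp only [Prod.snd_neg, Pi.neg_apply, h2, map_neg]; abel
    · simp only [Prod.snd_neg, Prod.fst_neg, Pi.neg_apply, h3, map_neg]; abel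

/-- The coboundary map `κ ↦ (image of κ in M ⊗ ResZero, σ ↦ σ κ - κ)`. -/
def hyperCoboundary :
    (M ⊗[ℤ] ResOne F) →+ (M ⊗[ℤ] ResZero F) × (Gam F → M ⊗[ℤ] ResOne F) where
  toFun κ := (resDiff F M κ, fun σ => (ρ.tprod (resOneRep F)) σ κ - κ)
  map_zero' := by ext <;> simp
  map_add' a b := by
    refine Prod.ext (map_add _ _ _) (funext fun σ => ?_)
    simp only [map_add, Prod.snd_add, Pi.add_apply]
    abel

/-- The Galois cohomology group `H¹(F, M(1))`, where `M(1) = M ⊗ᴸ 𝔾ₘ[-1]`; in other words, the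
hypercohomology group `H⁰(F, M ⊗ᴸ 𝔾ₘ)`. -/
abbrev HOne : Type u :=
  hyperCocycles ρ ⧸ (hyperCoboundary ρ).range.addSubgroupOf (hyperCocycles ρ)

/-- The class in `H¹(F, M(1))` of a hypercocycle. -/
def HOne.mk : hyperCocycles ρ →+ HOne ρ := QuotientAddGroup.mk' _

section Functoriality

variable {ρ} {N : Type u} [AddCommGroup N] {ρ' : Representation ℤ (Gam F) N}

lemma tprod_rTensor {P : Type u} [AddCommGroup P] (η : Representation ℤ (Gam F) P)
    (f : ρ.IntertwiningMap ρ') (σ : Gam F) (t : M ⊗[ℤ] P) :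
    f.toLinearMap.rTensor P ((ρ.tprod η) σ t) = (ρ'.tprod η) σ (f.toLinearMap.rTensor P t) := by
  induction t using TensorProduct.induction_on with
  | zero => simp
  | add a b ha hb => simp only [map_add, ha, hb]
  | tmul m p =>
    have := LinearMap.congr_fun (f.isIntertwining' σ) m
    simp only [LinearMap.comp_apply] at this
    simp [this]

lemma resDiff_rTensor (f : M →ₗ[ℤ] N) (t : M ⊗[ℤ] ResOne F) :
    resDiff F N (f.rTensor _ t) = f.rTensor _ (resDiff F M t) := by
  induction t using TensorProduct.induction_on with
  | zero => simp
  | add a b ha hb => simp only [map_add, ha, hb]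
  | tmul m p => rfl

/-- The map on pairs `(p, c)` induced by a homomorphism of Galois modules. -/
def pairMap (f : M →ₗ[ℤ] N) :
    ((M ⊗[ℤ] ResZero F) × (Gam F → M ⊗[ℤ] ResOne F)) →+
      ((N ⊗[ℤ] ResZero F) × (Gam F → N ⊗[ℤ] ResOne F)) :=
  AddMonoidHom.prodMap (f.rTensor (ResZero F)).toAddMonoidHom
    ((f.rTensor (ResOne F)).toAddMonoidHom.compLeft (Gam F))

lemma pairMap_mem (f : ρ.IntertwiningMap ρ')
    {z : (M ⊗[ℤ] ResZero F) × (Gam F → M ⊗[ℤ] ResOne F)} (hz : z ∈ hyperCocycles ρ) :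
    pairMap f.toLinearMap z ∈ hyperCocycles ρ' := by
  obtain ⟨h1, h2, h3⟩ := hz
  refine ⟨h1.comp _, fun σ τ => ?_, fun σ => ?_⟩
  · change f.toLinearMap.rTensor _ (z.2 (σ * τ)) = f.toLinearMap.rTensor _ (z.2 σ) +
      (ρ'.tprod (resOneRep F)) σ (f.toLinearMap.rTensor _ (z.2 τ))
    rw [h2, map_add, tprod_rTensor]
  · change resDiff F N (f.toLinearMap.rTensor _ (z.2 σ)) =
      (ρ'.tprod (resZeroRep F)) σ (f.toLinearMap.rTensor _ z.1) - f.toLinearMap.rTensor _ z.1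
    rw [resDiff_rTensor, h3, map_sub, tprod_rTensor]

/-- The homomorphism `H¹(F, M(1)) → H¹(F, N(1))` induced by a homomorphism of Galois modules. -/
def HOne.map (f : ρ.IntertwiningMap ρ') : HOne ρ →+ HOne ρ' :=
  QuotientAddGroup.map _ _
    (((pairMap f.toLinearMap).comp (hyperCocycles ρ).subtype).codRestrict (hyperCocycles ρ')
      (fun z => pairMap_mem f z.2)) (by
    rintro ⟨z, hz⟩ ⟨κ, hκ⟩
    refine ⟨f.toLinearMap.rTensor _ κ, ?_⟩
    change hyperCoboundary ρ κ = z at hκ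
    subst hκ
    refine Prod.ext (resDiff_rTensor _ _) (funext fun σ => ?_)
    change (ρ'.tprod (resOneRep F)) σ (f.toLinearMap.rTensor _ κ) - f.toLinearMap.rTensor _ κ =
      f.toLinearMap.rTensor _ ((ρ.tprod (resOneRep F)) σ κ - κ)
    rw [map_sub, tprod_rTensor])

lemma HOne.map_mk (f : ρ.IntertwiningMap ρ') (z : hyperCocycles ρ) :
    HOne.map f (HOne.mk ρ z) = HOne.mk ρ' ⟨pairMap f.toLinearMap z.1, pairMap_mem f z.2⟩ := rfl

/-- The homomorphism `H⁰(F, M) → H⁰(F, N)` on invariants induced by a homomorphism of Galois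
modules. -/
def invMap (f : ρ.IntertwiningMap ρ') : ρ.invariants →+ ρ'.invariants :=
  (f.toLinearMap.restrict (p := ρ.invariants) (q := ρ'.invariants) (fun m hm σ => by
    have := LinearMap.congr_fun (f.isIntertwining' σ) m
    simp only [LinearMap.comp_apply] at this
    rw [← this, hm σ])).toAddMonoidHom

end Functoriality

end Galois

/-! ### Étale sheaves, stalks -/

variable {X : Scheme.{u}}

/-- Sheaves of abelian groups on the small étale site of `X`. -/
abbrev EtaleSheaf (X : Scheme.{u}) : Type (u + 1) := Sheaf X.smallEtaleTopology Ab.{u}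

/-- The algebraic closure of the residue field at `x`. -/
abbrev Om (x : X) : Type u := AlgebraicClosure (X.residueField x)

/-- The geometric point of `X` over the point `x`. -/
def geomPoint (x : X) : Spec (.of (Om x)) ⟶ X :=
  Spec.map (CommRingCat.ofHom (algebraMap (X.residueField x) (Om x))) ≫ X.fromSpecResidueField x

/-- The stalk of an étale sheaf at the geometric point over `x`. -/
abbrev stalk (E : EtaleSheaf X) (x : X) : Ab.{u} :=
  (Scheme.pointSmallEtale (geomPoint x)).sheafFiber.obj E

/-- The germ, in the stalk at the geometric point over `x`, of a section over an étale
neighbourhood `U` with a lift `v` of the geometric point to `U`. -/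
def germ (E : EtaleSheaf X) (x : X) (U : X.Etale) (v : Spec (.of (Om x)) ⟶ U.left)
    (hv : v ≫ U.hom = geomPoint x) : E.obj.obj (op U) ⟶ stalk E x :=
  (Scheme.pointSmallEtale (geomPoint x)).toPresheafFiber U (Over.homMk v hv) E.obj

lemma specMap_geomPoint (x : X) (σ : Gam (X.residueField x)) :
    Spec.map (CommRingCat.ofHom (σ : Om x →+* Om x)) ≫ geomPoint x = geomPoint x := by
  rw [geomPoint, ← Category.assoc, ← Spec.map_comp]
  congr 2
  ext a
  simp

/-- The endomorphism of the geometric point over `x`, seen as a point of the étale site, given by an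
element of the Galois group. On lifts `v` of the geometric point it is `v ↦ Spec(σ) ≫ v`. -/
def galPoint (x : X) (σ : Gam (X.residueField x)) :
    Scheme.pointSmallEtale (geomPoint x) ⟶ Scheme.pointSmallEtale (geomPoint x) where
  hom := Functor.whiskerLeft _ (coyoneda.map (Quiver.Hom.op
    (Over.homMk (Spec.map (CommRingCat.ofHom (σ : Om x →+* Om x))) (specMap_geomPoint x σ))))

lemma galPoint_one (x : X) : galPoint x 1 = 𝟙 _ := by
  ext U v
  refine Over.OverMorphism.ext ?_
  change Spec.map (CommRingCat.ofHom (RingHom.id (Om x))) ≫ v.left = v.left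
  erw [Spec.map_id, Category.id_comp]

lemma galPoint_mul (x : X) (σ τ : Gam (X.residueField x)) :
    galPoint x (σ * τ) = galPoint x σ ≫ galPoint x τ := by
  ext U v
  refine Over.OverMorphism.ext ?_
  change Spec.map (CommRingCat.ofHom ((σ * τ : Gam _) : Om x →+* Om x)) ≫ v.left =
    Spec.map (CommRingCat.ofHom (σ : Om x →+* Om x)) ≫
      Spec.map (CommRingCat.ofHom (τ : Om x →+* Om x)) ≫ v.left
  rw [← Category.assoc, ← Spec.map_comp]
  rfl

/-- The Galois module `E_x`: the action of the Galois group of the residue field on the stalk. -/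
def stalkRep (E : EtaleSheaf X) (x : X) :
    Representation ℤ (Gam (X.residueField x)) (stalk E x) where
  toFun σ := ((galPoint x σ).sheafFiber.app E).hom.toIntLinearMap
  map_one' := by
    rw [galPoint_one, GrothendieckTopology.Point.Hom.sheafFiber_id]
    rfl
  map_mul' σ τ := by
    rw [galPoint_mul, GrothendieckTopology.Point.Hom.sheafFiber_comp]
    rfl

/-- The map on stalks induced by a morphism of étale sheaves, as a map of Galois modules. -/
def stalkMap {E E' : EtaleSheaf X} (f : E ⟶ E') (x : X) :
    (stalkRep E x).IntertwiningMap (stalkRep E' x) where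
  toLinearMap := ((Scheme.pointSmallEtale (geomPoint x)).sheafFiber.map f).hom.toIntLinearMap
  isIntertwining' σ := by
    refine LinearMap.ext fun m => ?_
    exact (ConcreteCategory.congr_hom ((galPoint x σ).sheafFiber.naturality f) m).symm

lemma stalkMap_germ {E E' : EtaleSheaf X} (f : E ⟶ E') (x : X) (U : X.Etale)
    (v : Spec (.of (Om x)) ⟶ U.left) (hv : v ≫ U.hom = geomPoint x) (s : E.obj.obj (op U)) :
    (stalkMap f x).toLinearMap (germ E x U v hv s) = germ E' x U v hv (f.hom.app (op U) s) :=
  (Scheme.pointSmallEtale (geomPoint x)).toPresheafFiber_naturality_apply f.hom U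
    (Over.homMk v hv) s

/-- `H⁰(k(x), E)`: the Galois invariants of the stalk. -/
abbrev HZeroAt (E : EtaleSheaf X) (x : X) : Type u := (stalkRep E x).invariants

/-- `H¹(k(x), E(1))`. -/
abbrev HOneAt (E : EtaleSheaf X) (x : X) : Type u := HOne (stalkRep E x)

/-! ### The residue map -/

/-- A branch of the closure of `x` along `y`: a valuation ring `V` of `k(x)` with a morphism
`Spec V ⟶ X` extending the point `x` and sending the closed point to `y`, together with a
`k(y)`-embedding of the residue field `k(V)` into the algebraic closure of `k(y)`. The embedding is
recorded as a ring homomorphism `τ` on `V`, whose image is the subfield `L`, so that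
`L ≅ k(V)` over `k(y)`. If the closures of `x` and `y` have dimensions `i + 1` and `i`, then
the rings `V` which occur are the discrete valuation rings given by the points lying over `y` of the
normalization of the closure of `x`. -/
structure Branch (x y : X) where
  /-- the valuation ring -/
  V : ValuationSubring (X.residueField x)
  /-- the image of the residue field -/
  L : IntermediateField (X.residueField y) (Om y)
  /-- the embedding of the residue field, as a map on `V` -/
  τ : V →+* Om y
  range_eq : Set.range τ = L
  center : ∃ t : Spec (.of V) ⟶ X,
    Spec.map (CommRingCat.ofHom V.subtype) ≫ t = X.fromSpecResidueField x ∧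
      Spec.map (CommRingCat.ofHom τ) ≫ t = geomPoint y

/-- Let `W` be a valuation ring of the algebraic closure of `k(x)` and `τ` a homomorphism from `W`
to the algebraic closure of `k(y)`. The stalk elements `e` at `y` and `e₀` at `x` correspond to each
other if they come from one section over an étale neighbourhood of `Spec W`. For a locally
constant sheaf and a morphism `Spec W ⟶ X` this is the graph of an isomorphism of stalks. -/
def Cospecializes (E : EtaleSheaf X) {x y : X} (W : ValuationSubring (Om x)) (τ : W →+* Om y)
    (e : stalk E y) (e₀ : stalk E x) : Prop :=
  ∃ (U : X.Etale) (w : Spec (.of W) ⟶ U.left)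
    (hx : (Spec.map (CommRingCat.ofHom W.subtype) ≫ w) ≫ U.hom = geomPoint x)
    (hy : (Spec.map (CommRingCat.ofHom τ) ≫ w) ≫ U.hom = geomPoint y)
    (s : E.obj.obj (op U)), germ E y U _ hy s = e ∧ germ E x U _ hx s = e₀

/-- The inertia group of a valuation ring of the algebraic closure, as a subgroup of the Galois
group. -/
def inertia {F : Type u} [Field F] (W : ValuationSubring (AlgebraicClosure F)) :
    Subgroup (Gam F) :=
  (W.inertiaSubgroup F).map (W.decompositionSubgroup F).subtype

/-- The element `∑ₐ q(a) ⊗ [a]` of `M ⊗ ResZero`. -/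
def tensorOf {F : Type u} [Field F] {M : Type u} [AddCommGroup M] (q : SepUnits F →₀ M) :
    M ⊗[ℤ] ResZero F :=
  q.sum fun a m => m ⊗ₜ[ℤ] (Finsupp.single a 1 : ResZero F)

/-- `IsResidueOf W v (p, c) e` says that the residue of the class of the hypercocycle `(p, c)` with
respect to the valuation ring `W` of the algebraic closure is `e`. Let `Fnr` be the fixed field of
the inertia group `I` in the separable closure (the fraction field of the strict henselization).
Since `H¹(I, 𝔾ₘ) = 0`, if `I` acts trivially on `M` then `H⁰(I, M ⊗ᴸ 𝔾ₘ) = M ⊗ Fnrˣ`: the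
restriction of `(p, c)` to `I` is cohomologous to `(∑ₐ q(a) ⊗ [a], 0)` with `q` supported on `Fnrˣ`.
The residue is then `∑ₐ ord(a) q(a)`. Here `ord` is the valuation on `Fnr`, normalized by `ord π = 1`
for the uniformizer `π` of the base field. -/
def IsResidueOf {F : Type u} [Field F] {M : Type u} [AddCommGroup M]
    (ρ : Representation ℤ (Gam F) M) (W : ValuationSubring (AlgebraicClosure F)) (π : F)
    (z : (M ⊗[ℤ] ResZero F) × (Gam F → M ⊗[ℤ] ResOne F)) (e : M) : Prop :=
  ∃ (κ : M ⊗[ℤ] ResOne F) (q : SepUnits F →₀ M) (ord : SepUnits F → ℤ),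
    (∀ a ∈ q.support, ∀ σ ∈ inertia W, galUnits F σ a = a) ∧
    z.1 = tensorOf q + (hyperCoboundary ρ κ).1 ∧
    (∀ σ ∈ inertia W, z.2 σ = (hyperCoboundary ρ κ).2 σ) ∧
    (∀ a ∈ q.support, W.valuation (a : separableClosure F (AlgebraicClosure F)) =
      W.valuation (algebraMap F (AlgebraicClosure F) π) ^ ord a) ∧
    e = q.sum fun a m => ord a • m

/-- `IsLocalResidue E b α e` says that `e`, in the stalk at `y`, is the residue of the class `α`
in `H¹(k(x), E(1))` along the branch `b`. One chooses a valuation ring `W` of the algebraic closure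
of `k(x)` over `b.V` and an extension of the embedding `b.τ` to `W`, takes the residue with respect
to `W` in the stalk at `x`, and moves it to the stalk at `y`. -/
def IsLocalResidue (E : EtaleSheaf X) {x y : X} (b : Branch x y) (α : HOneAt E x)
    (e : stalk E y) : Prop :=
  ∃ (z : hyperCocycles (stalkRep E x)) (W : ValuationSubring (Om x)) (τ : W →+* Om y)
    (π : b.V) (e₀ : stalk E x),
    HOne.mk _ z = α ∧
    W.comap (algebraMap (X.residueField x) (Om x)) = b.V ∧
    (∀ (a : b.V) (ha : algebraMap (X.residueField x) (Om x) a ∈ W), τ ⟨_, ha⟩ = b.τ a) ∧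
    Irreducible π ∧
    IsResidueOf (stalkRep E x) W (π : X.residueField x) z e₀ ∧
    Cospecializes E W τ e e₀

variable (X) in
/-- The set `X₍ᵢ₎` of points whose closure has dimension `i`. -/
def pointsOfDim (i : ℤ) : Set X :=
  {x | ∃ n : ℕ, (n : ℤ) = i ∧ topologicalKrullDim (closure ({x} : Set X)) = n}

/-- The group `⨁ H⁰(k(x), E)` over the points `x` in `X₍ᵢ₎`. -/
abbrev Cycles (E : EtaleSheaf X) (i : ℤ) : Type u :=
  DirectSum (pointsOfDim X i) fun x => HZeroAt E x.1

/-- The graph of the residue homomorphism `H¹(k(x), E(1)) → ⨁ H⁰(k(y), E)`, the sum over the `y` in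
`X₍ᵢ₎`. The component at `y` is the sum, over the points `v` of the normalization of the closure of
`x` above `y`, of the transfers from `k(v)` to `k(y)` of the residues at `v`. The transfer on `H⁰` is
the sum over the embeddings of `k(v)` in the algebraic closure of `k(y)`, multiplied by
the inseparable degree of `k(v)` over `k(y)`. -/
def IsBoundary (E : EtaleSheaf X) (i : ℤ) (x : X) (α : HOneAt E x) (z : Cycles E i) : Prop :=
  ∃ r : ∀ y : pointsOfDim X i, Branch x y.1 → stalk E y.1,
    ∀ y : pointsOfDim X i,
      (∀ b, IsLocalResidue E b α (r y b)) ∧ (Function.support (r y)).Finite ∧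
      (z y : stalk E y.1) = ∑ᶠ b, Field.finInsepDegree (X.residueField y.1) b.L • r y b

/-- The image of the residue homomorphism
`⨁ H¹(k(x), E(1)) → ⨁ H⁰(k(y), E)`, where `x` runs over `X₍ᵢ₊₁₎` and `y` over `X₍ᵢ₎`. -/
def boundaries (E : EtaleSheaf X) (i : ℤ) : AddSubgroup (Cycles E i) :=
  AddSubgroup.closure
    {z | ∃ x ∈ pointsOfDim X (i + 1), ∃ α : HOneAt E x, IsBoundary E i x α z}

/-- The twisted Chow group `CHᵢ(X, E)`. -/
abbrev CH (E : EtaleSheaf X) (i : ℤ) : Type u := Cycles E i ⧸ boundaries E i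

section Functoriality

variable {E E' : EtaleSheaf X} (f : E ⟶ E')

/-- The homomorphism `⨁ H⁰(k(x), E) → ⨁ H⁰(k(x), E')` induced by a morphism of sheaves. -/
def cyclesMap (i : ℤ) : Cycles E i →+ Cycles E' i :=
  DirectSum.map fun x => invMap (stalkMap f x.1)

lemma IsResidueOf.map {F : Type u} [Field F] {M N : Type u} [AddCommGroup M] [AddCommGroup N]
    {ρ : Representation ℤ (Gam F) M} {ρ' : Representation ℤ (Gam F) N}
    {W : ValuationSubring (AlgebraicClosure F)} {π : F}
    {z : (M ⊗[ℤ] ResZero F) × (Gam F → M ⊗[ℤ] ResOne F)} {e : M} (h : IsResidueOf ρ W π z e)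
    (f : ρ.IntertwiningMap ρ') :
    IsResidueOf ρ' W π (pairMap f.toLinearMap z) (f.toLinearMap e) := by
  obtain ⟨κ, q, ord, h1, h2, h3, h4, h5⟩ := h
  have hs : (q.mapRange f.toLinearMap (map_zero _)).support ⊆ q.support :=
    Finsupp.support_mapRange
  refine ⟨f.toLinearMap.rTensor _ κ, q.mapRange f.toLinearMap (map_zero _), ord,
    fun a ha => h1 a (hs ha), ?_, fun σ hσ => ?_, fun a ha => h4 a (hs ha), ?_⟩
  · change f.toLinearMap.rTensor _ z.1 =
      tensorOf (q.mapRange f.toLinearMap (map_zero _)) + resDiff F N (f.toLinearMap.rTensor _ κ)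
    rw [h2, map_add, resDiff_rTensor]
    congr 1
    rw [tensorOf, tensorOf, Finsupp.sum_mapRange_index (by simp), Finsupp.sum, Finsupp.sum, map_sum]
    simp
  · change f.toLinearMap.rTensor _ (z.2 σ) =
      (ρ'.tprod (resOneRep F)) σ (f.toLinearMap.rTensor _ κ) - f.toLinearMap.rTensor _ κ
    rw [h3 σ hσ, ← tprod_rTensor, ← map_sub]
    rfl
  · rw [h5, Finsupp.sum_mapRange_index (by simp), Finsupp.sum, Finsupp.sum, map_sum]
    simp

lemma Cospecializes.map {x y : X} {W : ValuationSubring (Om x)} {τ : W →+* Om y}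
    {e : stalk E y} {e₀ : stalk E x} (h : Cospecializes E W τ e e₀) :
    Cospecializes E' W τ ((stalkMap f y).toLinearMap e) ((stalkMap f x).toLinearMap e₀) := by
  obtain ⟨U, w, hx, hy, s, rfl, rfl⟩ := h
  exact ⟨U, w, hx, hy, f.hom.app (op U) s, (stalkMap_germ f y U _ hy s).symm,
    (stalkMap_germ f x U _ hx s).symm⟩

lemma IsLocalResidue.map {x y : X} {b : Branch x y} {α : HOneAt E x} {e : stalk E y}
    (h : IsLocalResidue E b α e) :
    IsLocalResidue E' b (HOne.map (stalkMap f x) α) ((stalkMap f y).toLinearMap e) := by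
  obtain ⟨z, W, τ, π, e₀, rfl, h1, h2, h3, h4, h5⟩ := h
  exact ⟨⟨_, pairMap_mem (stalkMap f x) z.2⟩, W, τ, π, _, (HOne.map_mk _ z).symm, h1, h2, h3,
    h4.map (stalkMap f x), h5.map f⟩

lemma IsBoundary.map {i : ℤ} {x : X} {α : HOneAt E x} {z : Cycles E i}
    (h : IsBoundary E i x α z) :
    IsBoundary E' i x (HOne.map (stalkMap f x) α) (cyclesMap f i z) := by
  obtain ⟨r, hr⟩ := h
  refine ⟨fun y b => (stalkMap f y.1).toLinearMap (r y b), fun y => ?_⟩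
  obtain ⟨h1, h2, h3⟩ := hr y
  refine ⟨fun b => (h1 b).map f, h2.subset fun b hb hb' => hb ?_, ?_⟩
  · change (stalkMap f y.1).toLinearMap (r y b) = 0
    rw [hb', map_zero]
  · change (stalkMap f y.1).toLinearMap (z y : stalk E y.1) = _
    rw [h3]
    have := AddMonoidHom.map_finsum (stalkMap f y.1).toLinearMap.toAddMonoidHom
      (f := fun b : Branch x y.1 => Field.finInsepDegree (X.residueField y.1) b.L • r y b)
      (h2.subset fun b hb hb' => hb (by simp [hb']))
    refine this.trans (finsum_congr fun b => ?_)
    exact map_nsmul _ _ _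

/-- The homomorphism `CHᵢ(X, E) → CHᵢ(X, E')` induced by a morphism of étale sheaves. -/
def CH.map (i : ℤ) : CH E i →+ CH E' i :=
  QuotientAddGroup.map _ _ (cyclesMap f i) (by
    rw [boundaries, AddSubgroup.closure_le]
    rintro z ⟨x, hx, α, h⟩
    exact AddSubgroup.subset_closure ⟨x, hx, _, h.map f⟩)

end Functoriality

/-! ### Locally constant sheaves -/

/-- An isomorphism of the restriction of `E` to `U` with the constant sheaf `M` on `U`, whose
sections over `V ⟶ U` are the locally constant functions from `V` to `M`. -/
structure Trivialization (E : EtaleSheaf X) (U : X.Etale) (M : Type u) [AddCommGroup M] where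
  /-- the isomorphism on sections -/
  iso : ∀ {V : X.Etale}, (V ⟶ U) → (E.obj.obj (op V) ≃+ LocallyConstant V.left M)
  naturality : ∀ {V V' : X.Etale} (g : V' ⟶ V) (f : V ⟶ U) (s : E.obj.obj (op V)),
    iso (g ≫ f) (E.obj.map g.op s) = (iso f s).comap g.left.base.hom

/-- An étale sheaf is naively locally constant if it is constant on an étale covering. -/
def IsNaivelyLocallyConstant (E : EtaleSheaf X) : Prop :=
  ∀ x : X, ∃ (U : X.Etale) (M : Type u) (_ : AddCommGroup M),
    x ∈ Set.range U.hom ∧ Nonempty (Trivialization E U M)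

/-- An étale sheaf is locally constant if it is a direct limit of naively locally constant
sheaves. -/
def IsLocallyConstantSheaf (E : EtaleSheaf X) : Prop :=
  ∃ (J : Type u) (_ : SmallCategory J) (_ : IsFiltered J) (D : J ⥤ EtaleSheaf X)
    (c : Limits.Cocone D), (∀ j, IsNaivelyLocallyConstant (D.obj j)) ∧
      Nonempty (Limits.IsColimit c) ∧ Nonempty (c.pt ≅ E)

/-! ### Coflasque and invertible sheaves -/

section Lattices

variable {R : Type u} [CommRing R] {G : Type u} [Group G] {M : Type u} [AddCommGroup M] [Module R M]

/-- An `RG`-module is coflasque if `H¹(H, M) = 0` for every subgroup `H` of `G`. -/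
def IsCoflasqueRep (ρ : Representation R G M) : Prop :=
  ∀ H : Subgroup G, Subsingleton (groupCohomology.H1 (Rep.of (ρ.comp H.subtype)))

/-- An `RG`-module is invertible if it is a direct summand of a permutation module `R[S]`, with `S` a
finite `G`-set. -/
def IsInvertibleRep (ρ : Representation R G M) : Prop :=
  ∃ (S : Type u) (_ : Finite S) (_ : MulAction G S)
    (ι : ρ.IntertwiningMap (Representation.ofMulAction R G S))
    (p : (Representation.ofMulAction R G S).IntertwiningMap ρ),
    ∀ m, p.toLinearMap (ι.toLinearMap m) = m

end Lattices

/-- A description of an étale sheaf `E`, over an open and closed subset of `X`, by a lattice over a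
finite quotient of the fundamental group: a finite étale `Y ⟶ X` which is a torsor under a finite
group `G` over its image, an `RG`-lattice `M`, and a `G`-equivariant isomorphism of the pullback
of `E` to `Y` with the constant sheaf `M`. -/
structure LatticeModel (R : Type u) [CommRing R] (E : EtaleSheaf X) where
  /-- the covering -/
  Y : X.Etale
  isFinite : IsFinite Y.hom
  /-- the finite group -/
  G : Type u
  [group : Group G]
  [finite : Finite G]
  /-- the action on the covering -/
  act : G →* Aut Y
  simply_transitive : ∀ (Ω : Type u) [Field Ω] [IsAlgClosed Ω] (y y' : Spec (.of Ω) ⟶ Y.left),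
    y ≫ Y.hom = y' ≫ Y.hom → ∃! g : G, y ≫ (act g).hom.left = y'
  /-- the lattice -/
  M : Type u
  [addCommGroup : AddCommGroup M]
  [module : Module R M]
  [moduleFinite : Module.Finite R M]
  [projective : Module.Projective R M]
  /-- the action on the lattice -/
  ρ : Representation R G M
  /-- the trivialization on the covering -/
  triv : Trivialization E Y M
  equivariant : ∀ (g : G) {V : X.Etale} (f : V ⟶ Y) (s : E.obj.obj (op V)) (v : V.left),
    triv.iso (f ≫ (act g).hom) s v = ρ g (triv.iso f s v)

attribute [instance] LatticeModel.group LatticeModel.finite LatticeModel.addCommGroup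
  LatticeModel.module LatticeModel.moduleFinite LatticeModel.projective

/-- An étale sheaf is coflasque over `R` if, on each connected component of `X`, it corresponds to a
coflasque lattice over `R` for some finite quotient of the fundamental group. -/
def IsCoflasque (R : Type u) [CommRing R] (E : EtaleSheaf X) : Prop :=
  ∀ x : X, ∃ D : LatticeModel R E, x ∈ Set.range D.Y.hom ∧ IsCoflasqueRep D.ρ

/-- An étale sheaf is invertible over `R` if, on each connected component of `X`, it corresponds to
an invertible lattice over `R` for some finite quotient of the fundamental group. -/
def IsInvertible (R : Type u) [CommRing R] (E : EtaleSheaf X) : Prop :=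
  ∀ x : X, ∃ D : LatticeModel R E, x ∈ Set.range D.Y.hom ∧ IsInvertibleRep D.ρ

end TwistedChow

end

noncomputable section

namespace TwistedChow

/-! ### Stalks at geometric points: germs, exactness, filtered colimits. -/

section Stalks

variable {X : Scheme.{u}}

/-! Stalks at geometric points turn the sequence into exact sequences of discrete Galois modules 0 →
A_x → B_x → C_x → 0, and the theorem rests on two vanishing statements over the fields k(x),
together with the fact that residues are well defined.

Cycles. Invariants are left exact, so cycles are always exact in the middle (`cyclesMap_exact`). The
obstruction to surjectivity at x is a class in H¹(k(x), A_x) (`invMap_surjective`). If A is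
coflasque, a cocycle is a homomorphism on the subgroup that acts trivially on the lattice. A
continuous homomorphism from such a subgroup to a torsion-free group is zero (`eq_zero_of_map_mul`),
so the class comes from a subgroup of the finite group and vanishes
(`hasTrivialHOne_of_isCoflasqueRep`). An invertible lattice is a retract of a permutation lattice,
where the vanishing is Shapiro's lemma plus the same remark (`hasTrivialHOne_of_isInvertibleRep`).
Surjectivity on cycles gives surjectivity on Chow groups.

Boundaries. Exactness in the middle further needs every boundary of C to be the image of a boundary
of B (`CH.map_exact`). A class in H¹(k(x), C(1)) lifts to H¹(k(x), B(1)) up to an obstruction in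
H²(k(x), A(1)), which is H¹(k(x), A ⊗ 𝔾ₘ) because A is flat over ℤ (`HOne.map_surjective`). For
invertible A this is a retract of the cohomology of R ⊗ (functions S → 𝔾ₘ). It vanishes by Hilbert
90 (`hasTrivialHOne_unitsPi`) and flatness of R (`HasTrivialHOne.tprod_one`).

Residues. The residue map is given by its graph, so the lifted class must be shown to possess a
residue, and the image of that residue must be the given one. For existence, flatness of A lets a
local residue lift from C to B (`exists_isLocalResidue`). The local residues assemble into a cycle
because there are finitely many branches along each point (`finite_branch`, by Krull–Akizuki) and
residues vanish near x (`exists_isOpen_isLocalResidue_zero`).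

Uniqueness (`IsLocalResidue.unique`) has three ingredients. Two extensions of a valuation with
compatible residue embeddings are conjugate (`exists_algEquiv_of_comap_eq`). Elements fixed by
inertia have the valuation of a power of the uniformizer (`exists_zpow_valuation_eq`), which makes
the order function, and hence the residue, well defined. Finally, cospecialization is well defined
for a locally constant sheaf, because étale neighbourhoods of the closed point lift over a valuation
ring of an algebraically closed field (`exists_lift_of_etale`). -/

lemma germ_surjective (E : EtaleSheaf X) (x : X) (e : stalk E x) :
    ∃ (U : X.Etale) (v : Spec (.of (Om x)) ⟶ U.left) (hv : v ≫ U.hom = geomPoint x)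
      (s : E.obj.obj (op U)), germ E x U v hv s = e := by
  obtain ⟨U, v, s, rfl⟩ :=
    (Scheme.pointSmallEtale (geomPoint x)).toPresheafFiber_jointly_surjective (P := E.obj) e
  exact ⟨U, v.left, Over.w v, s, rfl⟩

lemma germ_map (E : EtaleSheaf X) (x : X) {U V : X.Etale} (f : V ⟶ U)
    (v : Spec (.of (Om x)) ⟶ V.left) (hv : v ≫ V.hom = geomPoint x)
    (hv' : (v ≫ f.left) ≫ U.hom = geomPoint x) (s : E.obj.obj (op U)) :
    germ E x V v hv (E.obj.map f.op s) = germ E x U (v ≫ f.left) hv' s :=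
  (Scheme.pointSmallEtale (geomPoint x)).toPresheafFiber_w_apply f (Over.homMk v hv) E.obj s

lemma germ_eq_zero (E : EtaleSheaf X) (x : X) {U : X.Etale}
    (v : Spec (.of (Om x)) ⟶ U.left) (hv : v ≫ U.hom = geomPoint x) (s : E.obj.obj (op U))
    (h : germ E x U v hv s = 0) :
    ∃ (V : X.Etale) (f : V ⟶ U) (v' : Spec (.of (Om x)) ⟶ V.left), v' ≫ f.left = v ∧
      E.obj.map f.op s = 0 := by
  have h2 : germ E x U v hv s = germ E x U v hv 0 := by rw [h, map_zero]
  obtain ⟨V, f, v', h3, h4⟩ := ((Scheme.pointSmallEtale (geomPoint x)).toPresheafFiber_eq_iff'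
    U (Over.homMk v hv) s 0).1 h2
  refine ⟨V, f, v'.left, congr_arg (fun z => z.left) h3, ?_⟩
  rw [h4, map_zero]

lemma stalkRep_germ (E : EtaleSheaf X) (x : X) (σ : Gam (X.residueField x)) {U : X.Etale}
    (v : Spec (.of (Om x)) ⟶ U.left) (hv : v ≫ U.hom = geomPoint x)
    (hv' : (Spec.map (CommRingCat.ofHom (σ : Om x →+* Om x)) ≫ v) ≫ U.hom = geomPoint x)
    (s : E.obj.obj (op U)) :
    stalkRep E x σ (germ E x U v hv s) =
      germ E x U (Spec.map (CommRingCat.ofHom (σ : Om x →+* Om x)) ≫ v) hv' s := by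
  exact ConcreteCategory.congr_hom
    ((Scheme.pointSmallEtale (geomPoint x)).toPresheafFiber_presheafFiberDesc _ _ U
      (Over.homMk v hv)) s

lemma stalk_shortExact {S : ShortComplex (EtaleSheaf X)} (hS : S.ShortExact) (x : X) :
    (S.map (Scheme.pointSmallEtale (geomPoint x)).sheafFiber).ShortExact := 
  hS.map_of_exact _

lemma stalkMap_injective {S : ShortComplex (EtaleSheaf X)} (hS : S.ShortExact) (x : X) :
    Function.Injective (stalkMap S.f x).toLinearMap :=
  (stalk_shortExact hS x).ab_injective_f

lemma stalkMap_surjective {S : ShortComplex (EtaleSheaf X)} (hS : S.ShortExact) (x : X) :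
    Function.Surjective (stalkMap S.g x).toLinearMap :=
  (stalk_shortExact hS x).ab_surjective_g

lemma stalkMap_exact {S : ShortComplex (EtaleSheaf X)} (hS : S.ShortExact) (x : X) :
    Function.Exact (stalkMap S.f x).toLinearMap (stalkMap S.g x).toLinearMap :=
  (ShortComplex.ab_exact_iff_function_exact _).1 (stalk_shortExact hS x).exact

section Colimit

variable {J : Type u} [SmallCategory J] [IsFiltered J] {D : J ⥤ EtaleSheaf X}
    {c : Limits.Cocone D} 

lemma exists_stalkMap_eq (hc : Limits.IsColimit c) (x : X) (e : stalk c.pt x) :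
    ∃ (j : J) (e' : stalk (D.obj j) x), (stalkMap (c.ι.app j) x).toLinearMap e' = e := by
  have h := Limits.isColimitOfPreserves
    ((Scheme.pointSmallEtale (geomPoint x)).sheafFiber ⋙ forget Ab.{u}) hc
  obtain ⟨j, e', h⟩ := Limits.Types.jointly_surjective_of_isColimit h e
  exact ⟨j, e', h⟩

lemma exists_stalkMap_eq_zero (hc : Limits.IsColimit c) (x : X) (j : J) (e : stalk (D.obj j) x)
    (he : (stalkMap (c.ι.app j) x).toLinearMap e = 0) :
    ∃ (j' : J) (f : j ⟶ j'), (stalkMap (D.map f) x).toLinearMap e = 0 := by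
  have h := Limits.isColimitOfPreserves
    ((Scheme.pointSmallEtale (geomPoint x)).sheafFiber ⋙ forget Ab.{u}) hc
  have he' : (stalkMap (c.ι.app j) x).toLinearMap e = (stalkMap (c.ι.app j) x).toLinearMap 0 := by
    rw [he, map_zero]
  obtain ⟨k, f, h⟩ := (Limits.Types.FilteredColimit.isColimit_eq_iff' h e (0 : stalk (D.obj j) x)).1 he'
  exact ⟨k, f, h.trans (map_zero (stalkMap (D.map f) x).toLinearMap)⟩

end Colimit

end Stalks

/-! ### Valuation rings of algebraically closed fields are strictly henselian. -/

section HenselLift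

open Polynomial

/-- `W` is integrally closed in an algebraically closed field, so a monic polynomial splits into
linear factors over `W`. Applying `τ` to the factorization, one of the factors must vanish at `θ`.
-/
lemma exists_root_of_monic {Ω k : Type*} [Field Ω] [IsAlgClosed Ω] [Field k]
    (W : ValuationSubring Ω) (τ : W →+* k) (θ : k) (f : W[X]) (hf : f.Monic)
    (h : f.eval₂ τ θ = 0) : ∃ a : W, f.IsRoot a ∧ τ a = θ := by
  induction hn : f.natDegree generalizing f with
  | zero =>
    rw [eq_one_of_monic_natDegree_zero hf hn] at h
    simp at h
  | succ n ih =>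
    have hd : (f.map (algebraMap W Ω)).degree ≠ 0 := by
      rw [hf.degree_map, degree_eq_natDegree hf.ne_zero, hn]
      exact_mod_cast n.succ_ne_zero
    obtain ⟨a, ha⟩ := IsAlgClosed.exists_root _ hd
    have hint : IsIntegral W a := ⟨f, hf, by rwa [IsRoot.def, Polynomial.eval_map] at ha⟩
    obtain ⟨a, rfl⟩ := IsIntegrallyClosed.isIntegral_iff.1 hint
    have hroot : f.IsRoot a := by
      rw [IsRoot.def, eval_map_algebraMap, aeval_algebraMap_apply] at ha
      rw [IsRoot.def]
      have := (IsFractionRing.injective W Ω) (ha.trans (map_zero _).symm)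
      simpa using this
    obtain ⟨q, hq⟩ := dvd_iff_isRoot.2 hroot
    have hqm : q.Monic := (monic_X_sub_C a).of_mul_monic_left (hq ▸ hf)
    rw [hq, eval₂_mul] at h
    rcases mul_eq_zero.1 h with h | h
    · rw [eval₂_sub, eval₂_X, eval₂_C, sub_eq_zero] at h
      exact ⟨a, hroot, h.symm⟩
    · obtain ⟨b, hb, hb'⟩ := ih q hqm h (by
        have := (monic_X_sub_C a).natDegree_mul hqm
        rw [← hq, hn, natDegree_X_sub_C] at this
        omega)
      exact ⟨b, by rw [hq, IsRoot.def, eval_mul, show q.eval b = 0 from hb, mul_zero], hb'⟩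

/-- Near the kernel of `χ` the algebra is standard étale, so a homomorphism to `W` is a root of a
monic polynomial at which a second polynomial is invertible. The root is lifted by
`exists_root_of_monic`, and invertibility can be tested after `τ` since `τ` is local. -/
lemma exists_algHom_of_etale {Ω k R : Type*} [Field Ω] [IsAlgClosed Ω] [Field k]
    (W : ValuationSubring Ω) (τ : W →+* k) [IsLocalHom τ] [CommRing R] [Algebra W R]
    [Algebra.Etale W R] (χ : R →+* k) (hχ : χ.comp (algebraMap W R) = τ) :
    ∃ ψ : R →ₐ[W] W, τ.comp ψ.toRingHom = χ := by
  have : (RingHom.ker χ).IsPrime := RingHom.ker_isPrime χ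
  obtain ⟨f, hf, hS⟩ := Algebra.IsEtaleAt.exists_isStandardEtale (R := W) (RingHom.ker χ)
  have hfu : IsUnit (χ f) := by
    rw [isUnit_iff_ne_zero]; exact hf
  let χ' : Localization.Away f →+* k := IsLocalization.Away.lift f hfu
  have hχ' : χ'.comp (algebraMap R _) = χ := IsLocalization.Away.lift_comp f hfu
  have hχW : χ'.comp (algebraMap W _) = τ := by
    rw [IsScalarTower.algebraMap_eq W R, ← RingHom.comp_assoc, hχ', hχ]
  obtain ⟨P⟩ := hS.nonempty_standardEtalePresentation
  have heval : ∀ p : W[X], p.eval₂ τ (χ' P.x) = χ' (aeval P.x p) := by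
    intro p
    rw [aeval_def, hom_eval₂, hχW]
  obtain ⟨a, ha, ha'⟩ := exists_root_of_monic W τ (χ' P.x) P.f P.monic_f (by
    rw [heval, P.hasMap.1, map_zero])
  have hmap : P.HasMap a := by
    refine ⟨by simpa using ha, ?_⟩
    rw [← isUnit_map_iff τ]
    have : τ (aeval a P.g) = χ' (aeval P.x P.g) := by
      rw [← heval, ← ha', coe_aeval_eq_eval, eval₂_at_apply]
    rw [this]
    exact P.hasMap.2.map χ'
  let ψ' : Localization.Away f →ₐ[W] W := (P.lift a hmap).comp P.equivRing.toAlgHom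
  have hψ' : ψ' P.x = a := by simp [ψ']
  refine ⟨ψ'.comp (IsScalarTower.toAlgHom W R _), ?_⟩
  algebraize [τ]
  let χA : Localization.Away f →ₐ[W] k := ⟨χ', fun r => RingHom.congr_fun hχW r⟩
  -- A homomorphism from a standard étale algebra is determined by the image of the generator, and
  -- both sides send it to the same element of `k`.
  have h : (Algebra.ofId W k).comp ψ' = χA := P.hom_ext
    ((congr_arg τ hψ').trans ha')
  ext r
  have := AlgHom.congr_fun h (algebraMap R _ r)
  exact this.trans (RingHom.congr_fun hχ' r)

/-- A lift is a section over `Spec W` of the pullback of `p`. An affine open around the given point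
reduces this to the algebraic statement. It is the source of all later passages from the closed
point to the whole of `Spec W`. -/
lemma exists_lift_of_etale {Ω k : Type u} [Field Ω] [IsAlgClosed Ω] [Field k]
    (W : ValuationSubring Ω) (τ : W →+* k) [IsLocalHom τ] {U U' : Scheme.{u}} (p : U' ⟶ U)
    [Etale p] (w : Spec (.of W) ⟶ U) (v : Spec (.of k) ⟶ U')
    (h : v ≫ p = Spec.map (CommRingCat.ofHom τ) ≫ w) :
    ∃ w' : Spec (.of W) ⟶ U', w' ≫ p = w ∧ Spec.map (CommRingCat.ofHom τ) ≫ w' = v := by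
  let z : Spec (.of k) ⟶ Limits.pullback p w := Limits.pullback.lift v _ h
  obtain ⟨R, j, _, hj, _⟩ := Scheme.exists_affine_mem_range_and_range_subset
    (x := z.base default) (U := ⊤) (by simp)
  have hrange : Set.range z ⊆ Set.range j := by
    rintro _ ⟨a, rfl⟩
    rwa [Subsingleton.elim a default]
  let z' : Spec (.of k) ⟶ Spec R := IsOpenImmersion.lift j z hrange
  have hz' : z' ≫ j = z := IsOpenImmersion.lift_fac j z hrange
  obtain ⟨χ, hχ⟩ := Spec.map_surjective z'
  obtain ⟨φ, hφ⟩ := Spec.map_surjective (j ≫ Limits.pullback.snd p w)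
  have hφe : RingHom.Etale φ.hom := by
    rw [← HasRingHomProperty.Spec_iff (P := @Etale), hφ]
    infer_instance
  have hcomp : φ ≫ χ = CommRingCat.ofHom τ := by
    apply Spec.map_injective
    rw [Spec.map_comp, hφ, hχ, reassoc_of% hz', Limits.pullback.lift_snd]
  algebraize [φ.hom]
  obtain ⟨ψ, hψ⟩ := exists_algHom_of_etale W τ χ.hom (congr_arg CommRingCat.Hom.hom hcomp)
  let s : Spec (.of W) ⟶ Spec R := Spec.map (CommRingCat.ofHom ψ.toRingHom)
  have hs : s ≫ j ≫ Limits.pullback.snd p w = 𝟙 _ := by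
    rw [← hφ, ← Spec.map_comp, ← Spec.map_id]
    congr 1
    ext a
    exact congr_arg Subtype.val (ψ.commutes a)
  have hs' : Spec.map (CommRingCat.ofHom τ) ≫ s = z' := by
    rw [← Spec.map_comp, ← hχ]
    congr 1
    ext a
    exact RingHom.congr_fun hψ a
  refine ⟨s ≫ j ≫ Limits.pullback.fst p w, ?_, ?_⟩
  · rw [Category.assoc, Category.assoc, Limits.pullback.condition, ← Category.assoc j,
      ← Category.assoc s, hs, Category.id_comp]
  · rw [reassoc_of% hs', reassoc_of% hz', Limits.pullback.lift_fst]

end HenselLift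

/-! ### Locally constant sheaves and cospecialization along a valuation ring. -/

section LocallyConstant

variable {X : Scheme.{u}}

lemma exists_etale_prod {U U' : X.Etale} {T : Scheme.{u}} (w : T ⟶ U.left) (w' : T ⟶ U'.left)
    (h : w ≫ U.hom = w' ≫ U'.hom) :
    ∃ (P : X.Etale) (p : P ⟶ U) (p' : P ⟶ U') (v : T ⟶ P.left),
      v ≫ p.left = w ∧ v ≫ p'.left = w' := by
  refine ⟨Scheme.Etale.mk (Limits.pullback.fst U.hom U'.hom ≫ U.hom),
    MorphismProperty.Over.homMk (Limits.pullback.fst U.hom U'.hom) rfl (by trivial),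
    MorphismProperty.Over.homMk (Limits.pullback.snd U.hom U'.hom)
      Limits.pullback.condition.symm (by trivial),
    Limits.pullback.lift w w' h, ?_, ?_⟩
  · exact Limits.pullback.lift_fst _ _ _
  · exact Limits.pullback.lift_snd _ _ _

lemma left_comp_hom {U V : X.Etale} (f : V ⟶ U) : f.left ≫ U.hom = V.hom :=
  CategoryTheory.Over.w ((Scheme.Etale.forget X).map f)

lemma exists_geomPoint_lift (U : X.Etale) (x : X) (hx : x ∈ Set.range U.hom) :
    ∃ v : Spec (.of (Om x)) ⟶ U.left, v ≫ U.hom = geomPoint x := by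
  obtain ⟨a, ha⟩ := hx
  obtain ⟨l, hl, -⟩ := Scheme.exists_fac_of_etale_of_isSepClosed U.hom (geomPoint x) a (by
    rw [ha, geomPoint, Scheme.Hom.comp_apply, Scheme.fromSpecResidueField_apply])
  exact ⟨l, hl⟩

lemma exists_etale_open_mk {Y : Scheme.{u}} (f : Y ⟶ X) [hf : Etale f] (O : Y.Opens) {k : Type u}
    [Field k] (v : Spec (.of k) ⟶ Y) (hv : v default ∈ O) :
    ∃ (V' : X.Etale) (g : V' ⟶ Scheme.Etale.mk f) (v' : Spec (.of k) ⟶ V'.left),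
      v' ≫ g.left = v ∧ ∀ a, g.left a ∈ O := by
  have hO : Set.range v ⊆ Set.range O.ι := by
    rintro _ ⟨a, rfl⟩
    rw [Subsingleton.elim a default]
    simpa using hv
  let l : Spec (.of k) ⟶ O := IsOpenImmersion.lift O.ι v hO
  have hl : l ≫ O.ι = v := IsOpenImmersion.lift_fac _ _ _
  exact ⟨Scheme.Etale.mk (O.ι ≫ f),
    MorphismProperty.Over.homMk O.ι rfl (by trivial), l, hl, fun a => a.2⟩

lemma exists_etale_open (V : X.Etale) (O : V.left.Opens) {k : Type u} [Field k]
    (v : Spec (.of k) ⟶ V.left) (hv : v default ∈ O) :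
    ∃ (V' : X.Etale) (g : V' ⟶ V) (v' : Spec (.of k) ⟶ V'.left), v' ≫ g.left = v ∧
      ∀ a, g.left a ∈ O :=
  exists_etale_open_mk (hf := V.prop) V.hom O v hv

namespace Trivialization

variable {N : EtaleSheaf X} {U : X.Etale} {M : Type u} [AddCommGroup M] (T : Trivialization N U M)

/-- The section over `U` that corresponds to the constant function with value `m`. -/
def const : M →+ N.obj.obj (op U) where
  toFun m := (T.iso (𝟙 U)).symm (LocallyConstant.const _ m)
  map_zero' := map_zero (T.iso (𝟙 U)).symm
  map_add' a b := map_add (T.iso (𝟙 U)).symm (LocallyConstant.const _ a) (LocallyConstant.const _ b)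

lemma iso_const (m : M) : T.iso (𝟙 U) (T.const m) = LocallyConstant.const _ m :=
  (T.iso (𝟙 U)).apply_symm_apply _

lemma iso_map_const {V : X.Etale} (f : V ⟶ U) (m : M) (v : V.left) :
    T.iso f (N.obj.map f.op (T.const m)) v = m := by
  have := T.naturality f (𝟙 U) (T.const m)
  rw [Category.comp_id] at this
  rw [this, iso_const]
  rfl

/-- A locally constant function that vanishes at a point vanishes on an open neighbourhood, and that
neighbourhood is an object of the étale site. -/
lemma germ_eq_zero_iff {V : X.Etale} (f : V ⟶ U) (x : X) (v : Spec (.of (Om x)) ⟶ V.left)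
    (hv : v ≫ V.hom = geomPoint x) (s : N.obj.obj (op V)) :
    germ N x V v hv s = 0 ↔ T.iso f s (v default) = 0 := by
  constructor
  · intro h
    obtain ⟨V', g, v', rfl, h0⟩ := germ_eq_zero N x v hv s h
    have := T.naturality g f s
    rw [h0, map_zero] at this
    exact (DFunLike.congr_fun this (v' default)).symm
  · intro h
    obtain ⟨O, hO'⟩ : ∃ O : V.left.Opens, ∀ a, a ∈ O ↔ T.iso f s a = 0 :=
      ⟨⟨_, (T.iso f s).isLocallyConstant.isOpen_fiber 0⟩, fun a => Iff.rfl⟩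
    obtain ⟨V', g, v', hv', hg⟩ := exists_etale_open V O v ((hO' _).2 h)
    have h0 : N.obj.map g.op s = 0 := by
      apply (T.iso (g ≫ f)).injective
      rw [T.naturality g f s, map_zero]
      ext a
      exact (hO' _).1 (hg a)
    subst hv'
    rw [← germ_map N x g v' (by rw [← left_comp_hom g, ← Category.assoc, hv]), h0, map_zero]

lemma germ_const_surjective (x : X) (v : Spec (.of (Om x)) ⟶ U.left) (hv : v ≫ U.hom = geomPoint x)
    (e : stalk N x) : ∃ m, germ N x U v hv (T.const m) = e := by
  obtain ⟨V, v', hv', s, rfl⟩ := germ_surjective N x e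
  obtain ⟨P, p, p', w, rfl, rfl⟩ := exists_etale_prod v v' (hv.trans hv'.symm)
  have hw : w ≫ P.hom = geomPoint x := by rw [← hv, Category.assoc, left_comp_hom]
  refine ⟨T.iso p (N.obj.map p'.op s) (w default), ?_⟩
  rw [← germ_map N x p w hw, ← germ_map N x p' w hw, ← sub_eq_zero, ← map_sub,
    T.germ_eq_zero_iff p, map_sub]
  rw [LocallyConstant.sub_apply, iso_map_const, sub_self]

lemma germ_const_injective (x : X) (v : Spec (.of (Om x)) ⟶ U.left) (hv : v ≫ U.hom = geomPoint x)
    (m : M) (h : germ N x U v hv (T.const m) = 0) : m = 0 := by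
  rw [T.germ_eq_zero_iff (𝟙 U), iso_const] at h
  exact h

end Trivialization

lemma IsLocallyConstantSheaf.exists_isColimit {E : EtaleSheaf X} (hE : IsLocallyConstantSheaf E) :
    ∃ (J : Type u) (_ : SmallCategory J) (_ : IsFiltered J) (D : J ⥤ EtaleSheaf X)
    (c : Limits.Cocone D), (∀ j, IsNaivelyLocallyConstant (D.obj j)) ∧
      Nonempty (Limits.IsColimit c) ∧ c.pt = E := by
  obtain ⟨J, _, _, D, c, hN, ⟨hc⟩, ⟨i⟩⟩ := hE
  exact ⟨J, _, ‹_›, D, _, hN, ⟨hc.ofIsoColimit (Limits.Cocone.ext (c := c)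
    (c' := ⟨E, c.ι ≫ (Functor.const J).map i.hom⟩) i (fun j => rfl))⟩, rfl⟩

/-- Stalks commute with filtered colimits. Only the two consequences for stalks are kept, so that
the diagram need not be carried along. -/
lemma IsLocallyConstantSheaf.exists_stalk_eq {E : EtaleSheaf X} (hE : IsLocallyConstantSheaf E) :
    ∃ (J : Type u) (N : J → EtaleSheaf X) (ι : ∀ j, N j ⟶ E),
      (∀ j, IsNaivelyLocallyConstant (N j)) ∧
      (∀ x (e : stalk E x), ∃ j e', (stalkMap (ι j) x).toLinearMap e' = e) ∧
      ∀ x j (e : stalk (N j) x), (stalkMap (ι j) x).toLinearMap e = 0 →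
        ∃ (j' : J) (f : N j ⟶ N j'), f ≫ ι j' = ι j ∧ (stalkMap f x).toLinearMap e = 0 := by
  obtain ⟨J, _, _, D, c, hN, ⟨hc⟩, rfl⟩ := hE.exists_isColimit
  refine ⟨J, D.obj, c.ι.app, hN, fun x e => exists_stalkMap_eq hc x e, fun x j e he => ?_⟩
  obtain ⟨j', f, h⟩ := exists_stalkMap_eq_zero hc x j e he
  exact ⟨j', D.map f, c.w f, h⟩

section Valuation

variable {x y : X} (W : ValuationSubring (Om x)) (τ : W →+* Om y)

/-- The morphism `Spec k(x)ˢ ⟶ Spec W`. -/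
abbrev genPt : Spec (.of (Om x)) ⟶ Spec (.of W) := Spec.map (CommRingCat.ofHom W.subtype)

/-- The morphism `Spec k(y)ˢ ⟶ Spec W`. -/
abbrev closedPt : Spec (.of (Om y)) ⟶ Spec (.of W) := Spec.map (CommRingCat.ofHom τ)

lemma exists_lift_nhd [IsLocalHom τ] {t : Spec (.of W) ⟶ X}
    (hy : closedPt W τ ≫ t = geomPoint y) (U : X.Etale) (hU : y ∈ Set.range U.hom) :
    ∃ w : Spec (.of W) ⟶ U.left, w ≫ U.hom = t := by
  obtain ⟨v, hv⟩ := exists_geomPoint_lift U y hU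
  obtain ⟨w, hw, -⟩ := exists_lift_of_etale W τ U.hom t v (hv.trans hy.symm)
  exact ⟨w, hw⟩

lemma apply_genPt_eq_apply_closedPt [IsLocalHom τ] {S : Scheme.{u}} {M : Type u}
    (φ : LocallyConstant S M) (w : Spec (.of W) ⟶ S) :
    φ ((genPt W ≫ w) default) = φ ((closedPt W τ ≫ w) default) := by
  have : PreconnectedSpace (Spec (.of W)) :=
    inferInstanceAs (PreconnectedSpace (PrimeSpectrum W))
  exact ((φ.comap w.base.hom).isLocallyConstant.apply_eq_of_preconnectedSpace _ _)


variable {E : EtaleSheaf X}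

/-- An étale neighbourhood of the closed point on which `s` dies lifts all of `Spec W`, hence also
catches the generic point. This direction needs no local constancy. -/
lemma germ_genPt_eq_zero_of_germ_closedPt [IsLocalHom τ] (U : X.Etale) (w : Spec (.of W) ⟶ U.left)
    (hx : (genPt W ≫ w) ≫ U.hom = geomPoint x) (hy : (closedPt W τ ≫ w) ≫ U.hom = geomPoint y)
    (s : E.obj.obj (op U)) (h : germ E y U _ hy s = 0) : germ E x U _ hx s = 0 := by
  obtain ⟨V, f, v, hv, h0⟩ := germ_eq_zero E y _ hy s h
  obtain ⟨w', rfl, hw⟩ := exists_lift_of_etale W τ f.left w v hv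
  have hx' : (genPt W ≫ w') ≫ V.hom = geomPoint x := by
    rw [← hx, ← left_comp_hom f]; simp only [Category.assoc]
  have := germ_map E x f (genPt W ≫ w') hx' (by simpa only [Category.assoc] using hx) s
  rw [h0, map_zero] at this
  simpa only [Category.assoc] using this.symm

/-- `Spec W` is connected, so a locally constant function takes the same value at its two geometric
points. -/
lemma Trivialization.germ_genPt_eq_zero_iff [IsLocalHom τ] {U V : X.Etale} {M : Type u}
    [AddCommGroup M] (T : Trivialization E U M) (f : V ⟶ U) (w : Spec (.of W) ⟶ V.left)
    (hx : (genPt W ≫ w) ≫ V.hom = geomPoint x) (hy : (closedPt W τ ≫ w) ≫ V.hom = geomPoint y)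
    (s : E.obj.obj (op V)) : germ E x V _ hx s = 0 ↔ germ E y V _ hy s = 0 := by
  rw [T.germ_eq_zero_iff f, T.germ_eq_zero_iff f, apply_genPt_eq_apply_closedPt W τ]

lemma IsNaivelyLocallyConstant.germ_closedPt_eq_zero [IsLocalHom τ]
    (hE : IsNaivelyLocallyConstant E) (V : X.Etale) (w : Spec (.of W) ⟶ V.left)
    (hx : (genPt W ≫ w) ≫ V.hom = geomPoint x) (hy : (closedPt W τ ≫ w) ≫ V.hom = geomPoint y)
    (s : E.obj.obj (op V)) (h : germ E x V _ hx s = 0) : germ E y V _ hy s = 0 := by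
  obtain ⟨U, M, _, hU, ⟨T⟩⟩ := hE y
  obtain ⟨w₁, hw₁⟩ := exists_lift_nhd W τ ((Category.assoc _ _ _).symm.trans hy) U hU
  obtain ⟨P, p, p', w₂, rfl, rfl⟩ := exists_etale_prod w w₁ hw₁.symm
  have hx' : (genPt W ≫ w₂) ≫ P.hom = geomPoint x := by
    rw [← hx, ← left_comp_hom p]; simp only [Category.assoc]
  have hy' : (closedPt W τ ≫ w₂) ≫ P.hom = geomPoint y := by
    rw [← hy, ← left_comp_hom p]; simp only [Category.assoc]
  have h₁ := germ_map E x p (genPt W ≫ w₂) hx' (by simpa only [Category.assoc] using hx) s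
  have h₂ := germ_map E y p (closedPt W τ ≫ w₂) hy' (by simpa only [Category.assoc] using hy) s
  simp only [Category.assoc] at h₁ h₂ h ⊢
  rw [← h₂, ← T.germ_genPt_eq_zero_iff W τ p' w₂ hx' hy', h₁, h]

lemma app_map_apply {E' : EtaleSheaf X} (f : E ⟶ E') {U V : X.Etale} (g : V ⟶ U)
    (s : E.obj.obj (op U)) :
    f.hom.app (op V) (E.obj.map g.op s) = E'.obj.map g.op (f.hom.app (op U) s) :=
  NatTrans.naturality_apply f.hom g.op s

/-- Near `y` the section comes from a naively locally constant sheaf of the system, on a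
neighbourhood to which `Spec W` lifts. Its germ at `x` dies further along the system, and there the
naive case applies. -/
lemma IsLocallyConstantSheaf.germ_closedPt_eq_zero [IsLocalHom τ]
    (hE : IsLocallyConstantSheaf E) (V : X.Etale) (w : Spec (.of W) ⟶ V.left)
    (hx : (genPt W ≫ w) ≫ V.hom = geomPoint x) (hy : (closedPt W τ ≫ w) ≫ V.hom = geomPoint y)
    (s : E.obj.obj (op V)) (h : germ E x V _ hx s = 0) : germ E y V _ hy s = 0 := by
  obtain ⟨J, N, ι, hN, hsurj, hinj⟩ := hE.exists_stalk_eq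
  obtain ⟨j, n, hn⟩ := hsurj y (germ E y V _ hy s)
  obtain ⟨U, v, hv, s', rfl⟩ := germ_surjective (N j) y n
  rw [stalkMap_germ] at hn
  obtain ⟨P, p, p', v', hv₁, rfl⟩ := exists_etale_prod (closedPt W τ ≫ w) v (hy.trans hv.symm)
  have hv' : v' ≫ P.hom = geomPoint y := by rw [← hv, ← left_comp_hom p', Category.assoc]
  have hd : germ E y P v' hv' (E.obj.map p.op s -
      E.obj.map p'.op ((ι j).hom.app (op U) s')) = 0 := by
    rw [map_sub, germ_map _ _ _ _ _ (by rw [hv₁, hy]), germ_map _ _ _ _ _ hv, hn, sub_eq_zero]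
    congr 1
    simp only [hv₁]
  obtain ⟨Q, q, v'', rfl, h0⟩ := germ_eq_zero E y v' hv' _ hd
  obtain ⟨w', rfl, hw'⟩ := exists_lift_of_etale W τ (q ≫ p).left w v''
    (by rw [← hv₁, Category.assoc]; rfl)
  have hx' : (genPt W ≫ w') ≫ Q.hom = geomPoint x := by
    rw [← hx, ← left_comp_hom (q ≫ p)]; simp only [Category.assoc]
  have hy' : (closedPt W τ ≫ w') ≫ Q.hom = geomPoint y := by
    rw [← hy, ← left_comp_hom (q ≫ p)]; simp only [Category.assoc]
  have h₁ := germ_map E x (q ≫ p) (genPt W ≫ w') hx' (by simpa only [Category.assoc] using hx) s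
  have h₂ := germ_map E y (q ≫ p) (closedPt W τ ≫ w') hy'
    (by simpa only [Category.assoc] using hy) s
  simp only [Category.assoc] at h₁ h₂ h ⊢
  rw [← h₂]
  rw [h] at h₁
  have hs : E.obj.map (q ≫ p).op s =
      (ι j).hom.app (op Q) ((N j).obj.map (q ≫ p').op s') := by
    rw [map_sub, sub_eq_zero] at h0
    rw [app_map_apply]
    simpa only [op_comp, Functor.map_comp, ConcreteCategory.comp_apply] using h0
  rw [hs, ← stalkMap_germ] at h₁ ⊢
  obtain ⟨j', f, hf', hf⟩ := hinj x j _ h₁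
  rw [stalkMap_germ] at hf
  have hz := (hN j').germ_closedPt_eq_zero W τ Q w' hx' hy' _ hf
  rw [stalkMap_germ, ← hf']
  refine (stalkMap_germ (ι j') y Q _ hy' _).symm.trans ?_
  exact (congr_arg (stalkMap (ι j') y).toLinearMap hz).trans (map_zero _)

/-- The element comes from a naively locally constant sheaf. A covering that trivializes this sheaf
around `y` receives `Spec W`, and a constant section over it has the prescribed germ at `x`. -/
lemma IsLocallyConstantSheaf.exists_germ_genPt_eq [IsLocalHom τ] (hE : IsLocallyConstantSheaf E)
    (t : Spec (.of W) ⟶ X) (hx : genPt W ≫ t = geomPoint x) (hy : closedPt W τ ≫ t = geomPoint y)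
    (e : stalk E x) :
    ∃ (U : X.Etale) (w : Spec (.of W) ⟶ U.left) (_ : w ≫ U.hom = t)
      (hx : (genPt W ≫ w) ≫ U.hom = geomPoint x) (s : E.obj.obj (op U)),
      germ E x U _ hx s = e := by
  obtain ⟨J, N, ι, hN, hsurj, hinj⟩ := hE.exists_stalk_eq
  obtain ⟨j, n, rfl⟩ := hsurj x e
  obtain ⟨U, M, _, hU, ⟨T⟩⟩ := hN j y
  obtain ⟨w, rfl⟩ := exists_lift_nhd W τ hy U hU
  have hx' : (genPt W ≫ w) ≫ U.hom = geomPoint x := by rw [Category.assoc, hx]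
  obtain ⟨m, rfl⟩ := T.germ_const_surjective x _ hx' n
  exact ⟨U, w, rfl, hx', _, (stalkMap_germ (ι j) x U _ hx' _).symm⟩

lemma IsLocallyConstantSheaf.exists_cospecializes [IsLocalHom τ] (hE : IsLocallyConstantSheaf E)
    (t : Spec (.of W) ⟶ X) (hx : genPt W ≫ t = geomPoint x) (hy : closedPt W τ ≫ t = geomPoint y)
    (e₀ : stalk E x) : ∃ e, Cospecializes E W τ e e₀ := by
  obtain ⟨U, w, rfl, hx', s, rfl⟩ := hE.exists_germ_genPt_eq W τ t hx hy e₀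
  exact ⟨_, U, w, hx', by rw [Category.assoc, hy], s, rfl, rfl⟩

/-- Agreement at the closed point places both morphisms in one affine open, because every point of
`Spec W` specializes to the closed point. There they are ring homomorphisms to `W`, which embeds in
its fraction field. -/
lemma hom_ext_of_genPt [IsLocalHom τ] {t t' : Spec (.of W) ⟶ X}
    (h : genPt W ≫ t = genPt W ≫ t') (h' : closedPt W τ ≫ t = closedPt W τ ≫ t') : t = t' := by
  have hτ : (closedPt W τ) default = IsLocalRing.closedPoint W :=
    (IsLocalRing.comap_closedPoint τ).symm ▸ congr_arg (Spec.map (CommRingCat.ofHom τ)) (Subsingleton.elim _ _)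
  obtain ⟨R, j, _, hj, _⟩ := Scheme.exists_affine_mem_range_and_range_subset
    (x := t.base (IsLocalRing.closedPoint W)) (U := ⊤) (by simp)
  have hr (s : Spec (.of W) ⟶ X) (hs : closedPt W τ ≫ t = closedPt W τ ≫ s) :
      Set.range s ⊆ Set.range j := by
    rintro _ ⟨a, rfl⟩
    refine ((IsLocalRing.specializes_closedPoint (R := W) a).map s.continuous).mem_open
      j.isOpenEmbedding.isOpen_range ?_
    rw [← hτ, ← Scheme.Hom.comp_apply] at hj ⊢
    rwa [← hs]
  have hl := IsOpenImmersion.lift_fac j t (hr t rfl)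
  have hl' := IsOpenImmersion.lift_fac j t' (hr t' h')
  obtain ⟨φ, hφ⟩ := Spec.map_surjective (IsOpenImmersion.lift j t (hr t rfl))
  obtain ⟨φ', hφ'⟩ := Spec.map_surjective (IsOpenImmersion.lift j t' (hr t' h'))
  rw [← hφ] at hl
  rw [← hφ'] at hl'
  rw [← hl, ← hl']
  rw [← hl, ← hl', ← Category.assoc, ← Category.assoc, cancel_mono, ← Spec.map_comp,
    ← Spec.map_comp] at h
  congr 2
  have h := Spec.map_injective h
  ext a
  exact RingHom.congr_fun (congr_arg CommRingCat.Hom.hom h) a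

/-- Both sections live over neighbourhoods of the same morphism from `Spec W`. On the fibre product
their difference vanishes at `x`, hence at `y` by `germ_closedPt_eq_zero`. -/
lemma IsLocallyConstantSheaf.cospecializes_unique [IsLocalHom τ] (hE : IsLocallyConstantSheaf E)
    {e e' : stalk E y} {e₀ : stalk E x} (h : Cospecializes E W τ e e₀)
    (h' : Cospecializes E W τ e' e₀) : e = e' := by
  obtain ⟨U, w, hx, hy, s, rfl, rfl⟩ := h
  obtain ⟨U', w', hx', hy', s', rfl, hs⟩ := h'
  have ht : w ≫ U.hom = w' ≫ U'.hom := by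
    apply hom_ext_of_genPt W τ
    · rw [← Category.assoc, hx, ← Category.assoc, hx']
    · rw [← Category.assoc, hy, ← Category.assoc, hy']
  obtain ⟨P, p, p', v, rfl, rfl⟩ := exists_etale_prod w w' ht
  have hx₁ : (genPt W ≫ v) ≫ P.hom = geomPoint x := by
    rw [← hx, ← left_comp_hom p]; simp only [Category.assoc]
  have hy₁ : (closedPt W τ ≫ v) ≫ P.hom = geomPoint y := by
    rw [← hy, ← left_comp_hom p]; simp only [Category.assoc]
  have := hE.germ_closedPt_eq_zero W τ P v hx₁ hy₁ (E.obj.map p.op s - E.obj.map p'.op s')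
  rw [map_sub, map_sub, germ_map E x p, germ_map E x p', germ_map E y p, germ_map E y p',
    sub_eq_zero, sub_eq_zero] at this
  · simp only [Category.assoc] at this hs ⊢
    exact this hs.symm
  all_goals simpa only [Category.assoc]

/-- An element of the inertia group acts trivially on the stalk of a locally constant sheaf. -/
lemma IsLocallyConstantSheaf.stalkRep_eq_self [IsLocalHom τ] (hE : IsLocallyConstantSheaf E)
    (t : Spec (.of W) ⟶ X) (hx : genPt W ≫ t = geomPoint x) (hy : closedPt W τ ≫ t = geomPoint y)
    (σ : Gam (X.residueField x)) (g : W →+* W) (hg : ∀ a : W, (g a : Om x) = σ a)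
    (hτ : ∀ a, τ (g a) = τ a) (e : stalk E x) : stalkRep E x σ e = e := by
  obtain ⟨U, w, rfl, hx₀, s, rfl⟩ := hE.exists_germ_genPt_eq W τ t hx hy e
  -- The twist of `w` by `g` agrees with `w` at the closed point and represents the translate by `σ`
  -- at the generic point. Equality of the two germs of `s` thus propagates from the closed point to
  -- the generic one.
  let w' := Spec.map (CommRingCat.ofHom g) ≫ w
  have h₁ : genPt W ≫ w' = Spec.map (CommRingCat.ofHom (σ : Om x →+* Om x)) ≫ genPt W ≫ w := by
    simp only [w', ← Category.assoc, ← Spec.map_comp]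
    congr 2
    ext a
    exact hg a
  have h₂ : closedPt W τ ≫ w' = closedPt W τ ≫ w := by
    simp only [w', ← Category.assoc, ← Spec.map_comp]
    congr 2
    ext a
    exact hτ a
  have ht : w ≫ U.hom = w' ≫ U.hom := by
    apply hom_ext_of_genPt W τ
    · rw [← Category.assoc (genPt W) w', h₁, Category.assoc, Category.assoc, hx, specMap_geomPoint]
    · rw [← Category.assoc (closedPt W τ) w', h₂, Category.assoc]
  have hx' : (genPt W ≫ w') ≫ U.hom = geomPoint x := by rw [Category.assoc, ← ht, hx]
  obtain ⟨P, p, p', v, hv, hv'⟩ := exists_etale_prod w w' ht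
  have hx₁ : (genPt W ≫ v) ≫ P.hom = geomPoint x := by
    rw [← hx₀, ← left_comp_hom p, ← hv]; simp only [Category.assoc]
  have hy₁ : (closedPt W τ ≫ v) ≫ P.hom = geomPoint y := by
    rw [← hy, ← left_comp_hom p, ← hv]; simp only [Category.assoc]
  have h := germ_genPt_eq_zero_of_germ_closedPt W τ P v hx₁ hy₁
    (E.obj.map p.op s - E.obj.map p'.op s)
  rw [map_sub, map_sub,
    germ_map E x p _ _ (by rw [Category.assoc, left_comp_hom, hx₁]),
    germ_map E x p' _ _ (by rw [Category.assoc, left_comp_hom, hx₁]),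
    germ_map E y p _ _ (by rw [Category.assoc, left_comp_hom, hy₁]),
    germ_map E y p' _ _ (by rw [Category.assoc, left_comp_hom, hy₁]),
    sub_eq_zero, sub_eq_zero] at h
  simp only [Category.assoc, hv, hv', h₁, h₂] at h
  rw [stalkRep_germ E x σ _ hx₀ (by rw [← h₁, hx'])]
  exact (h trivial).symm

end Valuation

end LocallyConstant

/-! ### The Galois action on stalks: discreteness and comparison with lattices. -/

section GeometricPoints

variable {X : Scheme.{u}}

/-- A geometric point of the fibre over `x` factors through a finitely generated algebra over k(x).
Its image lies in a finite extension, whose fixing subgroup is open. -/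
lemma exists_isOpen_fixing (x : X) (U : X.Etale) (v : Spec (.of (Om x)) ⟶ U.left)
    (hv : v ≫ U.hom = geomPoint x) :
    ∃ N : Subgroup (Gam (X.residueField x)), IsOpen (N : Set (Gam (X.residueField x))) ∧
      ∀ σ ∈ N, Spec.map (CommRingCat.ofHom (σ : Om x →+* Om x)) ≫ v = v := by
  let c : Spec (.of (Om x)) ⟶ Spec (X.residueField x) :=
    Spec.map (CommRingCat.ofHom (algebraMap (X.residueField x) (Om x)))
  let z : Spec (.of (Om x)) ⟶ Limits.pullback U.hom (X.fromSpecResidueField x) :=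
    Limits.pullback.lift v c hv
  have hzfst : z ≫ Limits.pullback.fst _ _ = v := Limits.pullback.lift_fst _ _ _
  have hzsnd : z ≫ Limits.pullback.snd _ _ = c := Limits.pullback.lift_snd _ _ _
  obtain ⟨B, j, _, hj, _⟩ := Scheme.exists_affine_mem_range_and_range_subset
    (x := z.base default) (U := ⊤) (by simp)
  have hrange : Set.range z ⊆ Set.range j := by
    rintro _ ⟨a, rfl⟩
    rwa [Subsingleton.elim a default]
  have hz' := IsOpenImmersion.lift_fac j z hrange
  obtain ⟨χ, hχ⟩ := Spec.map_surjective (IsOpenImmersion.lift j z hrange)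
  obtain ⟨φ, hφ⟩ := Spec.map_surjective (j ≫ Limits.pullback.snd U.hom (X.fromSpecResidueField x))
  have hft : φ.hom.FiniteType := by
    rw [← HasRingHomProperty.Spec_iff (P := @LocallyOfFiniteType), hφ]
    infer_instance
  have hcomp : φ ≫ χ = CommRingCat.ofHom (algebraMap (X.residueField x) (Om x)) := by
    apply Spec.map_injective
    rw [Spec.map_comp, hφ, hχ, reassoc_of% hz', hzsnd]
    rfl
  algebraize [φ.hom]
  let χA : B →ₐ[X.residueField x] Om x := ⟨χ.hom, fun r =>
    RingHom.congr_fun (congr_arg CommRingCat.Hom.hom hcomp) r⟩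
  obtain ⟨s, hs⟩ := Algebra.FiniteType.out (R := X.residueField x) (A := B)
  let L : IntermediateField (X.residueField x) (Om x) := IntermediateField.adjoin _ (χA '' s)
  have : FiniteDimensional (X.residueField x) L :=
    IntermediateField.finiteDimensional_adjoin (S := χA '' s)
      (fun a _ => Algebra.IsIntegral.isIntegral a) 
  refine ⟨L.fixingSubgroup, L.fixingSubgroup_isOpen, fun σ hσ => ?_⟩
  have hσχ : (σ : Om x →ₐ[X.residueField x] Om x).comp χA = χA := by
    refine AlgHom.ext_of_adjoin_eq_top hs fun b hb => ?_
    exact (IntermediateField.mem_fixingSubgroup_iff _ _).1 hσ _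
      (IntermediateField.subset_adjoin _ _ ⟨b, hb, rfl⟩)
  rw [← hzfst, ← hz', ← hχ, ← Category.assoc, ← Category.assoc, ← Spec.map_comp]
  congr 3
  ext b
  exact AlgHom.congr_fun hσχ b

lemma exists_isOpen_stabilizer (E : EtaleSheaf X) (x : X) (e : stalk E x) :
    ∃ N : Subgroup (Gam (X.residueField x)), IsOpen (N : Set (Gam (X.residueField x))) ∧
      ∀ σ ∈ N, stalkRep E x σ e = e := by
  obtain ⟨U, v, hv, s, rfl⟩ := germ_surjective E x e
  obtain ⟨N, hN, h⟩ := exists_isOpen_fixing x U v hv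
  refine ⟨N, hN, fun σ hσ => ?_⟩
  rw [stalkRep_germ E x σ v hv (by rw [h σ hσ, hv])]
  simp only [h σ hσ]

variable {R : Type u} [CommRing R] {E : EtaleSheaf X}

lemma LatticeModel.map_act_const (D : LatticeModel R E) (g : D.G) (m : D.M) :
    E.obj.map (D.act g).hom.op (D.triv.const m) = D.triv.const (D.ρ g⁻¹ m) := by
  apply (D.triv.iso (𝟙 D.Y)).injective
  ext v
  rw [D.triv.iso_const]
  have h₁ := D.triv.naturality (D.act g).hom (𝟙 D.Y) (D.triv.const m)
  have h₂ := D.equivariant g (𝟙 D.Y) (E.obj.map (D.act g).hom.op (D.triv.const m)) v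
  rw [Category.comp_id] at h₁
  rw [Category.id_comp, h₁, D.triv.iso_const] at h₂
  have h₃ : m = D.ρ g (D.triv.iso (𝟙 D.Y) (E.obj.map (D.act g).hom.op (D.triv.const m)) v) := h₂
  generalize D.triv.iso (𝟙 D.Y) (E.obj.map (D.act g).hom.op (D.triv.const m)) v = a at h₃ ⊢
  change a = D.ρ g⁻¹ m
  rw [h₃, ← Module.End.mul_apply, ← map_mul, inv_mul_cancel, map_one, Module.End.one_apply]

/-- The Galois group permutes the geometric points of the torsor above `x`, and simple transitivity
converts this into a map to `D.G` once a base point `v` is chosen. Germs of constant sections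
identify the lattice with the stalk. -/
lemma LatticeModel.exists_stalk_equiv (D : LatticeModel R E) (x : X)
    (hx : x ∈ Set.range D.Y.hom) :
    ∃ (ψ : Gam (X.residueField x) →* D.G) (e : D.M ≃+ stalk E x),
      IsOpen (ψ.ker : Set (Gam (X.residueField x))) ∧
      ∀ σ m, stalkRep E x σ (e m) = e (D.ρ (ψ σ) m) := by
  obtain ⟨v, hv⟩ := exists_geomPoint_lift D.Y x hx
  have key (σ : Gam (X.residueField x)) : ∃! g : D.G, v ≫ (D.act g).hom.left =
      Spec.map (CommRingCat.ofHom (σ : Om x →+* Om x)) ≫ v :=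
    D.simply_transitive (Om x) _ _ (by rw [Category.assoc, hv, specMap_geomPoint])
  choose φ hφ hφ' using key
  have hmul (σ τ) : φ (σ * τ) = φ τ * φ σ := by
    symm
    apply hφ'
    have h₁ : (D.act (φ τ * φ σ)).hom.left = (D.act (φ σ)).hom.left ≫ (D.act (φ τ)).hom.left := by
      rw [map_mul]
      rfl
    rw [h₁, reassoc_of% (hφ σ), hφ τ, ← Category.assoc, ← Spec.map_comp]
    rfl
  have hfix (σ : Gam (X.residueField x)) (h : Spec.map (CommRingCat.ofHom (σ : Om x →+* Om x)) ≫ v = v) : φ σ = 1 := by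
    symm
    apply hφ'
    rw [h, map_one]
    exact Category.comp_id v
  have hone : φ 1 = 1 := hfix 1 (by
    change Spec.map (CommRingCat.ofHom (RingHom.id (Om x))) ≫ v = v
    erw [Spec.map_id, Category.id_comp])
  -- `φ` reverses products. Inverting it gives a homomorphism, and the same inverse appears in
  -- `map_act_const` because pullback of sections is contravariant.
  let ψ : Gam (X.residueField x) →* D.G :=
    { toFun := fun σ => (φ σ)⁻¹
      map_one' := by rw [hone, inv_one]
      map_mul' := fun σ τ => by rw [hmul, mul_inv_rev] }
  let e₀ : D.M →+ stalk E x := (germ E x D.Y v hv).hom.comp D.triv.const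
  refine ⟨ψ, AddEquiv.ofBijective e₀ ⟨(injective_iff_map_eq_zero e₀).2 fun m hm =>
    D.triv.germ_const_injective x v hv m hm, D.triv.germ_const_surjective x v hv⟩, ?_, ?_⟩
  · obtain ⟨N, hN, h⟩ := exists_isOpen_fixing x D.Y v hv
    refine Subgroup.isOpen_mono (H₁ := N) (fun σ hσ => ?_) hN
    change (φ σ)⁻¹ = 1
    rw [hfix σ (h σ hσ), inv_one]
  · intro σ m
    have h₁ : (v ≫ (D.act (φ σ)).hom.left) ≫ D.Y.hom = geomPoint x := by
      rw [hφ, Category.assoc, hv, specMap_geomPoint]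
    have h₂ := germ_map E x (D.act (φ σ)).hom v hv h₁ (D.triv.const m)
    rw [D.map_act_const] at h₂
    refine (stalkRep_germ E x σ v hv (by rw [Category.assoc, hv, specMap_geomPoint]) _).trans ?_
    refine Eq.trans ?_ h₂.symm
    simp only [hφ]

end GeometricPoints

/-! ### Invariants commute with tensoring by a flat module. -/

section FlatInvariants

/-- A flat module with trivial action commutes with invariants, provided orbits are finite. -/
lemma exists_invariants_lTensor {P U G : Type*} [AddCommGroup P] [Module.Flat ℤ P] [AddCommGroup U]
    [Group G] (ρ : Representation ℤ G U) (hfin : ∀ u, (Set.range fun g => ρ g u).Finite)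
    (t : P ⊗[ℤ] U) (ht : ∀ g, (ρ g).lTensor P t = t) :
    ∃ t' : P ⊗[ℤ] ρ.invariants, ρ.invariants.subtype.lTensor P t' = t := by
  classical
  obtain ⟨S, hS⟩ := TensorProduct.exists_finset t
  let U' : Submodule ℤ U := Submodule.span ℤ (S.image Prod.snd : Set U)
  have hmem : ∀ i ∈ S, i.2 ∈ U' := fun i hi =>
    Submodule.subset_span (by exact_mod_cast Finset.mem_image_of_mem _ hi)
  obtain ⟨t', rfl⟩ : ∃ t', U'.subtype.lTensor P t' = t := by
    refine ⟨∑ i ∈ S.attach, i.1.1 ⊗ₜ ⟨i.1.2, hmem _ i.2⟩, ?_⟩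
    rw [map_sum, hS, ← S.sum_attach (fun i => i.1 ⊗ₜ[ℤ] i.2)]
    rfl
  have hrange : (Set.range fun g => fun u : S.image Prod.snd => ρ g u.1).Finite := by
    refine (Set.Finite.pi' fun u : S.image Prod.snd => hfin u.1).subset ?_
    rintro _ ⟨g, rfl⟩ u
    exact ⟨g, rfl⟩
  -- Only finitely many vectors occur in `t`, with finite orbits, so finitely many group elements
  -- exhaust the action on their span. Invariance becomes the kernel of one map `D` to a finite
  -- power of `U`, and flatness preserves that kernel.
  obtain ⟨T, hTf, hT⟩ : ∃ T : Set G, T.Finite ∧ ∀ g, ∃ h ∈ T, ∀ u ∈ U', ρ g u = ρ h u := by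
    refine ⟨Set.range fun z : Set.range (fun g => fun u : S.image Prod.snd => ρ g u.1) =>
      z.2.choose, ?_, fun g => ⟨_, ⟨⟨_, g, rfl⟩, rfl⟩, fun u hu => ?_⟩⟩
    · have := hrange.to_subtype
      exact Set.finite_range _
    · have h : ∃ g', (fun u : S.image Prod.snd => ρ g' u.1) = fun u => ρ g u.1 := ⟨g, rfl⟩
      refine LinearMap.eqOn_span (f := ρ g) (g := ρ h.choose) (fun v hv => ?_) hu
      exact (congr_fun h.choose_spec ⟨v, by exact_mod_cast hv⟩).symm
  have := hTf.to_subtype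
  have := Fintype.ofFinite T
  let D : U' →ₗ[ℤ] (T → U) := LinearMap.pi fun g => (ρ g.1 - LinearMap.id).comp U'.subtype
  have hK : ∀ u ∈ LinearMap.ker D, (u : U) ∈ ρ.invariants := by
    intro u hu g
    obtain ⟨h, hhT, hh⟩ := hT g
    have := congr_fun hu ⟨h, hhT⟩
    rw [hh u u.2]
    exact sub_eq_zero.1 this
  have hex := Module.Flat.lTensor_exact P (f := (LinearMap.ker D).subtype) (g := D)
    (LinearMap.exact_subtype_ker_map D)
  have hD0 : D.lTensor P t' = 0 := by
    apply (TensorProduct.piRight ℤ ℤ P (fun _ : T => U)).injective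
    rw [map_zero]
    ext g
    have : ∀ s : P ⊗[ℤ] U', TensorProduct.piRight ℤ ℤ P (fun _ : T => U) (D.lTensor P s) g =
        (ρ g.1).lTensor P (U'.subtype.lTensor P s) - U'.subtype.lTensor P s := by
      intro s
      induction s using TensorProduct.induction_on with
      | zero => simp
      | add a b ha hb => simp only [map_add, Pi.add_apply, ha, hb]; abel
      | tmul p u => simp [D, TensorProduct.tmul_sub]
    rw [this, ht, sub_self]
    rfl
  obtain ⟨s, rfl⟩ := (hex t').1 hD0
  let j : LinearMap.ker D →ₗ[ℤ] ρ.invariants :=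
    LinearMap.codRestrict _ (U'.subtype.comp (LinearMap.ker D).subtype) fun u => hK _ u.2
  refine ⟨j.lTensor P s, ?_⟩
  rw [← LinearMap.comp_apply, ← LinearMap.comp_apply, ← LinearMap.lTensor_comp,
    ← LinearMap.lTensor_comp]
  rfl

end FlatInvariants

/-! ### Coordinates in the free resolution of the multiplicative group. -/

section TensorRes

variable {F : Type u} [Field F] {M N : Type u} [AddCommGroup M] [AddCommGroup N]

lemma tensorOf_add (q q' : SepUnits F →₀ M) : tensorOf (q + q') = tensorOf q + tensorOf q' := by
  classical
  exact Finsupp.sum_add_index' (by simp) (by simp [TensorProduct.add_tmul])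

lemma tensorOf_neg (q : SepUnits F →₀ M) : tensorOf (-q) = -tensorOf q := by
  rw [eq_neg_iff_add_eq_zero, ← tensorOf_add, neg_add_cancel]
  exact Finsupp.sum_zero_index

lemma tensorOf_sub (q q' : SepUnits F →₀ M) : tensorOf (q - q') = tensorOf q - tensorOf q' := by
  rw [sub_eq_add_neg, tensorOf_add, tensorOf_neg, sub_eq_add_neg]

lemma exists_tensorOf_eq (t : M ⊗[ℤ] ResZero F) : ∃ q, tensorOf q = t := by
  induction t using TensorProduct.induction_on with
  | zero => exact ⟨0, Finsupp.sum_zero_index⟩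
  | add a b ha hb =>
    obtain ⟨q, rfl⟩ := ha
    obtain ⟨q', rfl⟩ := hb
    exact ⟨q + q', tensorOf_add q q'⟩
  | tmul m r =>
    induction r using Finsupp.induction_linear with
    | zero => exact ⟨0, by rw [TensorProduct.tmul_zero]; exact Finsupp.sum_zero_index⟩
    | add a b ha hb =>
      obtain ⟨q, hq⟩ := ha
      obtain ⟨q', hq'⟩ := hb
      exact ⟨q + q', by rw [tensorOf_add, hq, hq', TensorProduct.tmul_add]⟩
    | single a n =>
      refine ⟨Finsupp.single a (n • m), ?_⟩
      rw [tensorOf, Finsupp.sum_single_index (by simp), TensorProduct.smul_tmul,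
        Finsupp.smul_single, smul_eq_mul, mul_one]

lemma rTensor_tensorOf (f : M →ₗ[ℤ] N) (q : SepUnits F →₀ M) :
    f.rTensor (ResZero F) (tensorOf q) = tensorOf (q.mapRange f (map_zero f)) := by
  rw [tensorOf, tensorOf, Finsupp.sum_mapRange_index (by simp), Finsupp.sum, Finsupp.sum, map_sum]
  simp

/-- The element of the algebraic closure underlying an element of `SepUnits F`. -/
abbrev coeUnit (a : SepUnits F) : AlgebraicClosure F :=
  ((a : separableClosure F (AlgebraicClosure F)) : AlgebraicClosure F)

lemma coe_galUnits (σ : Gam F) (a : SepUnits F) : coeUnit (galUnits F σ a) = σ (coeUnit a) :=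
  AlgEquiv.restrictNormal_commutes σ (separableClosure F (AlgebraicClosure F)) _

lemma coeUnit_injective : Function.Injective (coeUnit (F := F)) := fun _ _ h =>
  Units.ext (Subtype.ext h)

lemma coeUnit_ne_zero (a : SepUnits F) : coeUnit a ≠ 0 := fun h =>
  a.ne_zero (Subtype.ext h)

variable (F) in
/-- The Galois module `SepUnits F`, written additively. -/
def unitsRep : Representation ℤ (Gam F) (Additive (SepUnits F)) where
  toFun σ := (MonoidHom.toAdditive (galUnits F σ)).toIntLinearMap
  map_one' := by rw [map_one]; rfl
  map_mul' σ τ := by rw [map_mul]; rfl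

variable (F M) in
/-- The projection `M ⊗ ResZero → M ⊗ Fˢˣ`. -/
def resClass : M ⊗[ℤ] ResZero F →ₗ[ℤ] M ⊗[ℤ] Additive (SepUnits F) := (resAug F).lTensor M

lemma resAug_single (a : SepUnits F) : resAug F (Finsupp.single a 1) = Additive.ofMul a := by
  simp [resAug]

lemma resAug_surjective : Function.Surjective (resAug F) := fun a =>
  ⟨Finsupp.single a.toMul 1, resAug_single _⟩

lemma resClass_surjective : Function.Surjective (resClass F M) :=
  LinearMap.lTensor_surjective M resAug_surjective

lemma resDiff_resClass_exact : Function.Exact (resDiff F M) (resClass F M) :=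
  lTensor_exact M (LinearMap.exact_subtype_ker_map _) resAug_surjective

lemma resClass_resDiff (t : M ⊗[ℤ] ResOne F) : resClass F M (resDiff F M t) = 0 :=
  resDiff_resClass_exact.apply_apply_eq_zero t

lemma resDiff_injective [Module.Flat ℤ M] : Function.Injective (resDiff F M) :=
  Module.Flat.lTensor_preserves_injective_linearMap _ (Submodule.subtype_injective _)

variable (ρ : Representation ℤ (Gam F) M)

lemma resDiff_tprod (σ : Gam F) (t : M ⊗[ℤ] ResOne F) :
    resDiff F M ((ρ.tprod (resOneRep F)) σ t) = (ρ.tprod (resZeroRep F)) σ (resDiff F M t) := by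
  induction t using TensorProduct.induction_on with
  | zero => simp
  | add a b ha hb => simp only [map_add, ha, hb]
  | tmul m p => rfl

lemma resClass_tprod (σ : Gam F) (t : M ⊗[ℤ] ResZero F) :
    resClass F M ((ρ.tprod (resZeroRep F)) σ t) = (ρ.tprod (unitsRep F)) σ (resClass F M t) := by
  induction t using TensorProduct.induction_on with
  | zero => simp
  | add a b ha hb => simp only [map_add, ha, hb]
  | tmul m p => exact congr_arg (fun r => ρ σ m ⊗ₜ[ℤ] r) (resAug_resZeroRep F σ p)

lemma resClass_rTensor (f : M →ₗ[ℤ] N) (t : M ⊗[ℤ] ResZero F) :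
    resClass F N (f.rTensor _ t) = f.rTensor _ (resClass F M t) := by
  induction t using TensorProduct.induction_on with
  | zero => simp
  | add a b ha hb => simp only [map_add, ha, hb]
  | tmul m p => rfl

lemma tprod_eq_lTensor {P : Type*} [AddCommGroup P] (η : Representation ℤ (Gam F) P) {σ : Gam F}
    (h : ∀ m, ρ σ m = m) (t : M ⊗[ℤ] P) : (ρ.tprod η) σ t = (η σ).lTensor M t := by
  have : ρ σ = LinearMap.id := LinearMap.ext h
  rw [Representation.tprod_apply, this]
  rfl

lemma finite_range_unitsRep (a : Additive (SepUnits F)) :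
    (Set.range fun σ => unitsRep F σ a).Finite := by
  let a' : AlgebraicClosure F := (a.toMul : separableClosure F (AlgebraicClosure F))
  have h : (Set.range fun σ : Gam F => σ a').Finite := by
    refine ((minpoly F a').rootSet_finite (AlgebraicClosure F)).subset ?_
    rintro _ ⟨σ, rfl⟩
    rw [Polynomial.mem_rootSet_of_ne (minpoly.ne_zero (Algebra.IsIntegral.isIntegral a'))]
    change Polynomial.aeval (σ.toAlgHom a') _ = 0
    rw [Polynomial.aeval_algHom_apply, minpoly.aeval, map_zero]
  refine Set.Finite.of_finite_image (f := fun b : Additive (SepUnits F) =>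
    ((b.toMul : separableClosure F (AlgebraicClosure F)) : AlgebraicClosure F)) (h.subset ?_) ?_
  · rintro _ ⟨_, ⟨σ, rfl⟩, rfl⟩
    exact ⟨σ, (coe_galUnits σ _).symm⟩
  · intro b _ c _ hbc
    exact Additive.toMul.injective (Units.ext (Subtype.ext hbc))

end TensorRes

/-! ### The order function on inertia-fixed units and the vanishing of residues of coboundaries. -/

section Residue

variable {F : Type u} [Field F]

/-- The representation of the inertia group on the units of the separable closure. -/
abbrev inertiaUnits (W : ValuationSubring (AlgebraicClosure F)) :
    Representation ℤ (inertia W) (Additive (SepUnits F)) :=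
  (unitsRep F).comp (inertia W).subtype

lemma mem_inertiaUnits_invariants {W : ValuationSubring (AlgebraicClosure F)} {a : SepUnits F} :
    Additive.ofMul a ∈ (inertiaUnits W).invariants ↔ ∀ σ ∈ inertia W, galUnits F σ a = a :=
  ⟨fun h σ hσ => h ⟨σ, hσ⟩, fun h σ => h σ.1 σ.2⟩

/-- The order function of an element `π` of the base field on the units that are fixed by the
inertia group: a homomorphism to the integers with `|a| = |π| ^ ord a`. -/
structure UnramifiedOrder (W : ValuationSubring (AlgebraicClosure F)) (π : F) where
  /-- the order function -/
  ord : (inertiaUnits W).invariants →ₗ[ℤ] ℤ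
  valuation_eq : ∀ a : (inertiaUnits W).invariants, W.valuation (coeUnit a.1.toMul) =
    W.valuation (algebraMap F (AlgebraicClosure F) π) ^ ord a
  zpow_injective : Function.Injective
    fun n : ℤ => W.valuation (algebraMap F (AlgebraicClosure F) π) ^ n

/-- Since 0 < |π| < 1, the powers of |π| are distinct. The exponent is therefore unique, and
uniqueness forces it to be additive. -/
lemma nonempty_unramifiedOrder {W : ValuationSubring (AlgebraicClosure F)} {π : F} (hπ0 : π ≠ 0)
    (hπ : W.valuation (algebraMap F (AlgebraicClosure F) π) < 1)
    (h : ∀ a : SepUnits F, (∀ σ ∈ inertia W, galUnits F σ a = a) →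
      ∃ n : ℤ, W.valuation (coeUnit a) =
        W.valuation (algebraMap F (AlgebraicClosure F) π) ^ n) :
    Nonempty (UnramifiedOrder W π) := by
  have hv0 : 0 < W.valuation (algebraMap F (AlgebraicClosure F) π) := by
    rw [zero_lt_iff, (Valuation.ne_zero_iff _)]
    simpa using hπ0
  have hinj : Function.Injective
      fun n : ℤ => W.valuation (algebraMap F (AlgebraicClosure F) π) ^ n :=
    (zpow_right_strictAnti₀ hv0 hπ).injective
  choose n hn using fun a : (inertiaUnits W).invariants =>
    h a.1.toMul (mem_inertiaUnits_invariants.1 a.2)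
  refine ⟨⟨AddMonoidHom.toIntLinearMap (AddMonoidHom.mk' n fun a b => hinj ?_), hn, hinj⟩⟩
  change _ ^ n (a + b) = _ ^ (n a + n b)
  rw [zpow_add₀ hv0.ne', ← hn, ← hn, ← hn, ← map_mul]
  rfl

namespace UnramifiedOrder

variable {W : ValuationSubring (AlgebraicClosure F)} {π : F} (O : UnramifiedOrder W π)
  {M N : Type u} [AddCommGroup M] [AddCommGroup N]

/-- The map `M ⊗ Fnrˣ → M` induced by the order function. -/
def tensorOrd (M : Type u) [AddCommGroup M] : M ⊗[ℤ] (inertiaUnits W).invariants →ₗ[ℤ] M :=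
  (TensorProduct.rid ℤ M).toLinearMap ∘ₗ O.ord.lTensor M

lemma tensorOrd_tmul (m : M) (a : (inertiaUnits W).invariants) :
    O.tensorOrd M (m ⊗ₜ a) = O.ord a • m := by
  exact TensorProduct.rid_tmul (R := ℤ) m (O.ord a)

lemma tensorOrd_rTensor (f : M →ₗ[ℤ] N) (t : M ⊗[ℤ] (inertiaUnits W).invariants) :
    O.tensorOrd N (f.rTensor _ t) = f (O.tensorOrd M t) := by
  induction t using TensorProduct.induction_on with
  | zero => simp
  | add a b ha hb => simp only [map_add, ha, hb]
  | tmul m p => simp [tensorOrd_tmul]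

open Classical in
/-- The extension by zero of the order function. -/
def ordFun (a : SepUnits F) : ℤ :=
  if h : ∀ σ ∈ inertia W, galUnits F σ a = a then
    O.ord ⟨Additive.ofMul a, mem_inertiaUnits_invariants.2 h⟩ else 0

lemma ordFun_eq {a : SepUnits F} {n : ℤ} (ha : ∀ σ ∈ inertia W, galUnits F σ a = a)
    (h : W.valuation (coeUnit a) = W.valuation (algebraMap F (AlgebraicClosure F) π) ^ n) :
    n = O.ordFun a := by
  rw [ordFun, dif_pos ha]
  exact O.zpow_injective (h.symm.trans (O.valuation_eq ⟨Additive.ofMul a, _⟩))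

lemma valuation_eq_ordFun {a : SepUnits F} (ha : ∀ σ ∈ inertia W, galUnits F σ a = a) :
    W.valuation (coeUnit a) =
      W.valuation (algebraMap F (AlgebraicClosure F) π) ^ O.ordFun a := by
  rw [ordFun, dif_pos ha]
  exact O.valuation_eq ⟨Additive.ofMul a, _⟩

/-- The weighted sum of the coefficients. -/
def residue (q : SepUnits F →₀ M) : M := q.sum fun a m => O.ordFun a • m

lemma residue_add (q q' : SepUnits F →₀ M) : O.residue (q + q') = O.residue q + O.residue q' := by
  classical
  exact Finsupp.sum_add_index' (by simp) (by simp)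

lemma residue_mapRange (f : M →ₗ[ℤ] N) (q : SepUnits F →₀ M) :
    O.residue (q.mapRange f (map_zero f)) = f (O.residue q) := by
  rw [residue, residue, Finsupp.sum_mapRange_index (by simp), Finsupp.sum, Finsupp.sum, map_sum]
  simp

lemma exists_lift (q : SepUnits F →₀ M)
    (hq : ∀ a ∈ q.support, ∀ σ ∈ inertia W, galUnits F σ a = a) :
    ∃ t : M ⊗[ℤ] (inertiaUnits W).invariants,
      (inertiaUnits W).invariants.subtype.lTensor M t = resClass F M (tensorOf q) ∧
      O.tensorOrd M t = O.residue q := by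
  refine ⟨∑ a ∈ q.support.attach, q a.1 ⊗ₜ
    ⟨Additive.ofMul a.1, mem_inertiaUnits_invariants.2 (hq a.1 a.2)⟩, ?_, ?_⟩
  · rw [map_sum, tensorOf, Finsupp.sum, map_sum, ← q.support.sum_attach]
    refine Finset.sum_congr rfl fun a _ => ?_
    exact congr_arg (fun r => q a.1 ⊗ₜ[ℤ] r) (resAug_single a.1).symm
  · rw [map_sum, residue, Finsupp.sum, ← q.support.sum_attach]
    refine Finset.sum_congr rfl fun a _ => ?_
    rw [tensorOrd_tmul, ordFun, dif_pos (hq a.1 a.2)]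

/-- The residue of a hypercocycle that is a coboundary on the inertia group is zero. -/
lemma residue_eq_zero (q : SepUnits F →₀ M)
    (hq : ∀ a ∈ q.support, ∀ σ ∈ inertia W, galUnits F σ a = a) (k : M ⊗[ℤ] ResOne F)
    (hk : ∀ σ ∈ inertia W, (resOneRep F σ).lTensor M k = k) (hqk : resDiff F M k = tensorOf q) :
    O.residue q = 0 := by
  classical
  -- `M` need not be flat, so the invariants of M ⊗ units may exceed M ⊗ Fnrˣ. A free presentation
  -- P₁ → P₀ → M moves the computation to flat modules: the order of the lifted data is well defined
  -- in P₀, and the ambiguity lands in P₁, which dies in `M`.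
  let P₀ := M →₀ ℤ
  let lc : P₀ →ₗ[ℤ] M := Finsupp.linearCombination ℤ id
  let P₁ : Submodule ℤ P₀ := LinearMap.ker lc
  have hlc₁ (m : M) : lc (Finsupp.single m 1) = m :=
    (Finsupp.linearCombination_single ℤ 1 m).trans (one_smul ℤ m)
  have hlc : Function.Surjective lc := fun m => ⟨Finsupp.single m 1, hlc₁ m⟩
  have hex : Function.Exact P₁.subtype lc := LinearMap.exact_subtype_ker_map lc
  -- The obvious section sends 0 to a nonzero basis vector. It is corrected there so that it can be
  -- applied to the coefficients of a finitely supported function.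
  let s : M → P₀ := fun m => if m = 0 then 0 else Finsupp.single m 1
  have hs0 : s 0 = 0 := if_pos rfl
  have hs : ∀ m, lc (s m) = m := by
    intro m
    by_cases hm : m = 0
    · rw [hm, hs0, map_zero]
    · rw [show s m = Finsupp.single m 1 from if_neg hm, hlc₁]
  let q' : SepUnits F →₀ P₀ := q.mapRange s hs0
  have hq' : q'.mapRange lc (map_zero lc) = q := by
    ext a
    simp [q', hs]
  obtain ⟨k', hk'⟩ := LinearMap.rTensor_surjective (ResOne F) hlc k
  obtain ⟨d, hd⟩ := ((rTensor_exact (ResZero F) hex hlc) (resDiff F P₀ k' - tensorOf q')).1 (by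
    rw [map_sub, ← resDiff_rTensor, hk', rTensor_tensorOf, hq', hqk, sub_self])
  -- The image of σk' − k' in `M` is zero, so it comes from some `ε` over P₁. Then σd − d is the
  -- differential of `ε` and disappears in P₁ ⊗ units.
  have hinv : ∀ σ : inertia W, ((inertiaUnits W) σ).lTensor P₁ (resClass F P₁ d) =
      resClass F P₁ d := by
    intro σ
    obtain ⟨ε, hε⟩ := ((rTensor_exact (ResOne F) hex hlc)
        ((resOneRep F σ.1).lTensor P₀ k' - k')).1 (by
      rw [map_sub, ← LinearMap.comp_apply, LinearMap.rTensor_comp_lTensor,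
        ← LinearMap.lTensor_comp_rTensor, LinearMap.comp_apply, hk', hk σ.1 σ.2, sub_self])
    have h₁ : (resZeroRep F σ.1).lTensor P₁ d - d = resDiff F P₁ ε := by
      apply Module.Flat.rTensor_preserves_injective_linearMap (M := ResZero F) P₁.subtype
        P₁.subtype_injective
      rw [← resDiff_rTensor, hε, map_sub, hd, ← LinearMap.comp_apply,
        LinearMap.rTensor_comp_lTensor, ← LinearMap.lTensor_comp_rTensor, LinearMap.comp_apply, hd,
        map_sub, map_sub]
      have h₂ := resDiff_tprod (1 : Representation ℤ (Gam F) P₀) σ.1 k'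
      rw [tprod_eq_lTensor _ _ (fun _ => rfl), tprod_eq_lTensor _ _ (fun _ => rfl)] at h₂
      have h₃ : (resZeroRep F σ.1).lTensor P₀ (tensorOf q') = tensorOf q' := by
        rw [tensorOf, Finsupp.sum, map_sum]
        refine Finset.sum_congr rfl fun a ha => ?_
        have : galUnits F σ.1 a = a := hq a (Finsupp.support_mapRange ha) σ.1 σ.2
        rw [LinearMap.lTensor_tmul]
        congr 1
        change Finsupp.mapDomain _ _ = _
        rw [Finsupp.mapDomain_single, this]
      rw [h₂, h₃]
      abel
    have h₄ := resClass_tprod (1 : Representation ℤ (Gam F) P₁) σ.1 d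
    rw [tprod_eq_lTensor _ _ (fun _ => rfl), tprod_eq_lTensor _ _ (fun _ => rfl),
      sub_eq_iff_eq_add.1 h₁, map_add, resClass_resDiff, zero_add] at h₄
    exact h₄.symm
  obtain ⟨c, hc⟩ := exists_invariants_lTensor (inertiaUnits W)
    (fun a => (finite_range_unitsRep a).subset (by rintro _ ⟨σ, rfl⟩; exact ⟨σ.1, rfl⟩)) _ hinv
  obtain ⟨t, ht, ht'⟩ := O.exists_lift q' (fun a ha => hq a (Finsupp.support_mapRange ha))
  have hsum : P₁.subtype.rTensor _ c + t = 0 := by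
    apply Module.Flat.lTensor_preserves_injective_linearMap (M := P₀)
      (inertiaUnits W).invariants.subtype (Submodule.subtype_injective _)
    rw [map_add, map_zero, ht, ← LinearMap.comp_apply, LinearMap.lTensor_comp_rTensor,
      ← LinearMap.rTensor_comp_lTensor, LinearMap.comp_apply, hc, ← resClass_rTensor, hd, map_sub,
      resClass_resDiff]
    abel
  have := congr_arg (fun r => lc (O.tensorOrd P₀ r)) hsum
  simp only [map_add, map_zero, tensorOrd_rTensor, ht', ← residue_mapRange, hq'] at this
  rw [← this, right_eq_add]
  exact (O.tensorOrd P₁ c).2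

end UnramifiedOrder

end Residue

/-! ### Conjugation and uniqueness of residues along a fixed valuation. -/

section ResidueCalculus

open scoped Pointwise

variable {F : Type u} [Field F]

lemma mem_inertia_iff {W : ValuationSubring (AlgebraicClosure F)} {σ : Gam F} :
    σ ∈ inertia W ↔ (∀ a, σ a ∈ W ↔ a ∈ W) ∧ ∀ a ∈ W, W.valuation (σ a - a) < 1 := by
  constructor
  · rintro ⟨⟨σ, hσ⟩, h, rfl⟩
    have h₁ : ∀ a, σ a ∈ W ↔ a ∈ W := fun a => by
      have := ValuationSubring.smul_mem_pointwise_smul_iff (g := σ) (S := W) (x := a)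
      rwa [show σ • W = W from hσ] at this
    refine ⟨h₁, fun a ha => ?_⟩
    have h₂ := RingEquiv.congr_fun (MonoidHom.mem_ker.1 h) (IsLocalRing.residue W ⟨a, ha⟩)
    change IsLocalRing.residue W ⟨σ a, (h₁ a).2 ha⟩ = IsLocalRing.residue W ⟨a, ha⟩ at h₂
    rw [← sub_eq_zero, ← map_sub, IsLocalRing.residue_eq_zero_iff,
      ValuationSubring.valuation_lt_one_iff] at h₂
    exact h₂
  · rintro ⟨h₁, h₂⟩
    have hσ : σ • W = W := by
      ext a
      rw [ValuationSubring.mem_pointwise_smul_iff_inv_smul_mem, ← h₁]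
      change σ (σ⁻¹ • a) ∈ W ↔ _
      rw [← AlgEquiv.smul_def, smul_inv_smul]
    refine ⟨⟨σ, hσ⟩, MonoidHom.mem_ker.2 (RingEquiv.ext fun r => ?_), rfl⟩
    obtain ⟨⟨a, ha⟩, rfl⟩ := IsLocalRing.residue_surjective r
    change IsLocalRing.residue W ⟨σ a, (h₁ a).2 ha⟩ = IsLocalRing.residue W ⟨a, ha⟩
    rw [← sub_eq_zero, ← map_sub, IsLocalRing.residue_eq_zero_iff,
      ValuationSubring.valuation_lt_one_iff]
    exact h₂ a ha

lemma valuation_eq_iff_of_mem_iff {L : Type*} [Field L] {W W' : ValuationSubring L} (σ : L →+* L)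
    (h : ∀ a, σ a ∈ W' ↔ a ∈ W) (a b : L) :
    W'.valuation (σ a) = W'.valuation (σ b) ↔ W.valuation a = W.valuation b := by
  have key (a b : L) : W'.valuation (σ a) ≤ W'.valuation (σ b) ↔ W.valuation a ≤ W.valuation b := by
    by_cases hb : b = 0
    · simp [hb]
    have h₁ (V : ValuationSubring L) (a b : L) (hb : b ≠ 0) :
        V.valuation a ≤ V.valuation b ↔ a / b ∈ V := by
      rw [← V.valuation_le_one_iff, map_div₀, div_le_one₀ (zero_lt_iff.2 (by simpa using hb))]
    rw [h₁ W a b hb, h₁ W' _ _ (by simpa using hb), ← map_div₀, h]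
  rw [le_antisymm_iff, key, key, ← le_antisymm_iff]

variable {M : Type u} [AddCommGroup M] {ρ : Representation ℤ (Gam F) M}
  {W : ValuationSubring (AlgebraicClosure F)} {π : F}
  {z : (M ⊗[ℤ] ResZero F) × (Gam F → M ⊗[ℤ] ResOne F)} {e : M}

lemma IsResidueOf.add_coboundary (h : IsResidueOf ρ W π z e) (k : M ⊗[ℤ] ResOne F) :
    IsResidueOf ρ W π (z + hyperCoboundary ρ k) e := by
  obtain ⟨κ, q, ord, h1, h2, h3, h4, h5⟩ := h
  refine ⟨κ + k, q, ord, h1, ?_, fun σ hσ => ?_, h4, h5⟩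
  · rw [map_add, Prod.fst_add, Prod.fst_add, h2, add_assoc]
  · rw [map_add, Prod.snd_add, Prod.snd_add, Pi.add_apply, Pi.add_apply, h3 σ hσ]

lemma tprod_tensorOf (σ : Gam F) (q : SepUnits F →₀ M) :
    ∃ q' : SepUnits F →₀ M, q'.support ⊆ q.support.map ⟨galUnits F σ, by
      intro a b hab
      apply coeUnit_injective
      apply σ.injective
      rw [← coe_galUnits, ← coe_galUnits, hab]⟩ ∧
      (∀ a, q' (galUnits F σ a) = ρ σ (q a)) ∧
      (ρ.tprod (resZeroRep F)) σ (tensorOf q) = tensorOf q' := by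
  classical
  generalize_proofs hinj
  refine ⟨(q.mapRange (ρ σ) (map_zero _)).embDomain ⟨galUnits F σ, hinj⟩, ?_, ?_, ?_⟩
  · rw [Finsupp.support_embDomain]
    exact Finset.map_subset_map.2 Finsupp.support_mapRange
  · intro a
    exact (Finsupp.embDomain_apply_self ⟨galUnits F σ, hinj⟩ _ a)
  · rw [tensorOf, tensorOf, Finsupp.sum_embDomain, Finsupp.sum_mapRange_index (by simp),
      Finsupp.sum, Finsupp.sum, map_sum]
    refine Finset.sum_congr rfl fun a _ => ?_
    refine congr_arg (fun r => ρ σ (q a) ⊗ₜ[ℤ] r) ?_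
    exact Finsupp.mapDomain_single

lemma galUnits_mul_apply (σ τ : Gam F) (a : SepUnits F) :
    galUnits F (σ * τ) a = galUnits F σ (galUnits F τ a) := by
  rw [map_mul]; rfl

lemma galUnits_one_apply (a : SepUnits F) : galUnits F 1 a = a := by
  rw [map_one]; rfl

/-- Conjugation by `σ` acts trivially on cohomology, so the same hypercocycle serves for the
conjugate valuation ring. The data that compute its residue are translated by `σ`, which carries the
inertia group of `W` to that of `W'`. -/
lemma IsResidueOf.conj (hz : z ∈ hyperCocycles ρ) (h : IsResidueOf ρ W π z e) (σ : Gam F)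
    {W' : ValuationSubring (AlgebraicClosure F)} (hW : ∀ a, σ a ∈ W' ↔ a ∈ W) :
    IsResidueOf ρ W' π z (ρ σ e) := by
  obtain ⟨κ, q, ord, h1, h2, h3, h4, h5⟩ := h
  obtain ⟨-, hc, hp⟩ := hz
  obtain ⟨q', hq's, hq', hq't⟩ := tprod_tensorOf (ρ := ρ) σ q
  have hin : ∀ τ ∈ inertia W', σ⁻¹ * τ * σ ∈ inertia W := by
    intro τ hτ
    rw [mem_inertia_iff] at hτ ⊢
    refine ⟨fun a => ?_, fun a ha => ?_⟩
    · rw [← hW, ← hW a, ← hτ.1 (σ a)]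
      simp
    · have := hτ.2 (σ a) ((hW a).2 ha)
      have h₂ : τ (σ a) - σ a = σ ((σ⁻¹ * τ * σ) a - a) := by
        rw [map_sub]
        simp
      rw [h₂] at this
      refine lt_of_le_of_ne ?_ fun h₃ => this.ne ?_
      · rw [W.valuation_le_one_iff, ← hW, ← W'.valuation_le_one_iff]
        exact this.le
      · rw [← map_one W.valuation, ← valuation_eq_iff_of_mem_iff (σ : _ →+* _) hW] at h₃
        rw [← map_one W'.valuation, ← map_one (σ : AlgebraicClosure F →+* AlgebraicClosure F)]
        exact h₃
  -- The term −c(σ) is the homotopy between `z` and its conjugate: the cocycle relation turns a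
  -- coboundary on σ⁻¹τσ into one on τ with this corrected cochain.
  refine ⟨(ρ.tprod (resOneRep F)) σ κ - z.2 σ, q', fun a => ord (galUnits F σ⁻¹ a),
    fun a ha τ hτ => ?_, ?_, fun τ hτ => ?_, fun a ha => ?_, ?_⟩
  · obtain ⟨b, hb, rfl⟩ := Finset.mem_map.1 (hq's ha)
    have := h1 b hb _ (hin τ hτ)
    change galUnits F τ (galUnits F σ b) = galUnits F σ b
    nth_rewrite 2 [← this]
    rw [← galUnits_mul_apply, ← galUnits_mul_apply]
    congr 2
    group
  · change z.1 = tensorOf q' + resDiff F M _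
    rw [map_sub, hp, resDiff_tprod, ← hq't]
    have := congr_arg ((ρ.tprod (resZeroRep F)) σ) h2
    rw [map_add] at this
    change _ = _ + (ρ.tprod (resZeroRep F)) σ (resDiff F M κ) at this
    rw [this]
    abel
  · change z.2 τ = (ρ.tprod (resOneRep F)) τ _ - _
    have h₁ := h3 _ (hin τ hτ)
    have h₂ := congr_arg ((ρ.tprod (resOneRep F)) σ) h₁
    change _ = (ρ.tprod (resOneRep F)) σ ((ρ.tprod (resOneRep F)) (σ⁻¹ * τ * σ) κ - κ) at h₂
    have h₃ := hc σ (σ⁻¹ * τ * σ)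
    have h₄ : σ * (σ⁻¹ * τ * σ) = τ * σ := by group
    rw [h₂, h₄, hc, map_sub, ← Module.End.mul_apply, ← map_mul, h₄, map_mul,
      Module.End.mul_apply] at h₃
    rw [map_sub, ← sub_eq_zero]
    rw [← sub_eq_zero] at h₃
    rw [← h₃]
    abel
  · obtain ⟨b, hb, rfl⟩ := Finset.mem_map.1 (hq's ha)
    have h₁ : galUnits F σ⁻¹ (galUnits F σ b) = b := by
      rw [← galUnits_mul_apply, inv_mul_cancel, galUnits_one_apply]
    have h₂ := h4 b hb
    change W'.valuation (coeUnit (galUnits F σ b)) = _ ^ ord (galUnits F σ⁻¹ (galUnits F σ b))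
    rw [h₁, coe_galUnits, ← σ.commutes π, ← map_zpow₀, ← map_zpow₀]
    rw [← map_zpow₀] at h₂
    exact (valuation_eq_iff_of_mem_iff (σ : AlgebraicClosure F →+* AlgebraicClosure F) hW _ _).2 h₂
  · have hinj : Function.Injective (galUnits F σ) := by
      intro a b hab
      apply coeUnit_injective
      apply σ.injective
      rw [← coe_galUnits, ← coe_galUnits, hab]
    rw [h5, Finsupp.sum_of_support_subset q' hq's _ (by simp), Finset.sum_map, Finsupp.sum, map_sum]
    refine Finset.sum_congr rfl fun b _ => ?_
    have h₁ : galUnits F σ⁻¹ (galUnits F σ b) = b := by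
      rw [← galUnits_mul_apply, inv_mul_cancel, galUnits_one_apply]
    change _ = ord (galUnits F σ⁻¹ (galUnits F σ b)) • q' (galUnits F σ b)
    rw [h₁, hq', map_zsmul]

lemma IsResidueOf.exists_eq (O : UnramifiedOrder W π) (h : IsResidueOf ρ W π z e) :
    ∃ (κ : M ⊗[ℤ] ResOne F) (q : SepUnits F →₀ M),
      (∀ a ∈ q.support, ∀ σ ∈ inertia W, galUnits F σ a = a) ∧
      z.1 = tensorOf q + (hyperCoboundary ρ κ).1 ∧
      (∀ σ ∈ inertia W, z.2 σ = (hyperCoboundary ρ κ).2 σ) ∧ e = O.residue q := by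
  obtain ⟨κ, q, ord, h1, h2, h3, h4, rfl⟩ := h
  exact ⟨κ, q, h1, h2, h3, Finset.sum_congr rfl fun a ha => by
    beta_reduce; rw [O.ordFun_eq (h1 a ha) (h4 a ha)]⟩

lemma isResidueOf_residue (O : UnramifiedOrder W π) (κ : M ⊗[ℤ] ResOne F) (q : SepUnits F →₀ M)
    (h1 : ∀ a ∈ q.support, ∀ σ ∈ inertia W, galUnits F σ a = a)
    (h2 : z.1 = tensorOf q + (hyperCoboundary ρ κ).1)
    (h3 : ∀ σ ∈ inertia W, z.2 σ = (hyperCoboundary ρ κ).2 σ) :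
    IsResidueOf ρ W π z (O.residue q) :=
  ⟨κ, q, O.ordFun, h1, h2, h3, fun a ha => O.valuation_eq_ordFun (h1 a ha), rfl⟩

/-- Two computations differ by a chain κ' − κ that inertia fixes and whose differential is the
difference of the two unit parts. `residue_eq_zero` applies to that difference. -/
lemma IsResidueOf.unique (O : UnramifiedOrder W π) (hI : ∀ σ ∈ inertia W, ∀ m, ρ σ m = m) {e' : M}
    (h : IsResidueOf ρ W π z e) (h' : IsResidueOf ρ W π z e') : e = e' := by
  classical
  obtain ⟨κ, q, h1, h2, h3, rfl⟩ := h.exists_eq O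
  obtain ⟨κ', q', h1', h2', h3', rfl⟩ := h'.exists_eq O
  have := O.residue_eq_zero (q - q') (fun a ha => by
    rcases Finset.mem_union.1 (Finsupp.support_sub ha) with h | h
    exacts [h1 a h, h1' a h]) (κ' - κ) (fun σ hσ => by
    have h₁ : (ρ.tprod (resOneRep F)) σ κ - κ = (ρ.tprod (resOneRep F)) σ κ' - κ' :=
      (h3 σ hσ).symm.trans (h3' σ hσ)
    rw [← tprod_eq_lTensor ρ _ (hI σ hσ), map_sub, ← sub_eq_zero]
    rw [← sub_eq_zero] at h₁
    rw [← neg_eq_zero, ← h₁]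
    abel) (by
    have h₁ : tensorOf q + resDiff F M κ = tensorOf q' + resDiff F M κ' := h2.symm.trans h2'
    rw [map_sub, tensorOf_sub, sub_eq_sub_iff_add_eq_add, add_comm, ← h₁, add_comm])
  have h₁ := O.residue_add (q - q') q'
  rw [this, zero_add, sub_add_cancel] at h₁
  exact h₁

end ResidueCalculus

/-! ### Vanishing of almost all residues, and lifting of residues along B → C. -/

section ResidueExistence

variable {F : Type u} [Field F]

/-- The cocycle is zero on the fixing subgroup of a finite extension. `T` collects a spanning set of
it, the units in p, and the nonzero differences of all these with their conjugates. If they are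
units of `W`, inertia fixes the elements themselves: it moves an integral element by something of
valuation < 1, but a nonzero difference is a unit. Hence the cocycle vanishes on inertia and the
units in p have order 0. -/
lemma exists_finite_isResidueOf_zero {M : Type u} [AddCommGroup M]
    {ρ : Representation ℤ (Gam F) M} {z : (M ⊗[ℤ] ResZero F) × (Gam F → M ⊗[ℤ] ResOne F)}
    (hz : z ∈ hyperCocycles ρ) :
    ∃ T : Set (AlgebraicClosure F), T.Finite ∧ (∀ ξ ∈ T, ξ ≠ 0) ∧
      ∀ (W : ValuationSubring (AlgebraicClosure F)) (π : F),
        (∀ ξ ∈ T, ξ ∈ W ∧ ξ⁻¹ ∈ W) → IsResidueOf ρ W π z 0 := by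
  classical
  obtain ⟨hlc, hc, hp⟩ := hz
  have hc1 : z.2 1 = 0 := by
    have := hc 1 1
    rw [mul_one, map_one, Module.End.one_apply] at this
    simpa using this
  have hnhds : {σ | z.2 σ = 0} ∈ nhds (1 : Gam F) := (hlc.isOpen_fiber 0).mem_nhds hc1
  obtain ⟨E, hE, hEs⟩ := (krullTopology_mem_nhds_one_iff _ _ _).1 hnhds
  obtain ⟨S, hS⟩ := hE.fg_top
  obtain ⟨q, hq⟩ := exists_tensorOf_eq z.1
  let T₀ : Set (AlgebraicClosure F) := E.val '' S ∪ coeUnit '' q.support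
  have hT₀ : T₀.Finite := (S.finite_toSet.image _).union (q.support.finite_toSet.image _)
  have hconj (a : AlgebraicClosure F) : (Set.range fun σ : Gam F => σ a).Finite := by
    refine ((minpoly F a).rootSet_finite (AlgebraicClosure F)).subset ?_
    rintro _ ⟨σ, rfl⟩
    rw [Polynomial.mem_rootSet_of_ne (minpoly.ne_zero (Algebra.IsIntegral.isIntegral a))]
    change Polynomial.aeval (σ.toAlgHom a) _ = 0
    rw [Polynomial.aeval_algHom_apply, minpoly.aeval, map_zero]
  let T : Set (AlgebraicClosure F) :=
    (T₀ ∪ ⋃ a ∈ T₀, (fun b => b - a) '' Set.range fun σ : Gam F => σ a) \ {0}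
  refine ⟨T, ((hT₀.union (hT₀.biUnion fun a _ => (hconj a).image _))).sdiff,
    fun ξ hξ => hξ.2, fun W π hW => ?_⟩
  have hfix : ∀ σ ∈ inertia W, ∀ a ∈ T₀, σ a = a := by
    intro σ hσ a ha
    by_contra hne
    have ha0 : a ≠ 0 := by
      rintro rfl
      exact hne (map_zero σ)
    have hd0 : σ a - a ≠ 0 := sub_ne_zero.2 hne
    have h₁ := hW a ⟨Or.inl ha, ha0⟩
    have h₂ := hW (σ a - a) ⟨Or.inr (Set.mem_biUnion ha ⟨σ a, ⟨σ, rfl⟩, rfl⟩), hd0⟩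
    have h₃ := (mem_inertia_iff.1 hσ).2 a h₁.1
    have h₄ := (W.valuation_le_one_iff _).2 h₂.2
    rw [map_inv₀, inv_le_one₀ (zero_lt_iff.2 (by simpa using hd0))] at h₄
    exact absurd h₃ h₄.not_gt
  have hval (a : SepUnits F) (ha : a ∈ q.support) : W.valuation (coeUnit a) = 1 := by
    have h₁ := hW (coeUnit a) ⟨Or.inl (Or.inr ⟨a, ha, rfl⟩), coeUnit_ne_zero a⟩
    refine le_antisymm ((W.valuation_le_one_iff _).2 h₁.1) ?_
    have h₂ := (W.valuation_le_one_iff _).2 h₁.2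
    rwa [map_inv₀, inv_le_one₀ (zero_lt_iff.2 (by simp))] at h₂
  refine ⟨0, q, fun _ => 0, fun a ha σ hσ => ?_, ?_, fun σ hσ => ?_, fun a ha => ?_, ?_⟩
  · apply coeUnit_injective
    rw [coe_galUnits]
    exact hfix σ hσ _ (Or.inr ⟨a, ha, rfl⟩)
  · rw [map_zero, hq, Prod.fst_zero, add_zero]
  · rw [map_zero]
    refine hEs ?_
    rw [SetLike.mem_coe, IntermediateField.mem_fixingSubgroup_iff]
    intro a ha
    have h : σ.toLinearMap ∘ₗ E.val.toLinearMap = E.val.toLinearMap :=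
      LinearMap.ext_on hS fun b hb => hfix σ hσ _ (Or.inl ⟨b, hb, rfl⟩)
    exact LinearMap.congr_fun h ⟨a, ha⟩
  · rw [zpow_zero]
    exact hval a ha
  · simp

variable {A B C : Type u} [AddCommGroup A] [AddCommGroup B] [AddCommGroup C]
  {ρA : Representation ℤ (Gam F) A} {ρB : Representation ℤ (Gam F) B}
  {ρC : Representation ℤ (Gam F) C} (f : ρA.IntertwiningMap ρB) (g : ρB.IntertwiningMap ρC)

/-- Lifts to `B` of the data for `C` fail only by a pair (p, c) over `A`, on which inertia acts
trivially. The class of p in A ⊗ units is fixed by inertia, so by flatness it comes from A ⊗ Fnrˣ.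
This corrects the lifted data. -/
lemma exists_isResidueOf [Module.Flat ℤ A] (hf : Function.Injective f.toLinearMap)
    (hg : Function.Surjective g.toLinearMap) (hfg : Function.Exact f.toLinearMap g.toLinearMap)
    {W : ValuationSubring (AlgebraicClosure F)} {π : F}
    (O : UnramifiedOrder W π) (hI : ∀ σ ∈ inertia W, ∀ m, ρB σ m = m)
    {z : (B ⊗[ℤ] ResZero F) × (Gam F → B ⊗[ℤ] ResOne F)} (hz : z ∈ hyperCocycles ρB) {e : C}
    (h : IsResidueOf ρC W π (pairMap g.toLinearMap z) e) : ∃ e', IsResidueOf ρB W π z e' := by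
  classical
  obtain ⟨hlc, hc, hp⟩ := hz
  obtain ⟨κ, q, h1, h2, h3, rfl⟩ := h.exists_eq O
  have hIA : ∀ σ ∈ inertia W, ∀ m, ρA σ m = m := fun σ hσ m => hf (by
    have := LinearMap.congr_fun (f.isIntertwining' σ) m
    exact this.trans (hI σ hσ _))
  have hf0 : Function.Injective (f.toLinearMap.rTensor (ResZero F)) :=
    Module.Flat.rTensor_preserves_injective_linearMap _ hf
  let s : C → B := fun m => if m = 0 then 0 else (hg m).choose
  have hs0 : s 0 = 0 := if_pos rfl
  have hs (m : C) : g.toLinearMap (s m) = m := by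
    by_cases hm : m = 0
    · rw [hm, hs0, map_zero]
    · rw [show s m = (hg m).choose from if_neg hm, (hg m).choose_spec]
  let qB : SepUnits F →₀ B := q.mapRange s hs0
  have hqB : qB.mapRange g.toLinearMap (map_zero _) = q := by
    ext a
    exact hs (q a)
  have hqBI : ∀ a ∈ qB.support, ∀ σ ∈ inertia W, galUnits F σ a = a :=
    fun a ha => h1 a (Finsupp.support_mapRange ha)
  have htq {N : Type u} [AddCommGroup N] (q : SepUnits F →₀ N)
      (hq : ∀ a ∈ q.support, ∀ σ ∈ inertia W, galUnits F σ a = a) (σ) (hσ : σ ∈ inertia W) :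
      (resZeroRep F σ).lTensor N (tensorOf q) = tensorOf q := by
    rw [tensorOf, Finsupp.sum, map_sum]
    refine Finset.sum_congr rfl fun a ha => ?_
    refine congr_arg (fun r => q a ⊗ₜ[ℤ] r) ?_
    refine Finsupp.mapDomain_single.trans ?_
    rw [hq a ha σ hσ]
  obtain ⟨κB, hκB⟩ := LinearMap.rTensor_surjective (ResOne F) hg κ
  obtain ⟨p, hpA⟩ := (rTensor_exact (ResZero F) hfg hg (z.1 - tensorOf qB - resDiff F B κB)).1 (by
    rw [map_sub, map_sub, ← resDiff_rTensor, hκB, rTensor_tensorOf, hqB, sub_sub, sub_eq_zero]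
    exact h2)
  have hc' : ∀ σ ∈ inertia W, ∃ c, f.toLinearMap.rTensor (ResOne F) c =
      z.2 σ - ((resOneRep F σ).lTensor B κB - κB) ∧
      resDiff F A c = (resZeroRep F σ).lTensor A p - p := by
    intro σ hσ
    have h₀ := h3 σ hσ
    change g.toLinearMap.rTensor (ResOne F) (z.2 σ) = (ρC.tprod (resOneRep F)) σ κ - κ at h₀
    obtain ⟨c, hcA⟩ := (rTensor_exact (ResOne F) hfg hg
      (z.2 σ - ((resOneRep F σ).lTensor B κB - κB))).1 (by
        rw [← tprod_eq_lTensor ρB _ (hI σ hσ), map_sub, map_sub, tprod_rTensor, hκB, h₀, sub_self])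
    refine ⟨c, hcA, hf0 ?_⟩
    rw [← resDiff_rTensor, hcA, ← tprod_eq_lTensor ρB _ (hI σ hσ),
      ← tprod_eq_lTensor ρA _ (hIA σ hσ), map_sub, map_sub, map_sub, tprod_rTensor, hpA, hp,
      resDiff_tprod, map_sub, map_sub, tprod_eq_lTensor ρB _ (hI σ hσ) (tensorOf qB),
      htq qB hqBI σ hσ]
    abel
  have hinv : ∀ σ : inertia W, (inertiaUnits W σ).lTensor A (resClass F A p) =
      resClass F A p := by
    intro σ
    obtain ⟨c, -, h⟩ := hc' σ.1 σ.2
    have h₁ := resClass_tprod ρA σ.1 p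
    rw [tprod_eq_lTensor ρA _ (hIA σ.1 σ.2), tprod_eq_lTensor ρA _ (hIA σ.1 σ.2),
      sub_eq_iff_eq_add.1 h.symm, map_add, resClass_resDiff, zero_add] at h₁
    exact h₁.symm
  obtain ⟨t, ht⟩ := exists_invariants_lTensor (inertiaUnits W)
    (fun a => (finite_range_unitsRep a).subset (by rintro _ ⟨σ, rfl⟩; exact ⟨σ.1, rfl⟩)) _ hinv
  obtain ⟨qA, hqA, hqAt⟩ : ∃ qA : SepUnits F →₀ A,
      (∀ a ∈ qA.support, ∀ σ ∈ inertia W, galUnits F σ a = a) ∧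
      resClass F A (tensorOf qA) = resClass F A p := by
    rw [← ht]
    clear ht
    induction t using TensorProduct.induction_on with
    | zero => exact ⟨0, by simp, by simp [tensorOf]⟩
    | add a b ha hb =>
      obtain ⟨q, h, h'⟩ := ha
      obtain ⟨q', k, k'⟩ := hb
      refine ⟨q + q', fun a ha => ?_, by rw [tensorOf_add, map_add, h', k', map_add]⟩
      rcases Finset.mem_union.1 (Finsupp.support_add ha) with h₁ | h₁
      exacts [h a h₁, k a h₁]
    | tmul m a =>
      refine ⟨Finsupp.single a.1.toMul m, fun b hb => ?_, ?_⟩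
      · rw [Finset.mem_singleton.1 (Finsupp.support_single_subset hb)]
        exact mem_inertiaUnits_invariants.1 a.2
      · rw [tensorOf, Finsupp.sum_single_index (by simp)]
        exact congr_arg (fun r => m ⊗ₜ[ℤ] r) (resAug_single a.1.toMul)
  obtain ⟨κA, hκA⟩ := (resDiff_resClass_exact (p - tensorOf qA)).1 (by
    rw [map_sub, hqAt, sub_self])
  refine ⟨_, isResidueOf_residue O (κB + f.toLinearMap.rTensor _ κA)
    (qB + qA.mapRange f.toLinearMap (map_zero _)) (fun a ha => ?_) ?_ fun σ hσ => ?_⟩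
  · rcases Finset.mem_union.1 (Finsupp.support_add ha) with h₁ | h₁
    exacts [hqBI a h₁, hqA a (Finsupp.support_mapRange h₁)]
  · change _ = _ + resDiff F B _
    rw [map_add, resDiff_rTensor, hκA, tensorOf_add, ← rTensor_tensorOf, map_sub, hpA]
    abel
  · change _ = (ρB.tprod (resOneRep F)) σ _ - _
    obtain ⟨c, h₁, h₂⟩ := hc' σ hσ
    -- Since `A` is flat, the differential is injective, so the cocycle part is forced by the part
    -- in degree 0.
    have h₃ : c = (resOneRep F σ).lTensor A κA - κA := by
      apply resDiff_injective
      have := resDiff_tprod ρA σ κA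
      rw [tprod_eq_lTensor ρA _ (hIA σ hσ), tprod_eq_lTensor ρA _ (hIA σ hσ)] at this
      rw [h₂, map_sub, this, hκA, map_sub, htq qA hqA σ hσ]
      abel
    rw [map_add, ← tprod_rTensor, tprod_eq_lTensor ρA _ (hIA σ hσ),
      tprod_eq_lTensor ρB _ (hI σ hσ)]
    rw [h₃, map_sub] at h₁
    rw [eq_sub_iff_add_eq] at h₁
    rw [← h₁]
    abel

end ResidueExistence

/-! ### Lifting invariants and classes in H¹(F, –(1)). -/

section HOneLift

variable {F : Type u} [Field F]

/-- A representation of the Galois group with continuous orbit maps for the discrete topology. -/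
def IsDiscreteRep {M : Type*} [AddCommGroup M] (ρ : Representation ℤ (Gam F) M) : Prop :=
  ∀ m, IsLocallyConstant fun σ => ρ σ m

lemma isDiscreteRep_of_stabilizer {M : Type*} [AddCommGroup M] {ρ : Representation ℤ (Gam F) M}
    (h : ∀ m, ∃ N : Subgroup (Gam F), IsOpen (N : Set (Gam F)) ∧ ∀ σ ∈ N, ρ σ m = m) :
    IsDiscreteRep ρ := by
  intro m
  obtain ⟨N, hN, hm⟩ := h m
  refine (IsLocallyConstant.iff_exists_open _).2 fun σ => ?_
  refine ⟨(fun τ => σ⁻¹ * τ) ⁻¹' N, hN.preimage (continuous_const_mul _), ?_, fun τ hτ => ?_⟩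
  · change σ⁻¹ * σ ∈ N
    rw [inv_mul_cancel]
    exact N.one_mem
  · have := hm _ hτ
    change ρ (σ⁻¹ * τ) m = m at this
    have h₂ : τ = σ * (σ⁻¹ * τ) := by group
    rw [h₂, map_mul, Module.End.mul_apply, this]

lemma IsDiscreteRep.tprod {M P : Type*} [AddCommGroup M] [AddCommGroup P]
    {ρ : Representation ℤ (Gam F) M} {η : Representation ℤ (Gam F) P} (hρ : IsDiscreteRep ρ)
    (hη : IsDiscreteRep η) : IsDiscreteRep (ρ.tprod η) := by
  intro t
  induction t using TensorProduct.induction_on with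
  | zero => simp only [map_zero]; exact IsLocallyConstant.const 0
  | add a b ha hb => simp only [map_add]; exact ha.add hb
  | tmul m p => exact (hρ m).comp₂ (hη p) fun a b => a ⊗ₜ[ℤ] b

lemma isDiscreteRep_unitsRep : IsDiscreteRep (unitsRep F) := by
  apply isDiscreteRep_of_stabilizer
  intro a
  refine ⟨(IntermediateField.adjoin F {coeUnit a.toMul}).fixingSubgroup, ?_, fun σ hσ => ?_⟩
  · have := IntermediateField.adjoin.finiteDimensional
      (K := F) (Algebra.IsIntegral.isIntegral (R := F) (coeUnit a.toMul))
    exact IntermediateField.fixingSubgroup_isOpen _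
  · refine Additive.toMul.injective (coeUnit_injective ?_)
    refine (coe_galUnits σ a.toMul).trans ?_
    exact (IntermediateField.mem_fixingSubgroup_iff _ _).1 hσ _
      (IntermediateField.mem_adjoin_simple_self F _)

lemma isDiscreteRep_resZeroRep : IsDiscreteRep (resZeroRep F) := by
  intro r
  induction r using Finsupp.induction_linear with
  | zero => simp only [map_zero]; exact IsLocallyConstant.const 0
  | add a b ha hb => simp only [map_add]; exact ha.add hb
  | single a n =>
    have := (isDiscreteRep_unitsRep (Additive.ofMul a)).comp
      fun b => (Finsupp.single b.toMul n : ResZero F)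
    convert this using 2 with σ
    exact Finsupp.mapDomain_single

variable {A B C : Type u} [AddCommGroup A] [AddCommGroup B] [AddCommGroup C]
  {ρA : Representation ℤ (Gam F) A} {ρB : Representation ℤ (Gam F) B}
  {ρC : Representation ℤ (Gam F) C} (f : ρA.IntertwiningMap ρB) (g : ρB.IntertwiningMap ρC)

/-- Every continuous 1-cocycle is a coboundary. -/
def HasTrivialHOne {M : Type*} [AddCommGroup M] (ρ : Representation ℤ (Gam F) M) : Prop :=
  ∀ h : Gam F → M, IsLocallyConstant h → (∀ σ τ, h (σ * τ) = h σ + ρ σ (h τ)) →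
    ∃ m, ∀ σ, h σ = ρ σ m - m

/-- The obstruction to lifting an invariant is the class of the cocycle σb − b with values in `A`,
where b is any lift. -/
lemma invMap_surjective (hA : HasTrivialHOne ρA) (hB : IsDiscreteRep ρB)
    (hf : Function.Injective f.toLinearMap) (hg : Function.Surjective g.toLinearMap)
    (hfg : Function.Exact f.toLinearMap g.toLinearMap) : Function.Surjective (invMap g) := by
  intro c
  obtain ⟨b, hb⟩ := hg c.1
  have h (σ : Gam F) : ∃ a, f.toLinearMap a = ρB σ b - b := (hfg _).1 (by
    have := LinearMap.congr_fun (g.isIntertwining' σ) b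
    rw [map_sub, hb, sub_eq_zero]
    refine this.trans ((congr_arg _ hb).trans ?_)
    exact c.2 σ)
  choose a ha using h
  have hal : IsLocallyConstant a := by
    have := ((hB b).sub (IsLocallyConstant.const b)).comp (Function.invFun f.toLinearMap)
    convert this using 1
    ext σ
    change a σ = Function.invFun f.toLinearMap (ρB σ b - b)
    rw [← ha, Function.leftInverse_invFun hf]
  obtain ⟨m, hm⟩ := hA a hal (fun σ τ => hf (by
    have := LinearMap.congr_fun (f.isIntertwining' σ) (a τ)
    rw [map_add, ha, ha, map_mul, Module.End.mul_apply]
    rw [LinearMap.comp_apply, LinearMap.comp_apply, ha, map_sub] at this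
    rw [this]
    abel))
  refine ⟨⟨b - f.toLinearMap m, fun σ => ?_⟩, Subtype.ext ?_⟩
  · have := LinearMap.congr_fun (f.isIntertwining' σ) m
    rw [LinearMap.comp_apply, LinearMap.comp_apply] at this
    have h₂ := ha σ
    rw [hm, map_sub, this] at h₂
    rw [map_sub, ← sub_eq_zero]
    rw [← sub_eq_zero] at h₂
    rw [← neg_eq_zero, ← h₂]
    abel
  · change g.toLinearMap (b - f.toLinearMap m) = c
    rw [map_sub, hb, hfg.apply_apply_eq_zero, sub_zero]

/-- Lifting (p, c) arbitrarily to `B` leaves an error over `A`: a 1-cochain `a` in A ⊗ ResZero and a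
2-cochain `d` in A ⊗ ResOne with dσ,τ mapping to the coboundary defect of `a`. As `A` is flat, A ⊗
ResOne → A ⊗ ResZero resolves A ⊗ units, where `a` becomes a 1-cocycle. A trivialization of it gives
corrections `u` of p and `v` of c. -/
lemma HOne.map_surjective [Module.Flat ℤ A] (hA : HasTrivialHOne (ρA.tprod (unitsRep F)))
    (hB : IsDiscreteRep ρB) (hAd : IsDiscreteRep ρA)
    (hf : Function.Injective f.toLinearMap) (hg : Function.Surjective g.toLinearMap)
    (hfg : Function.Exact f.toLinearMap g.toLinearMap) : Function.Surjective (HOne.map g) := by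
  intro α
  obtain ⟨⟨z, hlc, hc, hp⟩, rfl⟩ := QuotientAddGroup.mk'_surjective _ α
  have hf0 : Function.Injective (f.toLinearMap.rTensor (ResZero F)) :=
    Module.Flat.rTensor_preserves_injective_linearMap _ hf
  obtain ⟨p, hpz⟩ := LinearMap.rTensor_surjective (ResZero F) hg z.1
  -- Lifting the values of the cocycle by one fixed set-theoretic section keeps the lift locally
  -- constant.
  let s := Function.surjInv (LinearMap.rTensor_surjective (ResOne F) hg)
  have hs : ∀ t, g.toLinearMap.rTensor (ResOne F) (s t) = t :=
    Function.surjInv_eq (LinearMap.rTensor_surjective (ResOne F) hg)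
  let c : Gam F → B ⊗[ℤ] ResOne F := fun σ => s (z.2 σ)
  have hclc : IsLocallyConstant c := hlc.comp s
  have hcz (σ) : g.toLinearMap.rTensor (ResOne F) (c σ) = z.2 σ := hs _
  have h₁ (σ : Gam F) : ∃ a, f.toLinearMap.rTensor (ResZero F) a =
      resDiff F B (c σ) - ((ρB.tprod (resZeroRep F)) σ p - p) :=
    (rTensor_exact (ResZero F) hfg hg _).1 (by
      rw [map_sub, ← resDiff_rTensor, hcz, hp, map_sub, tprod_rTensor, hpz, sub_self])
  choose a ha using h₁
  have halc : IsLocallyConstant a := by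
    have := ((hclc.comp (resDiff F B)).sub (((hB.tprod isDiscreteRep_resZeroRep) p).sub
      (IsLocallyConstant.const p))).comp (Function.invFun (f.toLinearMap.rTensor (ResZero F)))
    convert this using 1
    ext σ
    change a σ = Function.invFun (f.toLinearMap.rTensor (ResZero F))
      (resDiff F B (c σ) - ((ρB.tprod (resZeroRep F)) σ p - p))
    rw [← ha, Function.leftInverse_invFun hf0]
  have h₂ (σ τ : Gam F) : ∃ d, f.toLinearMap.rTensor (ResOne F) d =
      c (σ * τ) - c σ - (ρB.tprod (resOneRep F)) σ (c τ) :=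
    (rTensor_exact (ResOne F) hfg hg _).1 (by
      rw [map_sub, map_sub, hcz, hcz, hc, tprod_rTensor, hcz]
      abel)
  choose d hd using h₂
  have hda (σ τ) : resDiff F A (d σ τ) = a (σ * τ) - a σ - (ρA.tprod (resZeroRep F)) σ (a τ) := by
    apply hf0
    rw [← resDiff_rTensor, hd, map_sub, map_sub, map_sub, map_sub, tprod_rTensor, ha, ha, ha,
      resDiff_tprod, map_sub, map_sub, map_mul, Module.End.mul_apply]
    abel
  obtain ⟨m, hm⟩ := hA (fun σ => resClass F A (a σ)) (halc.comp _) (fun σ τ => by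
    have h : resClass F A (a (σ * τ)) =
        resClass F A (a σ) + resClass F A ((ρA.tprod (resZeroRep F)) σ (a τ)) := by
      rw [← map_add, ← sub_eq_zero, ← map_sub, ← sub_sub, ← hda, resClass_resDiff]
    exact h.trans (congr_arg _ (resClass_tprod ρA σ (a τ))))
  obtain ⟨u, rfl⟩ := resClass_surjective m
  have h₃ (σ : Gam F) : ∃ v, resDiff F A v = a σ - ((ρA.tprod (resZeroRep F)) σ u - u) :=
    (resDiff_resClass_exact _).1 (by
      rw [map_sub, map_sub]
      exact sub_eq_zero.2 ((hm σ).trans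
        (congr_arg (· - resClass F A u) (resClass_tprod ρA σ u).symm)))
  choose v hv using h₃
  have hvlc : IsLocallyConstant v := by
    have := (halc.sub (((hAd.tprod isDiscreteRep_resZeroRep) u).sub
      (IsLocallyConstant.const u))).comp (Function.invFun (resDiff F A))
    convert this using 1
    ext σ
    change v σ = Function.invFun (resDiff F A) (a σ - ((ρA.tprod (resZeroRep F)) σ u - u))
    rw [← hv, Function.leftInverse_invFun resDiff_injective]
  have hdv (σ τ) : d σ τ = v (σ * τ) - v σ - (ρA.tprod (resOneRep F)) σ (v τ) := by
    apply resDiff_injective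
    rw [hda, map_sub, map_sub, resDiff_tprod, hv, hv, hv, map_sub, map_sub, map_mul,
      Module.End.mul_apply]
    abel
  refine ⟨HOne.mk ρB ⟨(p + f.toLinearMap.rTensor _ u, fun σ => c σ - f.toLinearMap.rTensor _ (v σ)),
    hclc.sub (hvlc.comp _), fun σ τ => ?_, fun σ => ?_⟩, ?_⟩
  · change c (σ * τ) - _ = c σ - _ + _
    have := hd σ τ
    rw [hdv, map_sub, map_sub, tprod_rTensor] at this
    rw [map_sub]
    rw [← sub_eq_zero] at this ⊢
    rw [← neg_eq_zero, ← this]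
    abel
  · change resDiff F B (c σ - _) = (ρB.tprod (resZeroRep F)) σ (p + f.toLinearMap.rTensor _ u) -
      (p + f.toLinearMap.rTensor _ u)
    have := ha σ
    rw [map_sub, resDiff_rTensor, hv, map_sub, map_sub, this, map_add, tprod_rTensor]
    abel
  · rw [HOne.map_mk]
    refine congr_arg (HOne.mk ρC) (Subtype.ext (Prod.ext ?_ (funext fun σ => ?_)))
    · change g.toLinearMap.rTensor _ (p + f.toLinearMap.rTensor _ u) = z.1
      rw [map_add, hpz, (rTensor_exact (ResZero F) hfg hg).apply_apply_eq_zero, add_zero]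
    · change g.toLinearMap.rTensor _ (c σ - f.toLinearMap.rTensor _ (v σ)) = z.2 σ
      rw [map_sub, hcz, (rTensor_exact (ResOne F) hfg hg).apply_apply_eq_zero, sub_zero]

end HOneLift

/-! ### Vanishing of H¹: coflasque lattices, permutation modules, Hilbert 90. -/

section TrivialHOne

variable {F : Type u} [Field F]

lemma exists_normal_fixingSubgroup_le {N : Set (Gam F)} (hN : N ∈ nhds 1) :
    ∃ E : IntermediateField F (AlgebraicClosure F), FiniteDimensional F E ∧ Normal F E ∧
      (E.fixingSubgroup : Set (Gam F)) ⊆ N :=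
  (krullTopology_mem_nhds_one_iff_of_normal _ _ _).1 hN

/-- By continuity `h` is zero on an open normal subgroup of finite index. A power of each σ lies
there, so a positive multiple of h(σ) is zero in a torsion-free group. -/
lemma eq_zero_of_map_mul {M : Type*} [AddCommGroup M] [IsAddTorsionFree M] {H : Subgroup (Gam F)}
    {h : Gam F → M} (hlc : IsLocallyConstant h)
    (hadd : ∀ σ ∈ H, ∀ τ ∈ H, h (σ * τ) = h σ + h τ) {σ : Gam F} (hσ : σ ∈ H) : h σ = 0 := by
  obtain ⟨E, hE, hE', hN⟩ := exists_normal_fixingSubgroup_le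
    ((hlc.isOpen_fiber (h 1)).mem_nhds (show (1 : Gam F) ∈ {τ | h τ = h 1} from rfl))
  have h1 : h 1 = 0 := by simpa using hadd 1 H.one_mem 1 H.one_mem
  have hpow (n : ℕ) : h (σ ^ n) = n • h σ := by
    induction n with
    | zero => simpa using h1
    | succ n ih => rw [pow_succ, hadd _ (H.pow_mem hσ n) _ hσ, ih, succ_nsmul]
  have hmem : σ ^ Nat.card (E ≃ₐ[F] E) ∈ E.fixingSubgroup := by
    rw [← IntermediateField.restrictNormalHom_ker, MonoidHom.mem_ker, map_pow]
    exact pow_card_eq_one'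
  have h₂ : h (σ ^ Nat.card (E ≃ₐ[F] E)) = h 1 := hN hmem
  rw [hpow, h1] at h₂
  exact (smul_eq_zero_iff_right Nat.card_pos.ne').1 h₂

lemma HasTrivialHOne.of_retract {M M' : Type*} [AddCommGroup M] [AddCommGroup M']
    {ρ : Representation ℤ (Gam F) M} {ρ' : Representation ℤ (Gam F) M'} (H : HasTrivialHOne ρ')
    (i : M →+ M') (p : M' →+ M) (hi : ∀ σ m, i (ρ σ m) = ρ' σ (i m))
    (hp : ∀ σ m, p (ρ' σ m) = ρ σ (p m)) (hpi : ∀ m, p (i m) = m) : HasTrivialHOne ρ := by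
  intro h hlc hc
  obtain ⟨m, hm⟩ := H (fun σ => i (h σ)) (hlc.comp i) fun σ τ => by rw [hc, map_add, hi]
  exact ⟨p m, fun σ => by rw [← hpi (h σ), hm, map_sub, hp]⟩

section Lattice

variable {R : Type u} [CommRing R] {G : Type u} [Group G]
  {M A : Type u} [AddCommGroup M] [Module R M] [AddCommGroup A]
  {ρ : Representation R G M} {ρA : Representation ℤ (Gam F) A} (ψ : Gam F →* G) (e : M ≃+ A)

/-- On the kernel of `ψ` the action is trivial and the cocycle is a homomorphism to a torsion-free
group, hence zero. The cocycle thus descends to the image of `ψ`, a subgroup of `G`, where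
coflasqueness applies. -/
lemma hasTrivialHOne_of_isCoflasqueRep [IsAddTorsionFree M] (hρ : IsCoflasqueRep ρ)
    (he : ∀ σ m, ρA σ (e m) = e (ρ (ψ σ) m)) : HasTrivialHOne ρA := by
  intro h hlc hc
  have he' (σ a) : e.symm (ρA σ a) = ρ (ψ σ) (e.symm a) := by
    rw [e.symm_apply_eq, ← he, e.apply_symm_apply]
  have hc' (σ τ) : e.symm (h (σ * τ)) = e.symm (h σ) + ρ (ψ σ) (e.symm (h τ)) := by
    rw [hc, map_add, he']
  have hker {σ} (hσ : σ ∈ ψ.ker) : e.symm (h σ) = 0 := by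
    refine eq_zero_of_map_mul (hlc.comp e.symm) (fun σ hσ τ hτ => ?_) hσ
    rw [Function.comp_apply, hc', (MonoidHom.mem_ker).1 hσ, map_one]
    rfl
  have hψ {σ τ} (hστ : ψ σ = ψ τ) : e.symm (h σ) = e.symm (h τ) := by
    have : τ = σ * (σ⁻¹ * τ) := by group
    rw [this, hc', hker (σ := σ⁻¹ * τ) (by simp [MonoidHom.mem_ker, hστ]), map_zero, add_zero]
  have hs (x : ψ.range) : ∃ σ, ψ σ = x := x.2
  choose s hs using hs
  let k : ψ.range → M := fun x => e.symm (h (s x))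
  let P := Rep.of (ρ.comp ψ.range.subtype)
  have hk : k ∈ groupCohomology.cocycles₁ P := by
    refine (groupCohomology.mem_cocycles₁_iff (A := P) k).2 fun x y => ?_
    rw [add_comm]
    change e.symm (h _) = e.symm (h _) + ρ x (e.symm (h _))
    rw [hψ (τ := s x * s y) (by rw [map_mul, hs, hs, hs]; rfl), hc', hs]
  have h0 : groupCohomology.H1π P ⟨k, hk⟩ = 0 := (hρ ψ.range).elim _ _
  obtain ⟨m, hm⟩ := (groupCohomology.H1π_eq_zero_iff _).1 h0
  refine ⟨e m, fun σ => ?_⟩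
  have h₂ : ρ (ψ σ) m - m = k ⟨ψ σ, σ, rfl⟩ := congr_fun hm ⟨ψ σ, σ, rfl⟩
  rw [he, ← map_sub, h₂]
  exact (e.apply_symm_apply _).symm.trans (congr_arg e (hψ (hs ⟨ψ σ, σ, rfl⟩).symm))

end Lattice

/-- The functions from a `Γ`-set to a representation of `Γ`. -/
def piRep {P : Type*} [AddCommGroup P] (η : Representation ℤ (Gam F) P) (S : Type*)
    [MulAction (Gam F) S] : Representation ℤ (Gam F) (S → P) where
  toFun σ :=
    { toFun := fun f s => η σ (f (σ⁻¹ • s))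
      map_add' := fun f g => by ext; simp
      map_smul' := fun n f => by ext; simp }
  map_one' := by ext; simp
  map_mul' σ τ := by ext; simp [mul_smul]

lemma piRep_apply {P : Type*} [AddCommGroup P] (η : Representation ℤ (Gam F) P) {S : Type*}
    [MulAction (Gam F) S] (σ : Gam F) (f : S → P) (s : S) :
    piRep η S σ f s = η σ (f (σ⁻¹ • s)) := rfl

/-- Shapiro's lemma by hand. Evaluated at a point s₀, the cocycle is a homomorphism on the
stabilizer, so it is zero there. Hence h(σ)(σs₀) depends only on the point σs₀, and with base points
chosen in the orbits this function of the point is, up to sign, a trivialization. -/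
lemma hasTrivialHOne_piRep_one {P : Type*} [AddCommGroup P] [IsAddTorsionFree P] (S : Type*)
    [MulAction (Gam F) S] : HasTrivialHOne (piRep (1 : Representation ℤ (Gam F) P) S) := by
  intro h hlc hc
  have hc' (σ τ s) : h (σ * τ) s = h σ s + h τ (σ⁻¹ • s) := congr_fun (hc σ τ) s
  have hr (s : S) : ∃ σ : Gam F, σ • (Quotient.mk (MulAction.orbitRel (Gam F) S) s).out = s :=
    MulAction.orbitRel_apply.1 (Quotient.exact (s := MulAction.orbitRel (Gam F) S)
      (Quotient.out_eq (Quotient.mk (MulAction.orbitRel (Gam F) S) s)).symm)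
  choose g hg using hr
  have key (s₀ : S) (σ τ : Gam F) (hστ : σ • s₀ = τ • s₀) : h σ (σ • s₀) = h τ (τ • s₀) := by
    have hη : σ⁻¹ * τ ∈ MulAction.stabilizer (Gam F) s₀ := by
      rw [MulAction.mem_stabilizer_iff, mul_smul, ← hστ, inv_smul_smul]
    have h0 := eq_zero_of_map_mul (H := MulAction.stabilizer (Gam F) s₀)
      (hlc.comp fun f => f s₀) (fun σ hσ τ hτ => by
        have : σ⁻¹ • s₀ = s₀ := MulAction.mem_stabilizer_iff.1 (inv_mem hσ)
        simp only [Function.comp_apply, hc', this]) hη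
    have : τ = σ * (σ⁻¹ * τ) := by group
    rw [← hστ]
    have h₂ := hc' σ (σ⁻¹ * τ) (σ • s₀)
    rw [← this, inv_smul_smul] at h₂
    exact (h₂.trans (add_eq_left.2 h0)).symm
  refine ⟨fun s => -h (g s) s, fun σ => funext fun s => ?_⟩
  have h₁ : h (g (σ⁻¹ • s)) (σ⁻¹ • s) = h (σ⁻¹ * g s) (σ⁻¹ • s) := by
    have hq : (Quotient.mk (MulAction.orbitRel (Gam F) S) (σ⁻¹ • s)) =
        Quotient.mk (MulAction.orbitRel (Gam F) S) s := Quotient.sound ⟨σ⁻¹, rfl⟩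
    have h₂ := key (Quotient.mk (MulAction.orbitRel (Gam F) S) s).out (g (σ⁻¹ • s)) (σ⁻¹ * g s)
      (by rw [mul_smul, hg, ← hq, hg])
    rwa [mul_smul, hg, ← hq, hg] at h₂
  have h₃ : h (g s) s = h σ s + h (σ⁻¹ * g s) (σ⁻¹ • s) := by
    rw [← hc']
    congr 1
    group
  change h σ s = -h (g (σ⁻¹ • s)) (σ⁻¹ • s) - -h (g s) s
  rw [h₁, h₃]
  abel

/-- Hilbert's theorem 90 for the functions from a `Γ`-set to the multiplicative group. -/
lemma hasTrivialHOne_unitsPi (S : Type*) [MulAction (Gam F) S] {N : Subgroup (Gam F)}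
    (hN : IsOpen (N : Set (Gam F))) (hNS : ∀ σ ∈ N, ∀ s : S, σ • s = s) :
    HasTrivialHOne (piRep (unitsRep F) S) := by
  classical
  intro h hlc hc
  -- `E` is a finite normal extension over which the cocycle is trivial and whose fixing subgroup
  -- acts trivially on `S`. Everything then happens over the finite quotient by that subgroup.
  obtain ⟨E, hE, hE', hEN⟩ := exists_normal_fixingSubgroup_le (Filter.inter_mem
    ((hlc.isOpen_fiber (h 1)).mem_nhds (show (1 : Gam F) ∈ {τ | h τ = h 1} from rfl))
    (hN.mem_nhds N.one_mem))
  let H : Subgroup (Gam F) := E.fixingSubgroup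
  have hH1 : ∀ σ ∈ H, h σ = 0 := fun σ hσ => by
    have h1 : h 1 = 0 := by
      have := hc 1 1
      rw [mul_one, map_one] at this
      exact left_eq_add.1 this
    rw [← h1]
    exact (hEN hσ).1
  have hHS : ∀ σ ∈ H, ∀ s : S, σ • s = s := fun σ hσ => hNS σ (hEN hσ).2
  have hHn : H.Normal := by
    change E.fixingSubgroup.Normal
    rw [← IntermediateField.restrictNormalHom_ker]
    infer_instance
  -- `E` may contain inseparable elements, while the trivialization must have separable values. The
  -- averaged elements are therefore taken from the separable part.
  let Es : IntermediateField F (AlgebraicClosure F) := E ⊓ separableClosure F (AlgebraicClosure F)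
  let v (σ : Gam F) (s : S) : AlgebraicClosure F := coeUnit (h σ s).toMul
  have hv0 (σ s) : v σ s ≠ 0 := coeUnit_ne_zero _
  have hv (σ τ : Gam F) (s : S) : v (σ * τ) s = v σ s * σ (v τ (σ⁻¹ • s)) := by
    change coeUnit _ = coeUnit _ * σ (coeUnit _)
    rw [hc, ← coe_galUnits]
    rfl
  have hv1 (σ) (hσ : σ ∈ H) (s : S) : v σ s = 1 := by
    change coeUnit _ = 1
    rw [hH1 σ hσ]
    rfl
  have : Finite (Gam F ⧸ H) := by
    have : (E.fixingSubgroup).FiniteIndex := by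
      rw [← IntermediateField.restrictNormalHom_ker]
      infer_instance
    exact Subgroup.finite_quotient_of_finiteIndex
  have := Fintype.ofFinite (Gam F ⧸ H)
  have hEs (n : Gam F) (hn : n ∈ H) (a : Es) : n (a : AlgebraicClosure F) = a :=
    (IntermediateField.mem_fixingSubgroup_iff _ _).1 hn _ a.2.1
  have hout (σ : Gam F) : ∃ n ∈ H, ((σ : Gam F ⧸ H)).out = σ * n := by
    refine ⟨σ⁻¹ * ((σ : Gam F ⧸ H)).out, QuotientGroup.eq.1 (QuotientGroup.out_eq' _).symm, ?_⟩
    group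
  let term (a : S → Es) (σ : Gam F) (s : S) : AlgebraicClosure F :=
    v σ s * σ (a (σ⁻¹ • s) : AlgebraicClosure F)
  have hterm (a : S → Es) (σ : Gam F) (s : S) : term a (σ : Gam F ⧸ H).out s = term a σ s := by
    obtain ⟨n, hn, h₂⟩ := hout σ
    change v _ s * (_ : Gam F) (_ : AlgebraicClosure F) = v σ s * σ _
    rw [h₂, hv, hv1 n hn, map_one, mul_one, mul_inv_rev, mul_smul, hHS _ (inv_mem hn),
      AlgEquiv.mul_apply, hEs n hn]
  -- The Poincaré series of Hilbert 90, for functions on `S`. It satisfies b(s) = v(τ)(s) ·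
  -- τ(b(τ⁻¹s)), so wherever it is nonzero its inverse trivializes the cocycle.
  let b (a : S → Es) (s : S) : AlgebraicClosure F := ∑ q : Gam F ⧸ H, term a q.out s
  have hb (a : S → Es) (τ : Gam F) (s : S) : b a s = v τ s * τ (b a (τ⁻¹ • s)) := by
    change ∑ q : Gam F ⧸ H, term a q.out s = _ * τ (∑ q : Gam F ⧸ H, term a q.out (τ⁻¹ • s))
    rw [map_sum, Finset.mul_sum, ← Equiv.sum_comp (Equiv.mulLeft (τ : Gam F ⧸ H))]
    refine Finset.sum_congr rfl fun q _ => ?_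
    have : (Equiv.mulLeft (τ : Gam F ⧸ H)) q = ((τ * q.out : Gam F) : Gam F ⧸ H) := by
      rw [QuotientGroup.mk_mul, QuotientGroup.out_eq']
      rfl
    rw [this, hterm]
    change v _ s * (τ * q.out) (_ : AlgebraicClosure F) = v τ s * τ (v _ _ * _)
    rw [hv, map_mul, mul_inv_rev, mul_smul, AlgEquiv.mul_apply, mul_assoc]
  -- An element of `E` has a power of p-power exponent in `Es`, and Frobenius is injective.
  -- Automorphisms that agree on `Es` therefore agree on `E`.
  have hinj : Function.Injective fun q : Gam F ⧸ H =>
      ((q.out : AlgebraicClosure F →* AlgebraicClosure F).comp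
        (Es.val : Es →* AlgebraicClosure F)) := by
    intro q q' hqq
    rw [← QuotientGroup.out_eq' q, ← QuotientGroup.out_eq' q']
    refine QuotientGroup.eq.2 ((IntermediateField.mem_fixingSubgroup_iff _ _).2 fun x hx => ?_)
    obtain ⟨n, hn⟩ := IsPurelyInseparable.pow_mem
      (separableClosure F (AlgebraicClosure F)) (ringExpChar F) x
    obtain ⟨y, hy⟩ := hn
    have hy' : x ^ ringExpChar F ^ n ∈ Es := ⟨pow_mem hx _, by rw [← hy]; exact y.2⟩
    have := ringExpChar.expChar F
    have : ExpChar (AlgebraicClosure F) (ringExpChar F) :=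
      expChar_of_injective_algebraMap (algebraMap F _).injective _
    have h₂ : q.out (x ^ ringExpChar F ^ n) = q'.out (x ^ ringExpChar F ^ n) :=
      DFunLike.congr_fun hqq (⟨_, hy'⟩ : Es)
    rw [map_pow, map_pow] at h₂
    have h₃ := iterateFrobenius_inj (AlgebraicClosure F) (ringExpChar F) n h₂
    rw [AlgEquiv.mul_apply, ← h₃]
    exact q.out.symm_apply_apply x
  -- Dedekind's independence of characters, with coefficients restricted to the stabilizer of `s₀`.
  -- The coset of 1 has coefficient 1, so the combination is not identically zero.
  have hx (s₀ : S) : ∃ x : Es, ∑ q : Gam F ⧸ H,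
      v q.out s₀ * (if q.out⁻¹ • s₀ = s₀ then q.out (x : AlgebraicClosure F) else 0) ≠ 0 := by
    by_contra! hcon
    have hli := ((linearIndependent_monoidHom Es (AlgebraicClosure F)).comp _ hinj)
    rw [Fintype.linearIndependent_iff] at hli
    have := hli (fun q => v q.out s₀ * (if q.out⁻¹ • s₀ = s₀ then 1 else 0)) (by
      ext x
      refine Eq.trans ?_ (hcon x)
      rw [Finset.sum_apply]
      refine Finset.sum_congr rfl fun q _ => ?_
      change _ * _ * q.out (x : AlgebraicClosure F) = _
      split_ifs <;> simp) ((1 : Gam F) : Gam F ⧸ H)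
    obtain ⟨n, hn, h₂⟩ := hout 1
    rw [h₂, one_mul, hv1 n hn, hHS _ (inv_mem hn), if_pos rfl, one_mul] at this
    exact one_ne_zero this
  choose x hx using hx
  let rep (s : S) : S := (Quotient.mk (MulAction.orbitRel (Gam F) S) s).out
  have hrep (s : S) : ∃ σ : Gam F, σ • rep s = s :=
    MulAction.orbitRel_apply.1 (Quotient.exact (s := MulAction.orbitRel (Gam F) S)
      (Quotient.out_eq (Quotient.mk (MulAction.orbitRel (Gam F) S) s)).symm)
  have hrep' (σ : Gam F) (s : S) : rep (σ • s) = rep s :=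
    congr_arg Quotient.out (Quotient.sound ⟨σ, rfl⟩)
  -- Supporting `a` on orbit representatives leaves only the stabilizer terms in the sum at a
  -- representative. The transformation rule carries nonvanishing to the rest of the orbit.
  let a (s : S) : Es := if s = rep s then x s else 0
  have hb0 (s : S) : b a s ≠ 0 := by
    obtain ⟨σ, hσ⟩ := hrep s
    have h₁ : rep (rep s) = rep s := by
      conv_rhs => rw [← hσ, hrep']
    have h₂ : b a (rep s) ≠ 0 := by
      convert hx (rep s) using 1
      refine Finset.sum_congr rfl fun q _ => ?_
      change _ * q.out ((if _ then _ else _ : Es) : AlgebraicClosure F) = _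
      congr 1
      rw [hrep', h₁]
      split_ifs with h
      · rw [h]
      · exact map_zero _
    rw [hb a σ⁻¹] at h₂
    rw [inv_inv, hσ] at h₂
    intro h0
    rw [h0, map_zero, mul_zero] at h₂
    exact h₂ rfl
  have hbs (s : S) : b a s ∈ separableClosure F (AlgebraicClosure F) := by
    refine sum_mem fun q _ => mul_mem (SetLike.coe_mem _) ?_
    exact mem_separableClosure_iff.2 (IsSeparable.map q.out.toAlgHom q.out.injective
      (mem_separableClosure_iff.1 (a _).2.2))
  let u (s : S) : SepUnits F := Units.mk0 ⟨b a s, hbs s⟩ fun h => hb0 s (congr_arg Subtype.val h)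
  refine ⟨fun s => -Additive.ofMul (u s), fun σ => funext fun s => ?_⟩
  change h σ s = unitsRep F σ (-Additive.ofMul (u (σ⁻¹ • s))) - -Additive.ofMul (u s)
  rw [map_neg, sub_neg_eq_add, neg_add_eq_sub, eq_sub_iff_add_eq]
  refine Additive.toMul.injective (coeUnit_injective ?_)
  refine Eq.trans ?_ (hb a σ s).symm
  exact congr_arg (v σ s * ·) (coe_galUnits σ (u (σ⁻¹ • s)))

end TrivialHOne

/-! ### Vanishing of H¹ for invertible lattices, also after tensoring with 𝔾ₘ. -/

section InvertibleHOne

lemma piRightHom_lTensor_apply {R A V ι : Type*} [AddCommGroup R] [AddCommGroup A] [AddCommGroup V]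
    (d : A →ₗ[ℤ] (ι → V)) (t : R ⊗[ℤ] A) (j : ι) :
    TensorProduct.piRightHom ℤ ℤ R (fun _ : ι => V) (d.lTensor R t) j =
      (LinearMap.proj j ∘ₗ d).lTensor R t := by
  induction t using TensorProduct.induction_on with
  | zero => simp
  | add a b ha hb => simp only [map_add, Pi.add_apply, ha, hb]
  | tmul m p => simp

variable {F : Type u} [Field F]

lemma exists_normal_finiteIndex_le {s : Set (Gam F)} (hs : s ∈ nhds 1) :
    ∃ N : Subgroup (Gam F), N.Normal ∧ N.FiniteIndex ∧ IsOpen (N : Set (Gam F)) ∧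
      (N : Set (Gam F)) ⊆ s := by
  obtain ⟨E, hE, hE', hEN⟩ := exists_normal_fixingSubgroup_le hs
  refine ⟨E.fixingSubgroup, ?_, ?_, IntermediateField.fixingSubgroup_isOpen _, hEN⟩
  · rw [← IntermediateField.restrictNormalHom_ker]
    infer_instance
  · rw [← IntermediateField.restrictNormalHom_ker]
    infer_instance

lemma IsDiscreteRep.finite_range {P : Type*} [AddCommGroup P] {η : Representation ℤ (Gam F) P}
    (hη : IsDiscreteRep η) (u : P) : (Set.range fun σ => η σ u).Finite := by
  obtain ⟨N, hn, hf, ho, hN⟩ := exists_normal_finiteIndex_le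
    (((hη u).isOpen_fiber u).mem_nhds (show (1 : Gam F) ∈ {σ | η σ u = u} by simp))
  have := Subgroup.finite_quotient_of_finiteIndex (H := N)
  refine (Set.finite_range fun q : Gam F ⧸ N => η q.out u).subset ?_
  rintro _ ⟨σ, rfl⟩
  refine ⟨(σ : Gam F ⧸ N), ?_⟩
  have h : (σ : Gam F ⧸ N).out⁻¹ * σ ∈ N := QuotientGroup.eq.1 (QuotientGroup.out_eq' _)
  have h₂ : η ((σ : Gam F ⧸ N).out⁻¹ * σ) u = u := hN h
  have h₃ : σ = (σ : Gam F ⧸ N).out * ((σ : Gam F ⧸ N).out⁻¹ * σ) := by group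
  change _ = η σ u
  conv_rhs => rw [h₃, map_mul, Module.End.mul_apply, h₂]

/-- A cocycle that is trivial on an open normal `N` has values in the N-invariants of R ⊗ P, which
by flatness are R ⊗ P^N. Cochains on the finite quotient by `N` commute with R ⊗ –, so the exactness
of 1-cochains with values in P^N survives tensoring with `R`. -/
lemma HasTrivialHOne.tprod_one {R P : Type*} [AddCommGroup R] [Module.Flat ℤ R] [AddCommGroup P]
    {η : Representation ℤ (Gam F) P} (H : HasTrivialHOne η) (hη : IsDiscreteRep η) :
    HasTrivialHOne ((1 : Representation ℤ (Gam F) R).tprod η) := by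
  classical
  intro h hlc hc
  replace hc : ∀ σ τ, h (σ * τ) = h σ + (η σ).lTensor R (h τ) := hc
  obtain ⟨N, hNn, hf, ho, hN⟩ := exists_normal_finiteIndex_le
    ((hlc.isOpen_fiber (h 1)).mem_nhds (show (1 : Gam F) ∈ {τ | h τ = h 1} from rfl))
  have h1 : h 1 = 0 := by
    have := hc 1 1
    rw [mul_one, map_one, Module.End.one_eq_id, LinearMap.lTensor_id] at this
    exact left_eq_add.1 this
  have hN1 : ∀ σ ∈ N, h σ = 0 := fun σ hσ => by
    rw [← h1]
    exact hN hσ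
  have := Subgroup.finite_quotient_of_finiteIndex (H := N)
  have := Fintype.ofFinite (Gam F ⧸ N)
  let θ : Representation ℤ N P := η.comp N.subtype
  let θ' := η.quotientToInvariants N
  have hθ' (σ : Gam F) (m : θ.invariants) : (θ' σ m : P) = η σ m := rfl
  have hval (σ : Gam F) : ∃ t, θ.invariants.subtype.lTensor R t = h σ := by
    refine exists_invariants_lTensor θ (fun u => (hη.finite_range u).subset ?_) _ fun n => ?_
    · rintro _ ⟨n, rfl⟩
      exact ⟨n, rfl⟩
    · have h₁ := hc n σ
      have h₂ : h (n * σ) = h σ := by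
        have : (n : Gam F) * σ = σ * (σ⁻¹ * n * σ) := by group
        rw [this, hc, hN1 (σ⁻¹ * n * σ), map_zero, add_zero]
        simpa using hNn.conj_mem n n.2 σ⁻¹
      rw [h₂, hN1 n n.2, zero_add] at h₁
      exact h₁.symm
  choose t ht using hval
  let V := θ.invariants
  have hinj : Function.Injective (V.subtype.lTensor R) :=
    Module.Flat.lTensor_preserves_injective_linearMap _ (Submodule.subtype_injective _)
  have hθt (σ : Gam F) (m : R ⊗[ℤ] V) :
      V.subtype.lTensor R ((θ' σ).lTensor R m) = (η σ).lTensor R (V.subtype.lTensor R m) := by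
    rw [← LinearMap.comp_apply, ← LinearMap.lTensor_comp, ← LinearMap.comp_apply,
      ← LinearMap.lTensor_comp]
    rfl
  have htN {σ τ : Gam F} (hστ : (σ : Gam F ⧸ N) = τ) : t σ = t τ := by
    apply hinj
    rw [ht, ht]
    have : τ = σ * (σ⁻¹ * τ) := by group
    rw [this, hc, hN1 _ (QuotientGroup.eq.1 hστ), map_zero, add_zero]
  have htc (σ τ) : t (σ * τ) = t σ + (θ' σ).lTensor R (t τ) := by
    apply hinj
    rw [map_add, hθt, ht, ht, ht, hc]
  -- The first two inhomogeneous differentials of the finite quotient with values in the invariants,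
  -- the second up to sign.
  let d₀ : V →ₗ[ℤ] ((Gam F ⧸ N) → V) := LinearMap.pi fun q => θ' q - LinearMap.id
  let pr (q : Gam F ⧸ N) : ((Gam F ⧸ N) → V) →ₗ[ℤ] V := LinearMap.proj q
  let d₁ : ((Gam F ⧸ N) → V) →ₗ[ℤ] ((Gam F ⧸ N) × (Gam F ⧸ N) → V) := LinearMap.pi fun p =>
    pr (p.1 * p.2) - pr p.1 - (θ' p.1) ∘ₗ pr p.2
  have hd : Function.Exact d₀ d₁ := by
    intro f
    constructor
    · intro hf0
      have hf1 (σ τ : Gam F) : f ((σ * τ : Gam F) : Gam F ⧸ N) = f σ + θ' σ (f τ) := by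
        have := congr_fun hf0 ((σ : Gam F ⧸ N), (τ : Gam F ⧸ N))
        exact sub_eq_zero.1 ((sub_sub _ _ _).symm.trans this)
      obtain ⟨m, hm⟩ := H (fun σ => (f σ : P))
        ((IsLocallyConstant.iff_exists_open _).2 fun σ => ⟨(fun τ => σ⁻¹ * τ) ⁻¹' N,
          ho.preimage (continuous_const_mul _), by simp [N.one_mem], fun τ hτ => by
            rw [QuotientGroup.eq.2 (show σ⁻¹ * τ ∈ N from hτ)]⟩)
        fun σ τ => congr_arg Subtype.val (hf1 σ τ)
      -- The cocycle depends only on cosets of `N`, so it takes on `N` its value at 1, which is 0.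
      -- This says that `m` is N-invariant.
      have hm' : m ∈ V := by
        intro n
        have h₁ := hm n
        have h₂ : ((n : Gam F) : Gam F ⧸ N) = ((1 : Gam F) : Gam F ⧸ N) :=
          (QuotientGroup.eq.2 (by simp)).symm
        have h₃ := hm 1
        rw [h₂, h₃, map_one, Module.End.one_apply, sub_self] at h₁
        exact (sub_eq_zero.1 h₁.symm)
      refine ⟨⟨m, hm'⟩, funext fun q => ?_⟩
      obtain ⟨σ, rfl⟩ := QuotientGroup.mk_surjective q
      exact Subtype.ext (hm σ).symm
    · rintro ⟨v, rfl⟩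
      ext ⟨q, q'⟩ : 1
      change (θ' (q * q') v - v) - (θ' q v - v) - θ' q (θ' q' v - v) = 0
      rw [map_mul, Module.End.mul_apply, map_sub]
      abel
  have hdR := Module.Flat.lTensor_exact R hd
  let T : R ⊗[ℤ] ((Gam F ⧸ N) → V) := (TensorProduct.piRight ℤ ℤ R fun _ => V).symm fun q => t q.out
  have hT (q) : (pr q).lTensor R T = t q.out := by
    have h₁ := piRightHom_lTensor_apply LinearMap.id T q
    rw [LinearMap.lTensor_id, LinearMap.id_apply, LinearMap.comp_id] at h₁
    rw [← h₁, ← TensorProduct.piRight_apply]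
    exact congr_fun (LinearEquiv.apply_symm_apply _ _) q
  obtain ⟨m, hm⟩ := (hdR T).1 (by
    apply (TensorProduct.piRight ℤ ℤ R fun _ => V).injective
    rw [map_zero]
    ext ⟨q, q'⟩ : 1
    rw [TensorProduct.piRight_apply, piRightHom_lTensor_apply]
    have : LinearMap.proj (q, q') ∘ₗ d₁ = pr (q * q') - pr q - (θ' q) ∘ₗ pr q' := rfl
    rw [this, LinearMap.lTensor_sub, LinearMap.lTensor_sub, LinearMap.lTensor_comp]
    simp only [LinearMap.sub_apply, LinearMap.comp_apply, hT]
    rw [htN (τ := q.out * q'.out) (by simp), htc]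
    have : θ' ((q.out : Gam F) : Gam F ⧸ N) = θ' q := by rw [QuotientGroup.out_eq']
    rw [this]
    simp)
  refine ⟨V.subtype.lTensor R m, fun σ => ?_⟩
  change h σ = (η σ).lTensor R _ - _
  rw [← hθt, ← map_sub, ← ht]
  congr 1
  rw [htN (τ := ((σ : Gam F ⧸ N)).out) (by simp), ← hT, ← hm, ← LinearMap.comp_apply,
    ← LinearMap.lTensor_comp]
  have : LinearMap.proj (σ : Gam F ⧸ N) ∘ₗ d₀ = θ' σ - LinearMap.id := rfl
  rw [this, LinearMap.lTensor_sub, LinearMap.lTensor_id]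
  rfl

lemma isDiscreteRep_piRep {P : Type*} [AddCommGroup P] {η : Representation ℤ (Gam F) P}
    (hη : IsDiscreteRep η) (S : Type*) [Finite S] [MulAction (Gam F) S] {N : Subgroup (Gam F)}
    (hN : IsOpen (N : Set (Gam F))) (hNS : ∀ σ ∈ N, ∀ s : S, σ • s = s) :
    IsDiscreteRep (piRep η S) := by
  refine isDiscreteRep_of_stabilizer fun f => ?_
  obtain ⟨N', -, -, ho, hN'⟩ := exists_normal_finiteIndex_le (s := N ∩ ⋂ s, {σ | η σ (f s) = f s})
    (Filter.inter_mem (hN.mem_nhds N.one_mem) (Filter.iInter_mem.2 fun s =>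
      ((hη (f s)).isOpen_fiber (f s)).mem_nhds (show (1 : Gam F) ∈ {σ | η σ (f s) = f s} by simp)))
  refine ⟨N', ho, fun σ hσ => funext fun s => ?_⟩
  rw [piRep_apply, hNS _ (inv_mem (hN' hσ).1)]
  exact Set.mem_iInter.1 (hN' hσ).2 s

section Lattice

variable {R : Type u} [CommRing R] {G : Type u} [Group G]
  {M A : Type u} [AddCommGroup M] [Module R M] [AddCommGroup A]
  {ρ : Representation R G M} {ρA : Representation ℤ (Gam F) A} (ψ : Gam F →* G) (e : M ≃+ A)

/-- An invertible lattice is a retract of a permutation lattice, in terms of coordinates. -/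
lemma IsInvertibleRep.exists_coords (hρ : IsInvertibleRep ρ)
    (he : ∀ σ m, ρA σ (e m) = e (ρ (ψ σ) m)) :
    ∃ (S : Type u) (_ : Fintype S) (_ : MulAction (Gam F) S) (c : S → A →+ R) (j : S → R →+ A),
      (∀ σ ∈ ψ.ker, ∀ s : S, σ • s = s) ∧ (∀ σ s a, c s (ρA σ a) = c (σ⁻¹ • s) a) ∧
      (∀ σ s r, ρA σ (j s r) = j (σ • s) r) ∧ ∀ a, ∑ s, j s (c s a) = a := by
  obtain ⟨S, hS, hGS, ι, p, hp⟩ := hρ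
  have := Fintype.ofFinite S
  have he' (σ a) : e.symm (ρA σ a) = ρ (ψ σ) (e.symm a) := by
    rw [e.symm_apply_eq, ← he, e.apply_symm_apply]
  refine ⟨S, this, MulAction.compHom S ψ,
    fun s => ((Finsupp.applyAddHom s).comp MonoidAlgebra.coeffAddEquiv.toAddMonoidHom).comp
      (ι.toLinearMap.toAddMonoidHom.comp e.symm.toAddMonoidHom),
    fun s => e.toAddMonoidHom.comp
      (p.toLinearMap.toAddMonoidHom.comp (MonoidAlgebra.singleAddHom s)),
    fun σ hσ s => ?_, fun σ s a => ?_, fun σ s r => ?_, fun a => ?_⟩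
  · change ψ σ • s = s
    rw [(MonoidHom.mem_ker).1 hσ, one_smul]
  · change (ι.toLinearMap (e.symm (ρA σ a))).coeff s =
      (ι.toLinearMap (e.symm a)).coeff (ψ σ⁻¹ • s)
    rw [he', map_inv]
    have := LinearMap.congr_fun (ι.isIntertwining' (ψ σ)) (e.symm a)
    refine (congr_arg (fun f => f.coeff s) this).trans ?_
    exact Representation.coeff_ofMulAction _ _ _
  · change ρA σ (e (p.toLinearMap (MonoidAlgebra.single s r))) =
      e (p.toLinearMap (MonoidAlgebra.single (ψ σ • s) r))
    rw [he]
    have := LinearMap.congr_fun (p.isIntertwining' (ψ σ)) (MonoidAlgebra.single s r)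
    refine congr_arg e (this.symm.trans (congr_arg p.toLinearMap ?_))
    exact Representation.ofMulAction_single _ _ _
  · change ∑ s, e (p.toLinearMap (MonoidAlgebra.single s ((ι.toLinearMap (e.symm a)).coeff s))) = a
    rw [← map_sum, ← map_sum]
    have : ∑ s, MonoidAlgebra.single s ((ι.toLinearMap (e.symm a)).coeff s) =
        ι.toLinearMap (e.symm a) :=
      MonoidAlgebra.coeff_injective
        ((MonoidAlgebra.coeff_sum _ _).trans (Finsupp.univ_sum_single _))
    rw [this, hp, e.apply_symm_apply]

/-- The coordinates exhibit the module as an equivariant retract of the functions S → R, with Γ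
acting through `S` only. -/
lemma hasTrivialHOne_of_isInvertibleRep [IsAddTorsionFree R] (hρ : IsInvertibleRep ρ)
    (he : ∀ σ m, ρA σ (e m) = e (ρ (ψ σ) m)) : HasTrivialHOne ρA := by
  obtain ⟨S, _, _, c, j, -, hc, hj, hjc⟩ := hρ.exists_coords ψ e he
  refine (hasTrivialHOne_piRep_one (F := F) (P := R) S).of_retract
    (AddMonoidHom.pi c) (∑ s, (j s).comp (Pi.evalAddMonoidHom _ s))
    (fun σ a => funext fun s => hc σ s a) (fun σ f => ?_) fun a => ?_
  · simp only [AddMonoidHom.finsetSum_apply, map_sum]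
    rw [← Equiv.sum_comp (MulAction.toPerm σ)]
    refine Finset.sum_congr rfl fun s _ => ?_
    change j (σ • s) (f (σ⁻¹ • σ • s)) = ρA σ (j s (f s))
    rw [inv_smul_smul, hj]
  · simp only [AddMonoidHom.finsetSum_apply]
    exact hjc a

/-- The coordinates make A ⊗ units a retract of R ⊗ (functions from S to units). Hilbert 90 handles
the functions and flatness of `R` handles the remaining factor. -/
lemma hasTrivialHOne_tprod_unitsRep [Module.Flat ℤ R] (hρ : IsInvertibleRep ρ)
    (hψ : IsOpen (ψ.ker : Set (Gam F))) (he : ∀ σ m, ρA σ (e m) = e (ρ (ψ σ) m)) :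
    HasTrivialHOne (ρA.tprod (unitsRep F)) := by
  classical
  obtain ⟨S, _, _, c, j, hS, hc, hj, hjc⟩ := hρ.exists_coords ψ e he
  let U := Additive (SepUnits F)
  -- The unit is placed at the coordinate s that carries the s-th coefficient of a. The map `p`
  -- evaluates at s and reassembles.
  let i : A ⊗[ℤ] U →ₗ[ℤ] R ⊗[ℤ] (S → U) := ∑ s, TensorProduct.map (c s).toIntLinearMap
    (LinearMap.single ℤ (fun _ : S => U) s)
  let p : R ⊗[ℤ] (S → U) →ₗ[ℤ] A ⊗[ℤ] U := ∑ s, TensorProduct.map (j s).toIntLinearMap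
    (Pi.evalAddMonoidHom (fun _ : S => U) s).toIntLinearMap
  have hi (a : A) (u : U) : i (a ⊗ₜ u) = ∑ s, c s a ⊗ₜ Pi.single s u :=
    LinearMap.sum_apply _ _ _
  have hp (r : R) (f : S → U) : p (r ⊗ₜ f) = ∑ s, j s r ⊗ₜ f s :=
    LinearMap.sum_apply _ _ _
  refine ((hasTrivialHOne_unitsPi S hψ hS).tprod_one (R := R)
    (isDiscreteRep_piRep isDiscreteRep_unitsRep S hψ hS)).of_retract
    i.toAddMonoidHom p.toAddMonoidHom (fun σ t => ?_) (fun σ t => ?_) fun t => ?_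
  · change i ((ρA.tprod (unitsRep F)) σ t) = (piRep (unitsRep F) S σ).lTensor R (i t)
    induction t using TensorProduct.induction_on with
    | zero => simp only [map_zero]
    | add a b ha hb => simp only [map_add, ha, hb]
    | tmul a u =>
      change i (ρA σ a ⊗ₜ unitsRep F σ u) = _
      rw [hi, hi, map_sum, ← Equiv.sum_comp (MulAction.toPerm σ)]
      refine Finset.sum_congr rfl fun s _ => ?_
      change c (σ • s) (ρA σ a) ⊗ₜ[ℤ] Pi.single (σ • s) (unitsRep F σ u) =
        c s a ⊗ₜ[ℤ] piRep (unitsRep F) S σ (Pi.single s u)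
      rw [hc, inv_smul_smul]
      congr 1
      ext s' : 1
      rw [piRep_apply, Pi.single_apply, Pi.single_apply]
      simp only [inv_smul_eq_iff]
      split_ifs <;> simp
  · change p ((piRep (unitsRep F) S σ).lTensor R t) = (ρA.tprod (unitsRep F)) σ (p t)
    induction t using TensorProduct.induction_on with
    | zero => simp only [map_zero]
    | add a b ha hb => simp only [map_add, ha, hb]
    | tmul r f =>
      rw [LinearMap.lTensor_tmul, hp, hp]
      refine Eq.trans ?_ (map_sum ((ρA.tprod (unitsRep F)) σ) _ _).symm
      rw [← Equiv.sum_comp (MulAction.toPerm σ)]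
      refine Finset.sum_congr rfl fun s _ => ?_
      change j (σ • s) r ⊗ₜ[ℤ] unitsRep F σ (f (σ⁻¹ • σ • s)) =
        ρA σ (j s r) ⊗ₜ[ℤ] unitsRep F σ (f s)
      rw [inv_smul_smul, hj]
  · change p (i t) = t
    induction t using TensorProduct.induction_on with
    | zero => simp only [map_zero]
    | add a b ha hb => simp only [map_add, ha, hb]
    | tmul a u =>
      rw [hi, map_sum]
      simp only [hp]
      have h (s : S) : ∑ s', j s' (c s a) ⊗ₜ[ℤ] (Pi.single s u : S → U) s' =
          j s (c s a) ⊗ₜ[ℤ] u := by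
        rw [Finset.sum_eq_single s]
        · rw [Pi.single_eq_same]
        · intro s' _ hs
          rw [Pi.single_eq_of_ne hs, TensorProduct.tmul_zero]
        · simp
      simp only [h]
      rw [← TensorProduct.sum_tmul, hjc]

end Lattice

end InvertibleHOne

/-! ### The vanishing statements for stalks of coflasque and invertible sheaves. -/

section StalkHOne

variable {R : Type u} [CommRing R] [Module.IsTorsionFree ℤ R] {X : Scheme.{u}}
  {E : EtaleSheaf X}

lemma flat_of_projective (M : Type*) [AddCommGroup M] [Module R M] [Module.Projective R M] :
    Module.Flat ℤ M := by
  have := Module.isTorsionFree_int_iff_isAddTorsionFree.1 ‹Module.IsTorsionFree ℤ R›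
  exact Module.Flat.trans ℤ R M

lemma isAddTorsionFree_of_projective (M : Type*) [AddCommGroup M] [Module R M]
    [Module.Projective R M] : IsAddTorsionFree M := by
  have := flat_of_projective (R := R) M
  exact Module.isTorsionFree_int_iff_isAddTorsionFree.1 inferInstance

lemma IsCoflasque.hasTrivialHOne (hE : IsCoflasque R E) (x : X) :
    HasTrivialHOne (stalkRep E x) := by
  obtain ⟨D, hx, hD⟩ := hE x
  obtain ⟨ψ, e, -, he⟩ := D.exists_stalk_equiv x hx
  have := isAddTorsionFree_of_projective (R := R) D.M
  exact hasTrivialHOne_of_isCoflasqueRep ψ e hD he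

lemma IsInvertible.hasTrivialHOne (hE : IsInvertible R E) (x : X) :
    HasTrivialHOne (stalkRep E x) := by
  obtain ⟨D, hx, hD⟩ := hE x
  obtain ⟨ψ, e, -, he⟩ := D.exists_stalk_equiv x hx
  have := Module.isTorsionFree_int_iff_isAddTorsionFree.1 ‹Module.IsTorsionFree ℤ R›
  exact hasTrivialHOne_of_isInvertibleRep ψ e hD he

lemma IsInvertible.hasTrivialHOne_tprod (hE : IsInvertible R E) (x : X) :
    HasTrivialHOne ((stalkRep E x).tprod (unitsRep (X.residueField x))) := by
  obtain ⟨D, hx, hD⟩ := hE x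
  obtain ⟨ψ, e, hψ, he⟩ := D.exists_stalk_equiv x hx
  exact hasTrivialHOne_tprod_unitsRep ψ e hD hψ he

lemma IsInvertible.flat_stalk (hE : IsInvertible R E) (x : X) : Module.Flat ℤ (stalk E x) := by
  obtain ⟨D, hx, hD⟩ := hE x
  obtain ⟨ψ, e, -, -⟩ := D.exists_stalk_equiv x hx
  have := flat_of_projective (R := R) D.M
  exact Module.Flat.of_linearEquiv e.symm.toIntLinearEquiv

lemma isDiscreteRep_stalkRep (E : EtaleSheaf X) (x : X) : IsDiscreteRep (stalkRep E x) :=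
  isDiscreteRep_of_stabilizer (exists_isOpen_stabilizer E x)

end StalkHOne

/-! ### Conjugacy of ring homomorphisms that agree on invariants. -/

section Conjugacy

open Polynomial

/-- Two homomorphisms to a domain which agree on the invariants of a group acting with finite orbits
are conjugate on every finite set. -/
lemma exists_smul_eq_of_fixed {G R L : Type*} [Group G] [CommRing R] [MulSemiringAction G R]
    [CommRing L] [IsDomain L] (hG : ∀ r : R, (MulAction.orbit G r).Finite) (φ φ' : R →+* L)
    (h : ∀ r : R, (∀ g : G, g • r = r) → φ r = φ' r) (s : Finset R) :
    ∃ g : G, ∀ r ∈ s, φ' (g • r) = φ r := by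
  classical
  -- Packing the elements of `s` as coefficients of one polynomial makes a single group element work
  -- for all of them.
  let f : R[X] := ∑ i : Fin s.card, monomial i (s.equivFin.symm i : R)
  have hf (g : G) (r : s) : (g • f).coeff (s.equivFin r) = g • (r : R) := by
    rw [Polynomial.coeff_smul, Polynomial.finsetSum_coeff, Finset.sum_eq_single (s.equivFin r)]
    · simp
    · intro i _ hi
      rw [coeff_monomial, if_neg (fun h => hi (Fin.ext h))]
    · simp
  have hfin : (MulAction.orbit G f).Finite := by
    have h₁ : (Set.range fun g : G => fun r : s => g • (r : R)).Finite :=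
      (Set.Finite.pi' fun r : s => hG r).subset (by rintro _ ⟨g, rfl⟩ r; exact ⟨g, rfl⟩)
    refine (h₁.image fun v : s → R => ∑ i : Fin s.card, monomial i (v (s.equivFin.symm i))).subset ?_
    rintro _ ⟨g, rfl⟩
    refine ⟨_, ⟨g, rfl⟩, ?_⟩
    simp only [f, Finset.smul_sum, Polynomial.smul_monomial]
  -- The coefficients of this orbit product are invariant, so `φ` and `φ'` give the same polynomial.
  -- Its root φ(f) must then be φ' of some translate of `f`.
  let N : R[X][X] := ∏ p ∈ hfin.toFinset, (X - C p)
  have hN (g : G) : g • N = N := by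
    change MulSemiringAction.toRingHom G _ g N = N
    rw [map_prod]
    refine Finset.prod_bij (fun p _ => g • p) (fun p hp => ?_) (fun p _ p' _ hpp => ?_)
      (fun p hp => ?_) fun p hp => ?_
    · rw [Set.Finite.mem_toFinset] at hp ⊢
      exact (MulAction.mem_orbit_iff.2 (by
        obtain ⟨g', rfl⟩ := hp
        exact ⟨g * g', mul_smul _ _ _⟩))
    · exact smul_left_cancel g hpp
    · rw [Set.Finite.mem_toFinset] at hp
      obtain ⟨g', rfl⟩ := hp
      refine ⟨(g⁻¹ * g') • f, ?_, ?_⟩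
      · rw [Set.Finite.mem_toFinset]
        exact ⟨_, rfl⟩
      · rw [mul_smul, smul_inv_smul]
    · rw [map_sub]
      change g • X - g • C p = _
      rw [Polynomial.smul_X]
      exact congr_arg (X - ·) (Polynomial.smul_C _ _)
  have hmap : N.map (mapRingHom φ) = N.map (mapRingHom φ') := by
    ext m n
    simp only [coeff_map, coe_mapRingHom]
    refine h _ fun g => ?_
    conv_rhs => rw [← hN g]
    rw [Polynomial.coeff_smul, Polynomial.coeff_smul]
  have h₀ : (N.map (mapRingHom φ)).eval (f.map φ) = 0 := by
    simp only [N, Polynomial.map_prod, eval_prod]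
    refine Finset.prod_eq_zero (i := f) ?_ ?_
    · rw [Set.Finite.mem_toFinset]
      exact MulAction.mem_orbit_self f
    · simp
  rw [hmap] at h₀
  simp only [N, Polynomial.map_prod, eval_prod] at h₀
  obtain ⟨p, hp, hp0⟩ := Finset.prod_eq_zero_iff.1 h₀
  rw [Set.Finite.mem_toFinset] at hp
  obtain ⟨g, rfl⟩ := hp
  refine ⟨g, fun r hr => ?_⟩
  have h₁ : f.map φ = (g • f).map φ' := by
    simpa [sub_eq_zero] using hp0
  have h₂ := congr_arg (fun p => p.coeff (s.equivFin ⟨r, hr⟩)) h₁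
  simp only [coeff_map, hf] at h₂
  rw [← h₂]
  congr 1
  have := hf 1 ⟨r, hr⟩
  rw [one_smul, one_smul] at this
  exact this

variable {K Ω : Type*} [Field K] [Field Ω] [Algebra K Ω]

/-- The intersection of the valuation rings of an extension field which contain `V`, that is, the
integral closure of `V`. -/
def valuationHull (V : ValuationSubring K) (Ω : Type*) [Field Ω] [Algebra K Ω] : Subring Ω :=
  ⨅ A : {A : ValuationSubring Ω // ∀ v ∈ V, algebraMap K Ω v ∈ A}, A.1.toSubring

lemma mem_valuationHull {V : ValuationSubring K} {b : Ω} : b ∈ valuationHull V Ω ↔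
    ∀ A : ValuationSubring Ω, (∀ v ∈ V, algebraMap K Ω v ∈ A) → b ∈ A := by
  simp [valuationHull, Subring.mem_iInf]

open scoped Pointwise in
instance {F : Type*} [Field F] [Algebra F K] [Algebra F Ω] [IsScalarTower F K Ω]
    (V : ValuationSubring F) : IsInvariantSubring (Ω ≃ₐ[K] Ω) (valuationHull V Ω) where
  smul_mem σ b hb := mem_valuationHull.2 fun A hA => by
    have : b ∈ σ⁻¹ • A := mem_valuationHull.1 hb _ fun v hv => by
      rw [ValuationSubring.mem_inv_pointwise_smul_iff]
      rw [IsScalarTower.algebraMap_apply F K Ω, AlgEquiv.smul_def, AlgEquiv.commutes,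
        ← IsScalarTower.algebraMap_apply]
      exact hA v hv
    rwa [ValuationSubring.mem_inv_pointwise_smul_iff] at this

lemma finite_orbit_algEquiv [Algebra.IsAlgebraic K Ω] (a : Ω) :
    (Set.range fun σ : Ω ≃ₐ[K] Ω => σ a).Finite := by
  refine ((minpoly K a).rootSet_finite Ω).subset ?_
  rintro _ ⟨σ, rfl⟩
  rw [mem_rootSet_of_ne (minpoly.ne_zero (Algebra.IsIntegral.isIntegral a))]
  change aeval (σ.toAlgHom a) _ = 0
  rw [aeval_algHom_apply, minpoly.aeval, map_zero]

lemma exists_algebraMap_eq_of_fixed [Normal K Ω] {a : Ω} (hs : IsSeparable K a)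
    (ha : ∀ σ : Ω ≃ₐ[K] Ω, σ a = a) : ∃ c, algebraMap K Ω c = a := by
  have h : (⟨a, hs⟩ : separableClosure K Ω) ∈
      (⊥ : IntermediateField K (separableClosure K Ω)) := by
    refine (InfiniteGalois.mem_bot_iff_fixed _).2 fun g => ?_
    obtain ⟨σ, rfl⟩ :=
      AlgEquiv.restrictNormalHom_surjective (F := K) (K₁ := separableClosure K Ω) Ω g
    apply Subtype.ext
    exact (AlgEquiv.restrictNormal_commutes σ (separableClosure K Ω) ⟨a, hs⟩).trans (ha σ)
  obtain ⟨c, hc⟩ := IntermediateField.mem_bot.1 h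
  exact ⟨c, congr_arg Subtype.val hc⟩

lemma exists_pow_mem_of_fixed [Normal K Ω] {a : Ω} (ha : ∀ σ : Ω ≃ₐ[K] Ω, σ a = a) :
    ∃ (n : ℕ) (c : K), a ^ ringExpChar K ^ n = algebraMap K Ω c := by
  obtain ⟨n, y, hy⟩ := IsPurelyInseparable.pow_mem (separableClosure K Ω) (ringExpChar K) a
  obtain ⟨c, hc⟩ := exists_algebraMap_eq_of_fixed (K := K) y.2 fun σ => by
    change σ (algebraMap _ Ω y) = algebraMap _ Ω y
    rw [hy, map_pow, ha]
  exact ⟨n, c, hy.symm.trans hc.symm⟩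

/-- Two homomorphisms to a field from an invariant subring of a normal extension which agree on the
elements of the base field are conjugate. -/
lemma exists_algEquiv_of_eq_on_base [Normal K Ω] (B : Subring Ω) [IsInvariantSubring (Ω ≃ₐ[K] Ω) B]
    {L : Type*} [Field L]
    (φ φ' : B →+* L)
    (h : ∀ (v : K) (hv hv' : algebraMap K Ω v ∈ B), φ ⟨_, hv⟩ = φ' ⟨_, hv'⟩) :
    ∃ σ : Ω ≃ₐ[K] Ω, ∀ b : B, φ' (σ • b) = φ b := by
  have hfin (r : B) : (MulAction.orbit (Ω ≃ₐ[K] Ω) r).Finite := by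
    refine Set.Finite.of_finite_image (f := Subtype.val)
      ((finite_orbit_algEquiv (K := K) (r : Ω)).subset ?_) Subtype.val_injective.injOn
    rintro _ ⟨_, ⟨σ, rfl⟩, rfl⟩
    exact ⟨σ, rfl⟩
  -- A fixed element is purely inseparable over `K`, so a power of it lies in the base, where the
  -- two maps agree. Frobenius is injective on `L`.
  have hfix (r : B) (hr : ∀ σ : Ω ≃ₐ[K] Ω, σ • r = r) : φ r = φ' r := by
    obtain ⟨n, c, hc⟩ := exists_pow_mem_of_fixed (K := K) (a := (r : Ω))
      fun σ => congr_arg Subtype.val (hr σ)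
    have hr' : algebraMap K Ω c ∈ B := hc ▸ pow_mem r.2 _
    have h₂ : r ^ ringExpChar K ^ n = ⟨_, hr'⟩ := Subtype.ext hc
    have h₃ : φ r ^ ringExpChar K ^ n = φ' r ^ ringExpChar K ^ n := by
      rw [← map_pow, ← map_pow, h₂, h]
    have hK := ringExpChar.expChar K
    generalize ringExpChar K = q at hK h₃
    cases hK with
    | zero => simpa using h₃
    | prime hq =>
      have := (CharP.charP_iff_prime_eq_zero (R := L) hq).2 (by
        have h₀ : (q : B) = 0 := Subtype.ext (by
          have := congr_arg (algebraMap K Ω) (CharP.cast_eq_zero K q)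
          rwa [map_natCast, map_zero] at this)
        rw [← map_natCast φ, h₀, map_zero])
      have := ExpChar.prime (R := L) hq
      exact iterateFrobenius_inj L q n h₃
  have key := exists_smul_eq_of_fixed hfin φ φ' hfix
  let C (b : B) : Set (Ω ≃ₐ[K] Ω) := {σ | φ' (σ • b) = φ b}
  -- Compactness of the Galois group in ultrafilter form. Finite sets of conditions are satisfiable
  -- by `key`, and since orbits are finite the ultrafilter selects a limit value at each element,
  -- which defines the automorphism.
  have hne : (⨅ s : Finset (B), Filter.principal (⋂ b ∈ s, C b)).NeBot := by
    classical
    refine Filter.iInf_neBot_of_directed' (fun s t => ⟨s ∪ t, ?_, ?_⟩) fun s => ?_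
    · exact Filter.principal_mono.2
        (Set.biInter_mono (fun b hb => Finset.mem_union_left t hb) fun _ _ => le_rfl)
    · exact Filter.principal_mono.2
        (Set.biInter_mono (fun b hb => Finset.mem_union_right s hb) fun _ _ => le_rfl)
    · obtain ⟨σ, hσ⟩ := key s
      exact Filter.principal_neBot_iff.2 ⟨σ, Set.mem_iInter₂.2 hσ⟩
  let 𝓤 := Ultrafilter.of (⨅ s : Finset (B), Filter.principal (⋂ b ∈ s, C b))
  have hC (b) : C b ∈ 𝓤 := by
    refine Ultrafilter.of_le _ (Filter.mem_iInf_of_mem {b} ?_)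
    simp
  have hev (a : Ω) : ∃ c, {σ : Ω ≃ₐ[K] Ω | σ a = c} ∈ 𝓤 := by
    obtain ⟨c, -, hc⟩ := (Ultrafilter.finite_biUnion_mem_iff (f := 𝓤)
      (s := fun c => {σ : Ω ≃ₐ[K] Ω | σ a = c}) (finite_orbit_algEquiv (K := K) a)).1 (by
        refine Filter.mem_of_superset Filter.univ_mem fun σ _ => ?_
        exact Set.mem_iUnion₂.2 ⟨σ a, ⟨σ, rfl⟩, rfl⟩)
    exact ⟨c, hc⟩
  choose c hc using hev
  let c' : Ω →ₐ[K] Ω :=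
    { toFun := c
      map_one' := by
        obtain ⟨σ, h₁⟩ := 𝓤.nonempty_of_mem (hc 1)
        exact h₁.symm.trans (map_one σ)
      map_zero' := by
        obtain ⟨σ, h₁⟩ := 𝓤.nonempty_of_mem (hc 0)
        exact h₁.symm.trans (map_zero σ)
      map_mul' := fun a b => by
        obtain ⟨σ, ⟨h₁, h₂⟩, h₃⟩ :=
          𝓤.nonempty_of_mem (Filter.inter_mem (Filter.inter_mem (hc a) (hc b)) (hc (a * b)))
        rw [← show σ a = c a from h₁, ← show σ b = c b from h₂, ← show σ (a * b) = _ from h₃,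
          map_mul]
      map_add' := fun a b => by
        obtain ⟨σ, ⟨h₁, h₂⟩, h₃⟩ :=
          𝓤.nonempty_of_mem (Filter.inter_mem (Filter.inter_mem (hc a) (hc b)) (hc (a + b)))
        rw [← show σ a = c a from h₁, ← show σ b = c b from h₂, ← show σ (a + b) = _ from h₃,
          map_add]
      commutes' := fun r => by
        obtain ⟨σ, h₁⟩ := 𝓤.nonempty_of_mem (hc (algebraMap K Ω r))
        exact h₁.symm.trans (σ.commutes r) }
  refine ⟨AlgEquiv.ofBijective c' (Algebra.IsAlgebraic.algHom_bijective c'), fun b => ?_⟩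
  obtain ⟨σ, h₁, h₂⟩ := 𝓤.nonempty_of_mem (Filter.inter_mem (hc b) (hC b))
  rw [← show φ' (σ • b) = φ b from h₂]
  congr 1
  exact Subtype.ext h₁.symm

end Conjugacy

/-! ### Extensions of a valuation ring to a normal extension are conjugate. -/

section ValuationExtension

open Polynomial

variable {K Ω : Type*} [Field K] [Field Ω] [Algebra K Ω]

/-- The inclusion of a valuation ring of `K` in an extension field. -/
abbrev valIncl (V : ValuationSubring K) (Ω : Type*) [Field Ω] [Algebra K Ω] : V →+* Ω :=
  (algebraMap K Ω).comp V.subtype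

/-- Divide the minimal polynomial by a coefficient of largest valuation. -/
lemma exists_polynomial_isUnit_coeff [Algebra.IsAlgebraic K Ω] (V : ValuationSubring K) (a : Ω) :
    ∃ P : V[X], P.eval₂ (valIncl V Ω) a = 0 ∧ ∃ j, IsUnit (P.coeff j) := by
  classical
  let p := minpoly K a
  have hp0 : p ≠ 0 := minpoly.ne_zero (Algebra.IsIntegral.isIntegral a)
  obtain ⟨j, hj, hmax⟩ := p.support.exists_max_image (fun i => V.valuation (p.coeff i))
    (by simpa using hp0)
  rw [mem_support_iff] at hj
  have hjv : V.valuation (p.coeff j) ≠ 0 := by simpa using hj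
  have hcoeff (i : ℕ) : (p.coeff j)⁻¹ * p.coeff i ∈ V := by
    rw [← V.valuation_le_one_iff, map_mul, map_inv₀]
    by_cases hi : i ∈ p.support
    · exact (inv_mul_le_one₀ (zero_lt_iff.2 hjv)).2 (hmax i hi)
    · rw [notMem_support_iff.1 hi]
      simp
  obtain ⟨P, hP⟩ : ∃ P : V[X], P.map V.subtype = C (p.coeff j)⁻¹ * p := by
    rw [← Polynomial.mem_lifts, Polynomial.lifts_iff_coeff_lifts]
    intro i
    rw [coeff_C_mul]
    exact ⟨⟨_, hcoeff i⟩, rfl⟩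
  refine ⟨P, ?_, j, ?_⟩
  · rw [valIncl, ← Polynomial.eval₂_map, hP, eval₂_mul, ← aeval_def, ← aeval_def, minpoly.aeval,
      mul_zero]
  · have h : P.coeff j = 1 := Subtype.ext (by
      have := congr_arg (fun q => q.coeff j) hP
      simp only [coeff_map, coeff_C_mul] at this
      rw [inv_mul_cancel₀ hj] at this
      exact this)
    rw [h]
    exact isUnit_one

lemma coeff_zero_iterate_divX {R : Type*} [CommRing R] (P : R[X]) (k : ℕ) :
    (divX^[k] P).coeff 0 = P.coeff k := by
  have (k i : ℕ) : (divX^[k] P).coeff i = P.coeff (k + i) := by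
    induction k generalizing i with
    | zero => simp
    | succ k ih => rw [Function.iterate_succ_apply', coeff_divX, ih]; congr 1; ring
  simpa using this k 0

lemma eval₂_iterate_divX {R S : Type*} [CommRing R] [CommRing S] (i : R →+* S) (a : S) (P : R[X])
    (k : ℕ) : (divX^[k] P).eval₂ i a = a * (divX^[k + 1] P).eval₂ i a + i (P.coeff k) := by
  conv_lhs => rw [← X_mul_divX_add (divX^[k] P)]
  rw [eval₂_add, eval₂_mul, eval₂_X, eval₂_C, coeff_zero_iterate_divX, Function.iterate_succ_apply']

lemma eval₂_mem_of_mem {V : ValuationSubring K} {A : ValuationSubring Ω}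
    (hA : ∀ v ∈ V, algebraMap K Ω v ∈ A) {a : Ω} (ha : a ∈ A) (P : V[X]) :
    P.eval₂ (valIncl V Ω) a ∈ A := by
  rw [eval₂_eq_sum_range]
  exact sum_mem fun i _ => mul_mem (hA _ (P.coeff i).2) (pow_mem ha i)

/-- Let A be a valuation ring of Ω containing `V`. If `a` is in A the claim is clear. Otherwise a⁻¹
is in A, and P(a) = 0 lets each Horner tail be computed from the previous one by subtracting a
coefficient and multiplying by a⁻¹. -/
lemma eval₂_iterate_divX_mem {V : ValuationSubring K} {a : Ω} {P : V[X]}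
    (hP : P.eval₂ (valIncl V Ω) a = 0) (k : ℕ) :
    (divX^[k] P).eval₂ (valIncl V Ω) a ∈ valuationHull V Ω := by
  refine mem_valuationHull.2 fun A hA => ?_
  by_cases ha : a ∈ A
  · exact eval₂_mem_of_mem hA ha _
  · have ha' : a⁻¹ ∈ A := (A.mem_or_inv_mem a).resolve_left ha
    have ha0 : a ≠ 0 := fun h => ha (h ▸ A.zero_mem)
    induction k with
    | zero => simp [hP, A.zero_mem]
    | succ k ih =>
      have h := eval₂_iterate_divX (valIncl V Ω) a P k
      have h₂ : (divX^[k + 1] P).eval₂ (valIncl V Ω) a =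
          a⁻¹ * ((divX^[k] P).eval₂ (valIncl V Ω) a - valIncl V Ω (P.coeff k)) := by
        rw [h]
        field_simp
        ring
      rw [h₂]
      exact mul_mem ha' (sub_mem ih (hA _ (P.coeff k).2))

lemma algebraMap_mem_valuationHull {V : ValuationSubring K} {v : K} (hv : v ∈ V) :
    algebraMap K Ω v ∈ valuationHull V Ω :=
  mem_valuationHull.2 fun _ hA => hA v hv

lemma valuationHull_le {V : ValuationSubring K} {W : ValuationSubring Ω}
    (hW : ∀ v ∈ V, algebraMap K Ω v ∈ W) {b : Ω} (hb : b ∈ valuationHull V Ω) : b ∈ W :=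
  mem_valuationHull.1 hb W hW

lemma valuation_coe_isUnit {L : Type*} [Field L] {W : ValuationSubring L} {u : W} (hu : IsUnit u) :
    W.valuation (u : L) = 1 := by
  exact (W.valuation_eq_one_iff u).1 hu

/-- A valuation ring of an algebraic extension is a localization of the integral closure. -/
lemma exists_mem_valuationHull_mul_mem [Algebra.IsAlgebraic K Ω] {V : ValuationSubring K}
    {W : ValuationSubring Ω} (hW : ∀ v ∈ V, algebraMap K Ω v ∈ W) {a : Ω} (ha : a ∈ W) :
    ∃ s ∈ valuationHull V Ω, W.valuation s = 1 ∧ a * s ∈ valuationHull V Ω := by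
  obtain ⟨P, hP, j, hj⟩ := exists_polynomial_isUnit_coeff V a
  let s (k : ℕ) : Ω := (divX^[k] P).eval₂ (valIncl V Ω) a
  have hs (k) : s k ∈ valuationHull V Ω := eval₂_iterate_divX_mem hP k
  have hs' (k) : s k = a * s (k + 1) + valIncl V Ω (P.coeff k) := eval₂_iterate_divX _ a P k
  -- If some tail s(k+1) were a unit of `W`, it would serve as the denominator, since a·s(k+1)
  -- differs from s(k) by a coefficient. So all tails have valuation < 1, which is impossible at the
  -- unit coefficient.
  by_contra! hcon
  have hlt (k : ℕ) : W.valuation (s k) < 1 := by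
    rcases k with _ | k
    · change W.valuation (P.eval₂ _ a) < 1
      rw [hP, map_zero]
      exact zero_lt_one
    · refine lt_of_le_of_ne ((W.valuation_le_one_iff _).2 (valuationHull_le hW (hs _))) fun h => ?_
      refine hcon _ (hs _) h ?_
      rw [← sub_eq_iff_eq_add.2 (hs' k)]
      exact sub_mem (hs k) (algebraMap_mem_valuationHull (P.coeff k).2)
  have hc : W.valuation (valIncl V Ω (P.coeff j)) < 1 := by
    rw [← sub_eq_iff_eq_add'.2 (hs' j)]
    refine lt_of_le_of_lt (W.valuation.map_sub _ _) (max_lt (hlt j) ?_)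
    rw [map_mul]
    exact mul_lt_one_of_nonneg_of_lt_one_right ((W.valuation_le_one_iff _).2 ha) zero_le (hlt _)
  obtain ⟨u, hu⟩ := hj
  refine hc.ne (valuation_coe_isUnit (u := (⟨valIncl V Ω (P.coeff j), hW _ (P.coeff j).2⟩ : W)) ?_)
  refine IsUnit.of_mul_eq_one ⟨valIncl V Ω ((u⁻¹ : Vˣ) : V), hW _ ((u⁻¹ : Vˣ) : V).2⟩
    (Subtype.ext ?_)
  change valIncl V Ω (P.coeff j) * valIncl V Ω ((u⁻¹ : Vˣ) : V) = 1
  rw [← hu, ← map_mul, Units.mul_inv, map_one]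

/-- A homomorphism on a valuation ring of an algebraic extension is local if it kills the maximal
ideal of the valuation ring below. -/
lemma isLocalHom_of_eq_zero [Algebra.IsAlgebraic K Ω] {V : ValuationSubring K}
    {W : ValuationSubring Ω} (hW : ∀ v ∈ V, algebraMap K Ω v ∈ W) {L : Type*} [Field L]
    (τ : W →+* L)
    (hτ : ∀ v : V, ¬ IsUnit v → τ ⟨algebraMap K Ω v, hW _ v.2⟩ = 0) : IsLocalHom τ := by
  classical
  refine ⟨fun x hx => ?_⟩
  by_contra hxu
  have hxm : W.valuation (x : Ω) < 1 := (W.valuation_lt_one_iff x).1 hxu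
  obtain ⟨P, hP, hj⟩ := exists_polynomial_isUnit_coeff V (x : Ω)
  let i : V →+* W := (valIncl V Ω).codRestrict W.toSubring fun v => hW _ v.2
  let s (k : ℕ) : W := (divX^[k] P).eval₂ i x
  have hs' (k) : s k = x * s (k + 1) + i (P.coeff k) := eval₂_iterate_divX i x P k
  have hs0 : s 0 = 0 := by
    apply Subtype.ext
    change W.subtype (P.eval₂ i x) = 0
    rw [Polynomial.hom_eval₂]
    exact hP
  -- Below the first unit coefficient `τ` kills all coefficients, so the vanishing propagates along
  -- the Horner tails. At that coefficient the tail is a unit, because `x` is assumed not to be one;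
  -- this contradicts τ(x) ≠ 0.
  have hk (k : ℕ) (hk : k ≤ Nat.find hj) : τ (s k) * τ x ^ k = 0 := by
    induction k with
    | zero => rw [hs0, map_zero, zero_mul]
    | succ k ih =>
      have h₁ : τ (i (P.coeff k)) = 0 := hτ _ (Nat.find_min hj (by omega))
      rw [← ih (by omega), hs' k, map_add, map_mul, h₁]
      ring
  have h₁ : IsUnit (s (Nat.find hj)) := by
    rw [hs']
    have h₂ : IsUnit (i (P.coeff (Nat.find hj))) := (Nat.find_spec hj).map i
    by_contra h
    have h₃ := (IsLocalRing.mem_maximalIdeal _).2 h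
    refine (IsLocalRing.mem_maximalIdeal _).1 ?_ h₂
    rw [Ideal.add_mem_iff_right] at h₃
    · exact h₃
    · exact Ideal.mul_mem_right _ _ ((IsLocalRing.mem_maximalIdeal _).2 hxu)
  exact (mul_ne_zero (h₁.map τ).ne_zero (pow_ne_zero _ hx.ne_zero)) (hk _ le_rfl)

/-- An automorphism compatible with two homomorphisms on the integral closure is compatible with
them on the valuation rings. -/
lemma exists_mem_iff_of_eq_on_hull [Algebra.IsAlgebraic K Ω] {V : ValuationSubring K}
    {W W' : ValuationSubring Ω} (hVW : ∀ v ∈ V, algebraMap K Ω v ∈ W)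
    (hVW' : ∀ v ∈ V, algebraMap K Ω v ∈ W') {L : Type*} [Field L] (τ : W →+* L) (τ' : W' →+* L)
    [IsLocalHom τ] [IsLocalHom τ'] (σ : Ω ≃ₐ[K] Ω)
    (hσB : ∀ {b}, b ∈ valuationHull V Ω → σ b ∈ valuationHull V Ω)
    (hσ' : ∀ b (hb : b ∈ valuationHull V Ω), τ' ⟨σ b, valuationHull_le hVW' (hσB hb)⟩ =
      τ ⟨b, valuationHull_le hVW hb⟩) :
    ∃ hσ : ∀ a, σ a ∈ W' ↔ a ∈ W, ∀ a (ha : a ∈ W), τ' ⟨σ a, (hσ a).2 ha⟩ = τ ⟨a, ha⟩ := by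
  -- Write `a` as a quotient of elements of the integral closure with denominator a unit of `W`.
  -- Locality of `τ'` keeps the translated denominator a unit of `W'`.
  have key (a : Ω) (ha : a ∈ W) : ∃ ha' : σ a ∈ W', τ' ⟨σ a, ha'⟩ = τ ⟨a, ha⟩ := by
    obtain ⟨s, hs, hs1, has⟩ := exists_mem_valuationHull_mul_mem hVW ha
    have hsu : IsUnit (⟨s, valuationHull_le hVW hs⟩ : W) := (W.valuation_eq_one_iff _).2 hs1
    have hsu' : IsUnit (⟨σ s, valuationHull_le hVW' (hσB hs)⟩ : W') := by
      refine (isUnit_map_iff τ' _).1 ?_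
      rw [hσ' s hs]
      exact hsu.map τ
    have hs0 : σ s ≠ 0 := by
      rintro h0
      exact hsu'.ne_zero (Subtype.ext h0)
    have h₁ : σ a ∈ W' := by
      rw [← W'.valuation_le_one_iff]
      have h₂ : W'.valuation (σ a * σ s) ≤ 1 := by
        rw [← map_mul, W'.valuation_le_one_iff]
        exact valuationHull_le hVW' (hσB has)
      rwa [map_mul, valuation_coe_isUnit hsu', mul_one] at h₂
    refine ⟨h₁, ?_⟩
    have h₂ : τ' ⟨σ a, h₁⟩ * τ' ⟨σ s, valuationHull_le hVW' (hσB hs)⟩ =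
        τ ⟨a, ha⟩ * τ ⟨s, valuationHull_le hVW hs⟩ := by
      rw [← map_mul, ← map_mul]
      refine Eq.trans ?_ (hσ' (a * s) has)
      congr 1
      exact Subtype.ext (map_mul σ a s).symm
    rw [hσ' s hs] at h₂
    exact mul_right_cancel₀ (hsu.map τ).ne_zero h₂
  refine ⟨fun a => ⟨fun ha => ?_, fun ha => (key a ha).1⟩, fun a ha => (key a ha).2⟩
  by_contra h
  have ha0 : a ≠ 0 := fun h0 => h (h0 ▸ W.zero_mem)
  have hinv : a⁻¹ ∈ W := (W.mem_or_inv_mem a).resolve_left h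
  obtain ⟨h₁, h₂⟩ := key _ hinv
  have hu : IsUnit (⟨σ a⁻¹, h₁⟩ : W') := IsUnit.of_mul_eq_one ⟨σ a, ha⟩ (Subtype.ext (by
    change σ a⁻¹ * σ a = 1
    rw [← map_mul, inv_mul_cancel₀ ha0, map_one]))
  have hu' : IsUnit (⟨a⁻¹, hinv⟩ : W) := by
    refine (isUnit_map_iff τ _).1 ?_
    rw [← h₂]
    exact hu.map τ'
  obtain ⟨b, hb⟩ := hu'.exists_right_inv
  have hb' : a⁻¹ * (b : Ω) = 1 := congr_arg Subtype.val hb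
  refine h ?_
  rw [inv_mul_eq_one₀ ha0] at hb'
  rw [hb']
  exact b.2

/-- Extensions of a valuation ring to a normal extension, together with an extension of the residue
homomorphism, are conjugate. -/
theorem exists_algEquiv_of_comap_eq [Normal K Ω] {V : ValuationSubring K}
    {W W' : ValuationSubring Ω} (hW : W.comap (algebraMap K Ω) = V)
    (hW' : W'.comap (algebraMap K Ω) = V) {L : Type*} [Field L] (τ : W →+* L) (τ' : W' →+* L)
    [IsLocalHom τ] [IsLocalHom τ']
    (h : ∀ v (hv : algebraMap K Ω v ∈ W) (hv' : algebraMap K Ω v ∈ W'), τ ⟨_, hv⟩ = τ' ⟨_, hv'⟩) :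
    ∃ (σ : Ω ≃ₐ[K] Ω) (hσ : ∀ a, σ a ∈ W' ↔ a ∈ W),
      ∀ a (ha : a ∈ W), τ' ⟨σ a, (hσ a).2 ha⟩ = τ ⟨a, ha⟩ := by
  have hVW : ∀ v ∈ V, algebraMap K Ω v ∈ W := fun v hv => by rwa [← hW] at hv
  have hVW' : ∀ v ∈ V, algebraMap K Ω v ∈ W' := fun v hv => by rwa [← hW'] at hv
  let ι : valuationHull V Ω →+* W := Subring.inclusion fun _ hb => valuationHull_le hVW hb
  let ι' : valuationHull V Ω →+* W' := Subring.inclusion fun _ hb => valuationHull_le hVW' hb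
  obtain ⟨σ, hσ⟩ := exists_algEquiv_of_eq_on_base (valuationHull V Ω) (τ.comp ι) (τ'.comp ι')
    fun v hv _ => h v _ _
  exact ⟨σ, exists_mem_iff_of_eq_on_hull hVW hVW' τ τ' σ
    (fun {b} hb => (σ • (⟨b, hb⟩ : valuationHull V Ω)).2) fun b hb => hσ ⟨b, hb⟩⟩

end ValuationExtension

/-! ### Separating one homomorphism from finitely many others by a single element. -/

section Separation

lemma finite_range_of_finiteIndex_ker {A B : Type*} [AddCommGroup A] [AddCommGroup B] (δ : A →+ B)
    (h : δ.ker.FiniteIndex) : (Set.range δ).Finite := by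
  have : Finite (A ⧸ δ.ker) := AddSubgroup.finite_quotient_of_finiteIndex
  have := Finite.of_equiv _ (QuotientAddGroup.quotientKerEquivRange δ).toEquiv
  exact Set.toFinite (δ.range : Set B)

/-- Otherwise the additive kernels of χᵢ − χ₀ cover `R`, so by B. H. Neumann's lemma one of them has
finite index. On it, multiplying the argument by a fixed r with χᵢ(r) ≠ χ₀(r) shows that χ₀ takes
finitely many values, and so χ₀ has finite range. -/
lemma exists_forall_ne_of_infinite {R L ι : Type*} [CommRing R] [Field L] [Finite ι] (χ₀ : R →+* L)
    (χ : ι → R →+* L) (hne : ∀ i, χ i ≠ χ₀) (hinf : (Set.range χ₀).Infinite) :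
    ∃ θ, ∀ i, χ i θ ≠ χ₀ θ := by
  by_contra! hcon
  have := Fintype.ofFinite ι
  let δ (i : ι) : R →+ L := (χ i : R →+ L) - χ₀
  obtain ⟨i, -, hi⟩ := Submodule.exists_finiteIndex_of_cover (R := ℤ) (s := Finset.univ)
    (p := fun i => (δ i).ker.toIntSubmodule) (by
      refine Set.eq_univ_of_forall fun θ => ?_
      obtain ⟨i, hi⟩ := hcon θ
      exact Set.mem_iUnion₂.2 ⟨i, Finset.mem_univ _, sub_eq_zero.2 hi⟩)
  replace hi : (δ i).ker.FiniteIndex := hi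
  have hD := finite_range_of_finiteIndex_ker (δ i) hi
  obtain ⟨r, hr⟩ := DFunLike.ne_iff.1 (hne i)
  have hr' : χ i r - χ₀ r ≠ 0 := sub_ne_zero.2 hr
  have hK : (χ₀ '' (δ i).ker).Finite := by
    refine Set.Finite.of_finite_image (f := fun l => l * (χ i r - χ₀ r)) (hD.subset ?_)
      fun a _ b _ hab => mul_right_cancel₀ hr' hab
    rintro _ ⟨_, ⟨s, hs, rfl⟩, rfl⟩
    refine ⟨r * s, ?_⟩
    have hs' : χ i s = χ₀ s := sub_eq_zero.1 hs
    change χ i (r * s) - χ₀ (r * s) = _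
    rw [map_mul, map_mul, hs']
    ring
  have : Finite (R ⧸ (δ i).ker) := AddSubgroup.finite_quotient_of_finiteIndex
  refine hinf (((Set.finite_range fun q : R ⧸ (δ i).ker => χ₀ q.out).add hK).subset ?_)
  rintro _ ⟨s, rfl⟩
  refine Set.mem_add.2 ⟨_, ⟨(s : R ⧸ (δ i).ker), rfl⟩,
    χ₀ (-(s : R ⧸ (δ i).ker).out + s), ⟨_, ?_, rfl⟩, ?_⟩
  · exact QuotientAddGroup.eq.1 (QuotientAddGroup.out_eq' _)
  · rw [← map_add]
    simp

/-- When χ₀ has finite range, its image is a finite field with cyclic unit group. A preimage of a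
generator separates χ₀ from every χᵢ with the same kernel. The other χᵢ are made to vanish by a
factor that χ₀ does not see. -/
lemma exists_forall_ne {R L ι : Type*} [CommRing R] [Field L] [Finite ι] (χ₀ : R →+* L)
    (χ : ι → R →+* L) (hne : ∀ i, χ i ≠ χ₀)
    (hker : ∀ i, RingHom.ker (χ i) ≤ RingHom.ker χ₀ → RingHom.ker χ₀ ≤ RingHom.ker (χ i)) :
    ∃ θ, ∀ i, χ i θ ≠ χ₀ θ := by
  classical
  by_cases hinf : (Set.range χ₀).Infinite
  · exact exists_forall_ne_of_infinite χ₀ χ hne hinf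
  rw [Set.not_infinite] at hinf
  have : Finite χ₀.range := hinf.to_subtype
  have := Fintype.ofFinite χ₀.range
  have := Fintype.ofFinite ι
  have hf : IsField χ₀.range := Finite.isField_of_domain _
  have hunit {r : R} (hr : χ₀ r ≠ 0) : IsUnit (χ₀.rangeRestrict r) := by
    obtain ⟨b, hb⟩ := hf.mul_inv_cancel (a := χ₀.rangeRestrict r) fun h => hr (congr_arg Subtype.val h)
    exact IsUnit.of_mul_eq_one _ hb
  obtain ⟨γ, hγ⟩ := IsCyclic.exists_generator (α := (χ₀.range)ˣ)
  obtain ⟨g, hg⟩ := χ₀.rangeRestrict_surjective γ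
  have hgen {r : R} (hr : χ₀ r ≠ 0) : ∃ k : ℕ, χ₀ r = χ₀ g ^ k := by
    obtain ⟨u, hu⟩ := hunit hr
    obtain ⟨k, hk⟩ := mem_powers_iff_mem_zpowers.2 (hγ u)
    refine ⟨k, ?_⟩
    have h₁ : χ₀.rangeRestrict r = χ₀.rangeRestrict g ^ k := by
      rw [← hu, ← hk, hg]
      simp
    exact congr_arg Subtype.val h₁
  have he (i : ι) : ∃ e : R, χ₀ e ≠ 0 ∧ (¬ RingHom.ker (χ i) ≤ RingHom.ker χ₀ → χ i e = 0) := by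
    by_cases h : RingHom.ker (χ i) ≤ RingHom.ker χ₀
    · exact ⟨1, by simp, fun h' => (h' h).elim⟩
    · obtain ⟨e, he, he'⟩ := SetLike.not_le_iff_exists.1 h
      exact ⟨e, he', fun _ => he⟩
  choose e he he' using he
  -- The exponent is the order of the unit group, so χ₀ sends the power to 1, while every χᵢ whose
  -- kernel is not contained in that of χ₀ sends it to 0.
  let θ : R := g * (∏ i, e i) ^ Fintype.card (χ₀.range)ˣ
  have hθ : χ₀ θ = χ₀ g := by
    have h₁ : χ₀ (∏ i, e i) ≠ 0 := by
      rw [map_prod]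
      exact Finset.prod_ne_zero_iff.2 fun i _ => he i
    obtain ⟨u, hu⟩ := hunit h₁
    have h₂ : χ₀.rangeRestrict (∏ i, e i) ^ Fintype.card (χ₀.range)ˣ = 1 := by
      rw [← hu, ← Units.val_pow_eq_pow_val, pow_card_eq_one, Units.val_one]
    have h₃ : χ₀ (∏ i, e i) ^ Fintype.card (χ₀.range)ˣ = 1 := congr_arg Subtype.val h₂
    rw [map_mul, map_pow, h₃, mul_one]
  have hg0 : χ₀ g ≠ 0 := fun h => γ.ne_zero (by
    rw [← hg]
    exact Subtype.ext h)
  refine ⟨θ, fun i hi => ?_⟩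
  by_cases h : RingHom.ker (χ i) ≤ RingHom.ker χ₀
  · refine hne i (RingHom.ext fun r => ?_)
    by_cases hr : χ₀ r = 0
    · rw [hr]
      exact hker i h hr
    · obtain ⟨k, hk⟩ := hgen hr
      have h₁ : r - θ ^ k ∈ RingHom.ker χ₀ := by
        rw [RingHom.mem_ker, map_sub, map_pow, hθ, hk, sub_self]
      have h₂ := hker i h h₁
      rw [RingHom.mem_ker, map_sub, map_pow, sub_eq_zero, hi, hθ] at h₂
      rw [h₂, hk]
  · rw [hθ, map_mul, map_pow, map_prod, Finset.prod_eq_zero (Finset.mem_univ i) (he' i h),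
      zero_pow Fintype.card_ne_zero, mul_zero] at hi
    exact hg0 hi.symm

end Separation

/-! ### Elements fixed by inertia have the valuation of a power of the uniformizer. -/

section Unramified

open Polynomial

variable {F : Type u} [Field F] {V : ValuationSubring F} {W : ValuationSubring (AlgebraicClosure F)}
  {L : Type u} [Field L]

lemma smul_mem_valuationHull (σ : Gam F) {b : AlgebraicClosure F}
    (hb : b ∈ valuationHull V (AlgebraicClosure F)) :
    σ b ∈ valuationHull V (AlgebraicClosure F) :=
  (σ • (⟨b, hb⟩ : valuationHull V (AlgebraicClosure F))).2

lemma mem_inertia_of_eq_on_hull (hW : ∀ v ∈ V, algebraMap F (AlgebraicClosure F) v ∈ W)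
    (τ : W →+* L) [IsLocalHom τ] {σ : Gam F}
    (h : ∀ b (hb : b ∈ valuationHull V (AlgebraicClosure F)),
      τ ⟨σ b, valuationHull_le hW (smul_mem_valuationHull σ hb)⟩ = τ ⟨b, valuationHull_le hW hb⟩) :
    σ ∈ inertia W := by
  obtain ⟨hσ, h₂⟩ := exists_mem_iff_of_eq_on_hull hW hW τ τ σ
    (fun hb => smul_mem_valuationHull σ hb) h
  refine mem_inertia_iff.2 ⟨hσ, fun a ha => ?_⟩
  refine (W.valuation_lt_one_iff (⟨σ a, (hσ a).2 ha⟩ - ⟨a, ha⟩)).1 ?_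
  rw [IsLocalRing.mem_maximalIdeal, mem_nonunits_iff, ← isUnit_map_iff τ, map_sub, h₂ a ha, sub_self]
  exact not_isUnit_zero

lemma isUnit_of_isUnit_algebraMap (hW : W.comap (algebraMap F _) = V) {v : V}
    {hv : algebraMap F (AlgebraicClosure F) v ∈ W} (h : IsUnit (⟨_, hv⟩ : W)) : IsUnit v := by
  obtain ⟨w, hw⟩ := h.exists_right_inv
  have hw' : algebraMap F (AlgebraicClosure F) v * w = 1 := congr_arg Subtype.val hw
  have hv0 : (v : F) ≠ 0 := fun h0 => by simp [h0] at hw'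
  have h₂ : (v : F)⁻¹ ∈ V := by
    refine hW.le ?_
    change algebraMap F _ (v : F)⁻¹ ∈ W
    rw [map_inv₀, ← eq_inv_of_mul_eq_one_right hw']
    exact w.2
  exact IsUnit.of_mul_eq_one ⟨_, h₂⟩ (Subtype.ext (mul_inv_cancel₀ hv0))

/-- Homomorphisms from subrings of the integral closure which kill the maximal ideal have
incomparable kernels. -/
lemma ker_le_ker {K : IntermediateField F (AlgebraicClosure F)}
    (φ φ' : ((K.toSubalgebra.toSubring ⊓ valuationHull V (AlgebraicClosure F) :
      Subring (AlgebraicClosure F))) →+* L)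
    (hφ : ∀ v : V, ¬ IsUnit v → φ ⟨algebraMap F _ v, K.algebraMap_mem _,
      algebraMap_mem_valuationHull v.2⟩ = 0)
    (h : RingHom.ker φ ≤ RingHom.ker φ') : RingHom.ker φ' ≤ RingHom.ker φ := by
  classical
  intro x hx
  by_contra hx0
  obtain ⟨P, hP, hj⟩ := exists_polynomial_isUnit_coeff V (x : AlgebraicClosure F)
  let R : Subring (AlgebraicClosure F) :=
    K.toSubalgebra.toSubring ⊓ valuationHull V (AlgebraicClosure F)
  let i : V →+* R := (valIncl V _).codRestrict R fun v =>
    ⟨K.algebraMap_mem _, algebraMap_mem_valuationHull v.2⟩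
  let s (k : ℕ) : R := (divX^[k] P).eval₂ i x
  have hs' (k) : s k = x * s (k + 1) + i (P.coeff k) := eval₂_iterate_divX i x P k
  have hs0 : s 0 = 0 := by
    apply Subtype.ext
    change R.subtype (P.eval₂ i x) = 0
    rw [Polynomial.hom_eval₂]
    exact hP
  have hk (k : ℕ) (hk : k ≤ Nat.find hj) : φ (s k) * φ x ^ k = 0 := by
    induction k with
    | zero => rw [hs0, map_zero, zero_mul]
    | succ k ih =>
      have h₁ : φ (i (P.coeff k)) = 0 := hφ _ (Nat.find_min hj (by omega))
      rw [← ih (by omega), hs' k, map_add, map_mul, h₁]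
      ring
  have h₁ : φ (s (Nat.find hj)) = 0 :=
    (mul_eq_zero.1 (hk _ le_rfl)).resolve_right (pow_ne_zero _ hx0)
  have h₂ : φ' (s (Nat.find hj)) = 0 := h h₁
  rw [hs', map_add, map_mul, show φ' x = 0 from hx, zero_mul, zero_add] at h₂
  exact (((Nat.find_spec hj).map i).map φ').ne_zero h₂

lemma apply_eq_of_mem_adjoin {a θ : AlgebraicClosure F} (hθ : θ ∈ IntermediateField.adjoin F {a})
    {σ : Gam F} (h : σ a = a) : σ θ = θ := by
  refine IntermediateField.adjoin_induction (p := fun x _ => σ x = x) F ?_ ?_ ?_ ?_ ?_ hθ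
  · rintro x rfl
    exact h
  · exact fun x => AlgEquiv.commutes _ x
  · intro x y _ _ hx hy
    rw [map_add, hx, hy]
  · intro x _ hx
    rw [map_inv₀, hx]
  · intro x y _ _ hx hy
    rw [map_mul, hx, hy]

/-- If `a` is fixed by the inertia group, some integral element of `F(a)` separates the residue
homomorphisms of the conjugates of `a`. -/
lemma exists_residue_separating (hW : W.comap (algebraMap F _) = V) (τ : W →+* L) [IsLocalHom τ]
    {a : AlgebraicClosure F} (ha : ∀ σ ∈ inertia W, σ a = a)
    (hVW : ∀ v ∈ V, algebraMap F (AlgebraicClosure F) v ∈ W) :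
    ∃ (θ : AlgebraicClosure F) (hθ : θ ∈ valuationHull V (AlgebraicClosure F)),
      θ ∈ IntermediateField.adjoin F {a} ∧ ∀ σ : Gam F, σ a ≠ a →
        τ ⟨σ θ, valuationHull_le hVW (smul_mem_valuationHull σ hθ)⟩ ≠
          τ ⟨θ, valuationHull_le hVW hθ⟩ := by
  classical
  let K := IntermediateField.adjoin F {a}
  let R : Subring (AlgebraicClosure F) :=
    K.toSubalgebra.toSubring ⊓ valuationHull V (AlgebraicClosure F)
  let χ (σ : Gam F) : R →+* L := τ.comp
    (((σ : AlgebraicClosure F →+* AlgebraicClosure F).comp R.subtype).codRestrict W.toSubring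
      fun r => valuationHull_le hVW (smul_mem_valuationHull σ r.2.2))
  have hχ (σ : Gam F) (r : R) : χ σ r =
    τ ⟨σ r, valuationHull_le hVW (smul_mem_valuationHull σ r.2.2)⟩ := rfl
  have hχa {σ σ' : Gam F} (h : σ a = σ' a) : χ σ = χ σ' := by
    ext r
    rw [hχ, hχ]
    congr 2
    have h₃ : (σ'⁻¹ * σ) r = r :=
      apply_eq_of_mem_adjoin r.2.1 (h ▸ σ'.symm_apply_apply a : σ'.symm (σ a) = a)
    exact (σ'.symm_apply_eq.1 h₃)
  -- If the residue maps of σ and 1 agree on F(a), then on the integral closure they are conjugate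
  -- by some ρ over F(a). Then σρ is in the inertia group and fixes `a`, as does ρ.
  have hχne (σ : Gam F) (hσ : χ σ = χ 1) : σ a = a := by
    let B := valuationHull V (AlgebraicClosure F)
    let φ : B →+* L := τ.comp (Subring.inclusion fun _ hb => valuationHull_le hVW hb)
    let φ' : B →+* L := τ.comp
      (((σ : AlgebraicClosure F →+* AlgebraicClosure F).comp B.subtype).codRestrict W.toSubring
        fun r => valuationHull_le hVW (smul_mem_valuationHull σ r.2))
    have : Normal K (AlgebraicClosure F) := inferInstance
    obtain ⟨ρ, hρ⟩ := exists_algEquiv_of_eq_on_base (K := K) B φ φ' fun v hv _ =>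
      (DFunLike.congr_fun hσ (⟨v, v.2, hv⟩ : R)).symm
    let ρ' : Gam F := ρ.restrictScalars F
    have hmem : σ * ρ' ∈ inertia W := mem_inertia_of_eq_on_hull hVW τ fun b hb => hρ ⟨b, hb⟩
    have h₁ := ha _ hmem
    have h₂ : ρ' a = a := ρ.commutes ⟨a, IntermediateField.mem_adjoin_simple_self F a⟩
    rwa [AlgEquiv.mul_apply, h₂] at h₁
  have hO := finite_orbit_algEquiv (K := F) a
  let ι := {c : Set.range fun σ : Gam F => σ a // (c : AlgebraicClosure F) ≠ a}
  have : Finite ι := by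
    have := hO.to_subtype
    infer_instance
  have hsel (c : ι) : ∃ σ : Gam F, σ a = c.1 := c.1.2
  choose s hs using hsel
  have hkill (σ : Gam F) (v : V) (hv : ¬ IsUnit v) : χ σ ⟨algebraMap F _ v, K.algebraMap_mem _,
      algebraMap_mem_valuationHull v.2⟩ = 0 := by
    by_contra h0
    have h₁ := (isUnit_map_iff τ _).1 (IsUnit.mk0 _ h0)
    refine hv (isUnit_of_isUnit_algebraMap hW (?_ : IsUnit (⟨_, hVW v v.2⟩ : W)))
    convert h₁ using 2
    exact (σ.commutes _).symm
  obtain ⟨θ, hθ⟩ := exists_forall_ne (χ 1) (fun c : ι => χ (s c))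
    (fun c h => c.2 ((hs c).symm.trans (hχne _ h))) fun c => ker_le_ker _ _ (hkill _)
  refine ⟨θ, θ.2.2, θ.2.1, fun σ hσ => ?_⟩
  have h₁ := hθ ⟨⟨σ a, σ, rfl⟩, hσ⟩
  rw [hχa (hs ⟨⟨σ a, σ, rfl⟩, hσ⟩ : _ = σ a)] at h₁
  exact h₁

/-- The polynomial with the conjugates of `θ` as its simple roots. -/
lemma exists_polynomial_of_residue_separating
    (hW : ∀ v ∈ V, algebraMap F (AlgebraicClosure F) v ∈ W)
    (hV : ∀ v, algebraMap F (AlgebraicClosure F) v ∈ W → v ∈ V)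
    (τ : W →+* L) [IsLocalHom τ] {θ : AlgebraicClosure F} (hs : IsSeparable F θ)
    (hθ : θ ∈ valuationHull V (AlgebraicClosure F))
    (h : ∀ σ : Gam F, σ θ ≠ θ → τ ⟨σ θ, valuationHull_le hW (smul_mem_valuationHull σ hθ)⟩ ≠
      τ ⟨θ, valuationHull_le hW hθ⟩) :
    ∃ Q : V[X], Q.eval₂ (valIncl V _) θ = 0 ∧
      W.valuation (Q.derivative.eval₂ (valIncl V _) θ) = 1 := by
  classical
  let O := (finite_orbit_algEquiv (K := F) θ).toFinset
  have hO {c} : c ∈ O ↔ ∃ σ : Gam F, σ θ = c := by simp [O]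
  let N : (AlgebraicClosure F)[X] := ∏ c ∈ O, (X - C c)
  have hN (σ : Gam F) : N.map (σ : AlgebraicClosure F →+* AlgebraicClosure F) = N := by
    simp only [N, Polynomial.map_prod, Polynomial.map_sub, map_X, map_C]
    refine Finset.prod_bij (fun c _ => σ c) (fun c hc => ?_) (fun c _ c' _ hcc => σ.injective hcc)
      (fun c hc => ?_) fun c _ => rfl
    · obtain ⟨ρ, rfl⟩ := hO.1 hc
      exact hO.2 ⟨σ * ρ, rfl⟩
    · obtain ⟨ρ, rfl⟩ := hO.1 hc
      exact ⟨(σ⁻¹ * ρ) θ, hO.2 ⟨_, rfl⟩, σ.apply_symm_apply _⟩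
  have hlift {S : Subring (AlgebraicClosure F)} (hS : ∀ c ∈ O, c ∈ S) (i : ℕ) : N.coeff i ∈ S := by
    have : N ∈ lifts S.subtype := by
      refine prod_mem fun c hc => ?_
      rw [sub_eq_add_neg, ← C_neg]
      exact add_mem (X_mem_lifts _) (C'_mem_lifts ⟨⟨-c, neg_mem (hS c hc)⟩, rfl⟩)
    obtain ⟨x, hx⟩ := (Polynomial.lifts_iff_coeff_lifts _).1 this i
    rw [← hx]
    exact x.2
  -- The coefficients are separable and Galois-invariant, so they lie in `F`; they are also
  -- integral, hence in `V`.
  have hcoeff (i : ℕ) : ∃ v : V, valIncl V (AlgebraicClosure F) v = N.coeff i := by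
    have h₁ : N.coeff i ∈ (separableClosure F (AlgebraicClosure F)).toSubalgebra.toSubring :=
      hlift (fun c hc => by
        obtain ⟨σ, rfl⟩ := hO.1 hc
        exact mem_separableClosure_iff.2 (IsSeparable.map σ.toAlgHom σ.injective hs)) i
    obtain ⟨v, hv⟩ := exists_algebraMap_eq_of_fixed (K := F) (mem_separableClosure_iff.1 h₁)
      fun σ => by
        conv_rhs => rw [← hN σ]
        rw [coeff_map]
        rfl
    have h₂ : N.coeff i ∈ valuationHull V (AlgebraicClosure F) := hlift (fun c hc => by
      obtain ⟨σ, rfl⟩ := hO.1 hc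
      exact smul_mem_valuationHull σ hθ) i
    exact ⟨⟨v, hV v (hv ▸ valuationHull_le hW h₂)⟩, hv⟩
  obtain ⟨Q, hQ⟩ : ∃ Q : V[X], Q.map (valIncl V _) = N := by
    rw [← Polynomial.mem_lifts, Polynomial.lifts_iff_coeff_lifts]
    exact hcoeff
  have hθO : θ ∈ O := hO.2 ⟨1, rfl⟩
  refine ⟨Q, ?_, ?_⟩
  · rw [← Polynomial.eval_map, hQ, Polynomial.eval_prod]
    exact Finset.prod_eq_zero hθO (by simp)
  · have h₁ : N = (X - C θ) * ∏ c ∈ O.erase θ, (X - C c) := (Finset.mul_prod_erase _ _ hθO).symm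
    rw [← Polynomial.eval_map, ← Polynomial.derivative_map, hQ, h₁, derivative_mul]
    simp only [derivative_sub, derivative_X, derivative_C, Polynomial.eval_add, Polynomial.eval_mul,
      Polynomial.eval_sub, Polynomial.eval_X, Polynomial.eval_C, sub_self, zero_mul, add_zero,
      sub_zero, one_mul, Polynomial.eval_prod, map_prod]
    refine Finset.prod_eq_one fun c hc => ?_
    obtain ⟨hne, hc⟩ := Finset.mem_erase.1 hc
    obtain ⟨σ, rfl⟩ := hO.1 hc
    have hu : IsUnit ((⟨θ, valuationHull_le hW hθ⟩ : W) -
        ⟨σ θ, valuationHull_le hW (smul_mem_valuationHull σ hθ)⟩) := by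
      refine (isUnit_map_iff τ _).1 (IsUnit.mk0 _ ?_)
      rw [map_sub, sub_ne_zero]
      exact (h σ hne).symm
    exact valuation_coe_isUnit hu

/-- An element of `V[θ]` of positive valuation is divisible by `π` up to a unit, when `θ` is a root
of a polynomial with invertible derivative. -/
lemma exists_valuation_eq_mul {π : V} (hπ : IsLocalRing.maximalIdeal V = Ideal.span {π})
    (hW : ∀ v ∈ V, algebraMap F (AlgebraicClosure F) v ∈ W)
    (τ : W →+* L) [IsLocalHom τ] (hτ : ∀ v : V, ¬ IsUnit v → τ ⟨algebraMap F _ v, hW _ v.2⟩ = 0)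
    {θ : AlgebraicClosure F} (hθ : θ ∈ W) {Q : V[X]}
    (hQ : Q.eval₂ (valIncl V _) θ = 0)
    (hQ' : W.valuation (Q.derivative.eval₂ (valIncl V _) θ) = 1) (f : V[X])
    (hf : W.valuation (f.eval₂ (valIncl V _) θ) < 1) :
    ∃ f' : V[X], W.valuation (f.eval₂ (valIncl V _) θ) =
      W.valuation (algebraMap F _ π) * W.valuation (f'.eval₂ (valIncl V _) θ) := by
  let i : V →+* W := (valIncl V _).codRestrict W.toSubring fun v => hW _ v.2
  let k := IsLocalRing.ResidueField V
  have : IsLocalHom (τ.comp i) := ⟨fun v hv => by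
    by_contra h
    exact hv.ne_zero (hτ v h)⟩
  let ι : k →+* L := IsLocalRing.ResidueField.lift (τ.comp i)
  let _ : Algebra k L := ι.toAlgebra
  let t : W := ⟨θ, hθ⟩
  have hev (g : V[X]) : ((g.eval₂ i t : W) : AlgebraicClosure F) = g.eval₂ (valIncl V _) θ :=
    Polynomial.hom_eval₂ g i W.subtype t
  have hred (g : V[X]) : aeval (τ t) (g.map (IsLocalRing.residue V)) = τ (g.eval₂ i t) := by
    rw [Polynomial.hom_eval₂, aeval_def, Polynomial.eval₂_map]
    rfl
  have hunit (g : V[X]) : aeval (τ t) (g.map (IsLocalRing.residue V)) ≠ 0 ↔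
      W.valuation (g.eval₂ (valIncl V _) θ) = 1 := by
    rw [hred, ← hev, ← W.valuation_eq_one_iff, ← isUnit_map_iff τ, isUnit_iff_ne_zero]
  have hQ0 : aeval (τ t) (Q.map (IsLocalRing.residue V)) = 0 := by
    rw [hred]
    exact (congr_arg τ (Subtype.ext ((hev Q).trans hQ))).trans (map_zero τ)
  have hQd : aeval (τ t) (derivative (Q.map (IsLocalRing.residue V))) ≠ 0 := by
    rw [Polynomial.derivative_map]
    exact (hunit _).2 hQ'
  have hf0 : aeval (τ t) (f.map (IsLocalRing.residue V)) = 0 := by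
    by_contra h
    exact hf.ne ((hunit _).1 h)
  -- The minimal polynomial of the residue of `θ` divides the reductions of both `Q` and `f`. The
  -- cofactor `H` of `Q` is a unit at `θ` since the root is simple, and Hf − Qm is divisible by `π`.
  -- Evaluation at `θ` kills `Q`.
  obtain ⟨h, hh⟩ := minpoly.dvd k (τ t) hQ0
  obtain ⟨m, hm⟩ := minpoly.dvd k (τ t) hf0
  obtain ⟨H, rfl⟩ := Polynomial.map_surjective _ IsLocalRing.residue_surjective h
  obtain ⟨m, rfl⟩ := Polynomial.map_surjective _ IsLocalRing.residue_surjective m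
  have hH : W.valuation (H.eval₂ (valIncl V _) θ) = 1 := by
    rw [← hunit]
    intro h0
    refine hQd ?_
    rw [hh, derivative_mul, map_add, map_mul, map_mul, h0, minpoly.aeval, mul_zero, zero_mul,
      add_zero]
  have hdvd : C π ∣ H * f - Q * m := by
    rw [Polynomial.C_dvd_iff_dvd_coeff]
    intro n
    rw [← Ideal.mem_span_singleton, ← hπ, ← IsLocalRing.residue_eq_zero_iff, ← coeff_map,
      Polynomial.map_sub, Polynomial.map_mul, Polynomial.map_mul, hh, hm]
    ring_nf
    exact coeff_zero n
  obtain ⟨f', hf'⟩ := hdvd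
  refine ⟨f', ?_⟩
  have h₁ := congr_arg (fun g => g.eval₂ (valIncl V (AlgebraicClosure F)) θ) hf'
  simp only [eval₂_sub, eval₂_mul, hQ, zero_mul, sub_zero, eval₂_C] at h₁
  have h₂ := congr_arg W.valuation h₁
  rw [map_mul, map_mul, hH, one_mul] at h₂
  exact h₂

/-- The lowest nonzero coefficient of a polynomial with root `b` is −b times a Horner tail, which is
integral. That coefficient is a unit times a power of `π`. This bound ends the division process in
`exists_zpow_valuation_eq`. -/
lemma exists_pow_le_valuation {π : V} [IsDiscreteValuationRing V] (hπ : Irreducible π)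
    (hW : ∀ v ∈ V, algebraMap F (AlgebraicClosure F) v ∈ W) {b : AlgebraicClosure F} (hb : b ≠ 0) :
    ∃ m : ℕ, W.valuation (algebraMap F _ π) ^ m ≤ W.valuation b := by
  classical
  obtain ⟨P, hP, j₀, hj₀⟩ := exists_polynomial_isUnit_coeff V b
  have hex : ∃ j, P.coeff j ≠ 0 := ⟨j₀, hj₀.ne_zero⟩
  let j := Nat.find hex
  have hs (k) : (divX^[k] P).eval₂ (valIncl V _) b ∈ valuationHull V (AlgebraicClosure F) :=
    eval₂_iterate_divX_mem hP k
  have hz (k : ℕ) (hk : k ≤ j) : (divX^[k] P).eval₂ (valIncl V _) b = 0 := by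
    induction k with
    | zero => exact hP
    | succ k ih =>
      have h₁ := eval₂_iterate_divX (valIncl V (AlgebraicClosure F)) b P k
      rw [ih (by omega), not_not.1 (Nat.find_min hex (show k < j by omega)), map_zero,
        add_zero] at h₁
      exact (mul_eq_zero.1 h₁.symm).resolve_left hb
  have h₁ := eval₂_iterate_divX (valIncl V (AlgebraicClosure F)) b P j
  rw [hz j le_rfl] at h₁
  obtain ⟨m, u, hu⟩ := IsDiscreteValuationRing.eq_unit_mul_pow_irreducible (Nat.find_spec hex) hπ
  refine ⟨m, ?_⟩
  have h₂ : W.valuation (valIncl V _ (P.coeff j)) =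
      W.valuation b * W.valuation ((divX^[j + 1] P).eval₂ (valIncl V _) b) := by
    rw [← map_mul, ← W.valuation.map_neg, neg_eq_of_add_eq_zero_left h₁.symm]
  have h₃ : W.valuation (valIncl V _ (P.coeff j)) = W.valuation (algebraMap F _ π) ^ m := by
    change W.valuation (valIncl V _ (P.coeff (Nat.find hex))) = _
    rw [hu, map_mul, map_mul, map_pow, map_pow]
    have : W.valuation (valIncl V _ (u : V)) = 1 :=
      valuation_coe_isUnit (u := (⟨_, hW _ (u : V).2⟩ : W))
        (IsUnit.of_mul_eq_one ⟨_, hW _ ((u⁻¹ : Vˣ) : V).2⟩ (Subtype.ext (by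
          change valIncl V _ (u : V) * valIncl V _ ((u⁻¹ : Vˣ) : V) = 1
          rw [← map_mul, Units.mul_inv, map_one])))
    rw [this, one_mul]
    rfl
  rw [← h₃, h₂]
  exact mul_le_of_le_one_right zero_le
    ((W.valuation_le_one_iff _).2 (valuationHull_le hW (hs _)))

lemma isSeparable_of_mem_adjoin {a θ : AlgebraicClosure F}
    (hθ : θ ∈ IntermediateField.adjoin F {a}) (hs : IsSeparable F a) : IsSeparable F θ := by
  have h : IntermediateField.adjoin F {a} ≤ separableClosure F (AlgebraicClosure F) :=
    IntermediateField.adjoin_simple_le_iff.2 (mem_separableClosure_iff.2 hs)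
  exact mem_separableClosure_iff.1 (h hθ)

lemma mem_adjoin_of_fixed {a θ : AlgebraicClosure F} (hs : IsSeparable F a)
    (h : ∀ σ : Gam F, σ θ = θ → σ a = a) : a ∈ IntermediateField.adjoin F {θ} := by
  let K := IntermediateField.adjoin F {θ}
  have hs' : IsSeparable K a := IsSeparable.tower_top K hs
  obtain ⟨c, hc⟩ := exists_algebraMap_eq_of_fixed (K := K) hs' fun σ =>
    h (σ.restrictScalars F) (σ.commutes ⟨θ, IntermediateField.mem_adjoin_simple_self F θ⟩)
  rw [← hc]
  exact c.2

lemma exists_polynomial_pow_mul_eq [IsDiscreteValuationRing V] {π : V} (hπ : Irreducible π)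
    {a θ : AlgebraicClosure F} (ha : a ∈ IntermediateField.adjoin F {θ}) :
    ∃ (n : ℕ) (f : V[X]), algebraMap F _ (π : F) ^ n * a = f.eval₂ (valIncl V _) θ := by
  have hθ : IsIntegral F θ := Algebra.IsIntegral.isIntegral θ
  obtain ⟨f, rfl⟩ : ∃ f : F[X], aeval θ f = a := by
    have h₁ : a ∈ (IntermediateField.adjoin F {θ}).toSubalgebra := ha
    rw [IntermediateField.adjoin_simple_toSubalgebra_of_isAlgebraic hθ.isAlgebraic,
      Algebra.adjoin_singleton_eq_range_aeval] at h₁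
    exact h₁
  have hfrac (c : F) : ∃ (n : ℕ) (v : V), (π : F) ^ n * c = v := by
    rcases V.mem_or_inv_mem c with hc | hc
    · exact ⟨0, ⟨c, hc⟩, by simp⟩
    · rcases eq_or_ne c 0 with rfl | hc0
      · exact ⟨0, 0, by simp⟩
      · obtain ⟨n, u, hu⟩ := IsDiscreteValuationRing.eq_unit_mul_pow_irreducible
          (x := (⟨c⁻¹, hc⟩ : V)) (fun h => inv_ne_zero hc0 (congr_arg Subtype.val h)) hπ
        refine ⟨n, ((u⁻¹ : Vˣ) : V), ?_⟩
        have h₁ : c⁻¹ = (u : V) * (π : F) ^ n := congr_arg Subtype.val hu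
        have h₂ : ((u : V) : F) * ((u⁻¹ : Vˣ) : V) = 1 := congr_arg Subtype.val u.mul_inv
        have h₃ : ((u : V) : F) * (π : F) ^ n * c = 1 := by rw [← h₁, inv_mul_cancel₀ hc0]
        calc (π : F) ^ n * c = ((u : V) : F) * ((u⁻¹ : Vˣ) : V) * ((π : F) ^ n * c) := by
              rw [h₂, one_mul]
          _ = ((u⁻¹ : Vˣ) : V) * (((u : V) : F) * (π : F) ^ n * c) := by ring
          _ = _ := by rw [h₃, mul_one]
  clear ha
  induction f using Polynomial.induction_on' with
  | add f g hf hg =>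
    obtain ⟨n, f', hf⟩ := hf
    obtain ⟨m, g', hg⟩ := hg
    refine ⟨n + m, C (π ^ m) * f' + C (π ^ n) * g', ?_⟩
    rw [eval₂_add, eval₂_mul, eval₂_mul, ← hf, ← hg, eval₂_C, eval₂_C, map_pow, map_pow, map_add]
    change _ = algebraMap F _ (π : F) ^ m * _ + algebraMap F _ (π : F) ^ n * _
    ring
  | monomial m c =>
    obtain ⟨n, v, hv⟩ := hfrac c
    refine ⟨n, monomial m v, ?_⟩
    rw [eval₂_monomial, aeval_monomial, ← mul_assoc, ← map_pow, ← map_mul, hv]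
    rfl

/-- An element fixed by the inertia group has the valuation of a power of the uniformizer. -/
theorem exists_zpow_valuation_eq [IsDiscreteValuationRing V] {π : V} (hπ : Irreducible π)
    (hW : W.comap (algebraMap F _) = V) (τ : W →+* L) [IsLocalHom τ]
    {a : AlgebraicClosure F} (ha0 : a ≠ 0) (hs : IsSeparable F a) (ha : ∀ σ ∈ inertia W, σ a = a) :
    ∃ n : ℤ, W.valuation a = W.valuation (algebraMap F _ (π : F)) ^ n := by
  have hVW : ∀ v ∈ V, algebraMap F (AlgebraicClosure F) v ∈ W := fun v hv => hW.ge hv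
  have hVW' : ∀ v, algebraMap F (AlgebraicClosure F) v ∈ W → v ∈ V := fun v hv => hW.le hv
  have hkill (v : V) (hv : ¬ IsUnit v) : τ ⟨algebraMap F _ v, hVW _ v.2⟩ = 0 := by
    by_contra h0
    exact hv (isUnit_of_isUnit_algebraMap hW ((isUnit_map_iff τ _).1 (IsUnit.mk0 _ h0)))
  obtain ⟨θ, hθ, hθa, hsep⟩ := exists_residue_separating hW τ ha hVW
  have hθs : IsSeparable F θ := isSeparable_of_mem_adjoin hθa hs
  have hθW : θ ∈ W := valuationHull_le hVW hθ
  obtain ⟨Q, hQ, hQ'⟩ := exists_polynomial_of_residue_separating hVW hVW' τ hθs hθ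
    fun σ hσ => hsep σ fun h => hσ (apply_eq_of_mem_adjoin hθa h)
  have haθ : a ∈ IntermediateField.adjoin F {θ} := mem_adjoin_of_fixed hs fun σ hσ => by
    by_contra h
    exact hsep σ h (congr_arg τ (Subtype.ext hσ))
  obtain ⟨n, f, hf⟩ := exists_polynomial_pow_mul_eq hπ haθ
  have hπ0 : algebraMap F (AlgebraicClosure F) (π : F) ≠ 0 := by
    rw [_root_.map_ne_zero]
    exact fun h => hπ.ne_zero (Subtype.ext h)
  have hp0 : W.valuation (algebraMap F (AlgebraicClosure F) (π : F)) ≠ 0 :=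
    (W.valuation.ne_zero_iff).2 hπ0
  -- Divide by `π` as long as the valuation is < 1. The lower bound |π|^m allows at most m
  -- divisions.
  have key (m : ℕ) : ∀ f : V[X], W.valuation (algebraMap F _ (π : F)) ^ m ≤
      W.valuation (f.eval₂ (valIncl V _) θ) →
      ∃ n : ℕ, W.valuation (f.eval₂ (valIncl V _) θ) =
        W.valuation (algebraMap F _ (π : F)) ^ n := by
    induction m with
    | zero =>
      intro f hf
      refine ⟨0, le_antisymm ?_ hf⟩
      rw [pow_zero, W.valuation_le_one_iff]
      exact eval₂_mem_of_mem hVW hθW f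
    | succ m ih =>
      intro f hf
      have h1 : W.valuation (f.eval₂ (valIncl V _) θ) ≤ 1 :=
        (W.valuation_le_one_iff _).2 (eval₂_mem_of_mem hVW hθW f)
      rcases h1.lt_or_eq with h1 | h1
      · obtain ⟨f', hf'⟩ := exists_valuation_eq_mul hπ.maximalIdeal_eq hVW τ hkill hθW hQ hQ' f h1
        rw [hf', pow_succ'] at hf
        obtain ⟨n, hn⟩ := ih f' ((mul_le_mul_iff_right₀ (zero_lt_iff.2 hp0)).1 hf)
        exact ⟨n + 1, by rw [hf', hn, pow_succ']⟩
      · exact ⟨0, by rw [h1, pow_zero]⟩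
  obtain ⟨m, hm⟩ := exists_pow_le_valuation hπ hVW
    (hf ▸ mul_ne_zero (pow_ne_zero n hπ0) ha0 : f.eval₂ (valIncl V _) θ ≠ 0)
  obtain ⟨N, hN⟩ := key m f hm
  refine ⟨(N : ℤ) - n, ?_⟩
  rw [← hf, map_mul, map_pow] at hN
  rw [zpow_sub₀ hp0, zpow_natCast, zpow_natCast, eq_div_iff (pow_ne_zero n hp0), mul_comm, hN]

theorem nonempty_unramifiedOrder_of_irreducible [IsDiscreteValuationRing V] {π : V}
    (hπ : Irreducible π) (hW : W.comap (algebraMap F _) = V) (τ : W →+* L) [IsLocalHom τ] :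
    Nonempty (UnramifiedOrder W (π : F)) := by
  have hVW : ∀ v ∈ V, algebraMap F (AlgebraicClosure F) v ∈ W := fun v hv => hW.ge hv
  refine nonempty_unramifiedOrder (fun h => hπ.ne_zero (Subtype.ext h)) ?_ fun a ha => ?_
  · have h := (W.valuation_lt_one_iff ⟨algebraMap F _ (π : F), hVW _ π.2⟩).1 ?_
    · exact h
    · rw [IsLocalRing.mem_maximalIdeal, mem_nonunits_iff]
      exact fun hu => hπ.not_isUnit (isUnit_of_isUnit_algebraMap hW hu)
  · refine exists_zpow_valuation_eq hπ hW τ (coeUnit_ne_zero a)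
      (mem_separableClosure_iff.1 (a : separableClosure F (AlgebraicClosure F)).2) fun σ hσ => ?_
    rw [← coe_galUnits, ha σ hσ]

end Unramified

/-! ### The Krull–Akizuki theorem. -/

section KrullAkizuki

open scoped Pointwise

variable {O : Type*} [CommRing O]

lemma length_lt_length_of_lt {P : Type*} [AddCommGroup P] [Module O P] {N N' : Submodule O P}
    (h : N < N') (hN : Module.length O N' ≠ ⊤) : Module.length O N < Module.length O N' := by
  obtain ⟨_, _⟩ := isFiniteLength_iff_isNoetherian_isArtinian.1 (Module.length_ne_top_iff.1 hN)
  have h₁ : N.comap N'.subtype ≠ ⊤ := fun h₂ => h.not_ge fun x hx => by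
    have : (⟨x, hx⟩ : N') ∈ N.comap N'.subtype := h₂ ▸ Submodule.mem_top
    exact this
  rw [← (Submodule.comapSubtypeEquivOfLe h.le).length_eq]
  exact Submodule.length_lt h₁

/-- Bounded lengths yield a finitely generated submodule of maximal length. Adjoining an element
outside it would increase a finite length, so it is the whole module. -/
lemma isNoetherian_of_length_fg_le {P : Type*} [AddCommGroup P] [Module O P] (n : ℕ)
    (h : ∀ N : Submodule O P, N.FG → Module.length O N ≤ n) : _root_.IsNoetherian O P := by
  obtain ⟨N, hN, hmax⟩ : ∃ N : Submodule O P, N.FG ∧ ∀ N' : Submodule O P, N'.FG →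
      Module.length O N' ≤ Module.length O N := by
    by_contra! hc
    have key (k : ℕ) : ∃ N : Submodule O P, N.FG ∧ (k : ℕ∞) ≤ Module.length O N := by
      induction k with
      | zero => exact ⟨⊥, Submodule.fg_bot, by simp⟩
      | succ k ih =>
        obtain ⟨N, hN, hk⟩ := ih
        obtain ⟨N', hN', hlt⟩ := hc N hN
        exact ⟨N', hN', by
          rw [Nat.cast_add, Nat.cast_one]
          exact Order.add_one_le_of_lt (hk.trans_lt hlt)⟩
    obtain ⟨N, hN, hn⟩ := key (n + 1)
    exact absurd (Nat.cast_le.1 (hn.trans (h N hN))) (by omega)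
  have hne : Module.length O N ≠ ⊤ := ((h N hN).trans_lt (ENat.natCast_lt_top n)).ne
  have htop : N = ⊤ := by
    by_contra hc
    obtain ⟨x, -, hx⟩ := SetLike.exists_of_lt (lt_top_iff_ne_top.2 hc)
    have hfg : (N ⊔ Submodule.span O {x}).FG := hN.sup (Submodule.fg_span_singleton x)
    refine (length_lt_length_of_lt (left_lt_sup.2 fun hle => hx ?_) ?_).not_ge (hmax _ hfg)
    · exact hle (Submodule.mem_span_singleton_self x)
    · exact ((h _ hfg).trans_lt (ENat.natCast_lt_top n)).ne
  subst htop
  rw [Module.length_top] at hne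
  exact (isFiniteLength_iff_isNoetherian_isArtinian.1 (Module.length_ne_top_iff.1 hne)).1

variable [IsDomain O]

section

variable {F : Type*} [Field F] [Algebra O F] [IsFractionRing O F]

lemma exists_linearEquiv_ideal {M : Submodule O F} (hM : M.FG) (hM0 : M ≠ ⊥) :
    ∃ I : Ideal O, I ≠ ⊥ ∧ Nonempty (M ≃ₗ[O] I) := by
  obtain ⟨s, rfl⟩ := hM
  obtain ⟨d, hd⟩ := IsLocalization.exist_integer_multiples_of_finset (nonZeroDivisors O) s
  let m : F →ₗ[O] F := LinearMap.lsmul O F d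
  have hm : Function.Injective m := by
    intro x y hxy
    have hd0 : algebraMap O F d ≠ 0 := IsLocalization.to_map_ne_zero_of_mem_nonZeroDivisors F le_rfl d.2
    simp only [m, LinearMap.lsmul_apply, Algebra.smul_def] at hxy
    exact mul_left_cancel₀ hd0 hxy
  let N := (Submodule.span O (s : Set F)).map m
  have hN : N ≤ LinearMap.range (Algebra.linearMap O F) := by
    rw [Submodule.map_le_iff_le_comap, Submodule.span_le]
    intro x hx
    obtain ⟨y, hy⟩ := hd x hx
    exact ⟨y, hy⟩
  let e₁ := Submodule.equivMapOfInjective m hm (Submodule.span O (s : Set F))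
  let I := N.comap (Algebra.linearMap O F)
  let φ : I →ₗ[O] N := (Algebra.linearMap O F).restrict fun _ h => h
  have hφ : Function.Bijective φ := by
    refine ⟨fun x y hxy => Subtype.ext (IsFractionRing.injective O F (congr_arg Subtype.val hxy)),
      fun y => ?_⟩
    obtain ⟨x, hx⟩ := hN y.2
    exact ⟨⟨x, show _ ∈ N from hx ▸ y.2⟩, Subtype.ext hx⟩
  let e := e₁.trans (LinearEquiv.ofBijective φ hφ).symm
  refine ⟨I, fun hI => hM0 ?_, ⟨e⟩⟩
  have : Subsingleton I := by rw [hI]; infer_instance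
  have := e.toEquiv.subsingleton
  exact Submodule.subsingleton_iff_eq_bot.1 this

end

variable [IsNoetherianRing O] [Ring.DimensionLEOne O]

lemma length_quotient_ideal_ne_top {I : Ideal O} (hI : I ≠ ⊥) : Module.length O (O ⧸ I) ≠ ⊤ := by
  obtain ⟨a, haI, ha⟩ := Submodule.exists_mem_ne_zero_of_ne_bot hI
  have h := Ring.ord_ne_top (mem_nonZeroDivisors_of_ne_zero ha)
  refine ((Module.length_le_of_surjective (Submodule.factor (p := Ideal.span {a}) (p' := I)
    ((Ideal.span_singleton_le_iff_mem _).2 haI)) (Submodule.factor_surjective _)).trans_lt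
    (lt_top_iff_ne_top.2 h)).ne

/-- The length of O/fI is ℓ(O/I) + ℓ(O/f) and also ℓ(I/fI) + ℓ(O/I). The finite term ℓ(O/I) cancels.
-/
lemma length_ideal_quotient_smul_le {I : Ideal O} (hI : I ≠ ⊥) {f : O} (hf : f ≠ 0) :
    Module.length O (I ⧸ (f • ⊤ : Submodule O I)) ≤ Ring.ord O f := by
  have h₁ := Module.length_eq_add_of_exact (Ideal.mulQuot f I) (Ideal.quotOfMul f I)
    (Ideal.mulQuot_injective I (mem_nonZeroDivisors_of_ne_zero hf)) (Ideal.quotOfMul_surjective I)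
    (Ideal.exact_mulQuot_quotOfMul I)
  have hle : (f • I : Ideal O) ≤ I := Submodule.smul_le_self_of_tower f I
  let φ : (I ⧸ (f • ⊤ : Submodule O I)) →ₗ[O] O ⧸ (f • I : Ideal O) :=
    Submodule.mapQ _ _ I.subtype (by
      rintro _ ⟨x, -, rfl⟩
      exact ⟨x, x.2, rfl⟩)
  have hφ : Function.Injective φ := by
    rw [← LinearMap.ker_eq_bot, LinearMap.ker_eq_bot']
    intro x hx
    obtain ⟨x, rfl⟩ := Submodule.mkQ_surjective _ x
    obtain ⟨z, hz, hzx⟩ := (Submodule.Quotient.mk_eq_zero _).1 hx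
    refine (Submodule.Quotient.mk_eq_zero _).2 ⟨⟨z, hz⟩, trivial, Subtype.ext hzx⟩
  let ψ : (O ⧸ (f • I : Ideal O)) →ₗ[O] O ⧸ I := Submodule.factor hle
  have hex : Function.Exact φ ψ := by
    intro x
    obtain ⟨x, rfl⟩ := Submodule.mkQ_surjective _ x
    constructor
    · intro hx
      have hx : x ∈ I := (Submodule.Quotient.mk_eq_zero _).1 hx
      exact ⟨Submodule.mkQ _ ⟨x, hx⟩, rfl⟩
    · rintro ⟨y, hy⟩
      obtain ⟨y, rfl⟩ := Submodule.mkQ_surjective _ y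
      rw [← hy]
      exact (Submodule.Quotient.mk_eq_zero _).2 y.2
  have h₂ := Module.length_eq_add_of_exact φ ψ hφ (Submodule.factor_surjective _) hex
  rw [h₁, add_comm] at h₂
  exact ((ENat.add_left_injective_of_ne_top (length_quotient_ideal_ne_top hI)) h₂).ge

variable {F : Type*} [Field F] [Algebra O F] [IsFractionRing O F]

/-- The Krull–Akizuki bound. -/
lemma length_quotient_smul_le (A : Submodule O F) {f : O} (hf : f ≠ 0)
    (N : Submodule O (A ⧸ (f • ⊤ : Submodule O A))) (hN : N.FG) :
    Module.length O N ≤ Ring.ord O f := by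
  classical
  -- A finitely generated lift of `N` is isomorphic to an ideal by clearing denominators, so `N` is
  -- a quotient of I/fI.
  obtain ⟨M, hM, rfl⟩ : ∃ M : Submodule O A, M.FG ∧ M.map (Submodule.mkQ _) = N := by
    obtain ⟨s, rfl⟩ := hN
    obtain ⟨t, -, rfl⟩ := (Finset.subset_set_image_iff (s := Set.univ)
      (f := Submodule.mkQ (f • ⊤ : Submodule O A)) (t := s)).1 fun x _ => by
        obtain ⟨y, rfl⟩ := Submodule.mkQ_surjective _ x
        exact ⟨y, trivial, rfl⟩
    exact ⟨Submodule.span O t, ⟨t, rfl⟩, by rw [Submodule.map_span, Finset.coe_image]⟩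
  rcases eq_or_ne M ⊥ with rfl | hM0
  · rw [Submodule.map_bot, Module.length_bot]
    exact zero_le
  obtain ⟨I, hI, ⟨e'⟩⟩ := exists_linearEquiv_ideal (O := O) (F := F) (M := M.map A.subtype)
    (hM.map _) (by
      intro h
      exact hM0 (Submodule.map_injective_of_injective A.subtype_injective
        (h.trans (Submodule.map_bot _).symm)))
  let e : I ≃ₗ[O] M :=
    e'.symm.trans (Submodule.equivMapOfInjective _ A.subtype_injective M).symm
  let p : M →ₗ[O] M.map (Submodule.mkQ (f • ⊤ : Submodule O A)) :=
    (Submodule.mkQ _).restrict fun x hx => ⟨x, hx, rfl⟩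
  have hp : Function.Surjective p := by
    rintro ⟨_, x, hx, rfl⟩
    exact ⟨⟨x, hx⟩, rfl⟩
  let q : (I ⧸ (f • ⊤ : Submodule O I)) →ₗ[O] M.map (Submodule.mkQ (f • ⊤ : Submodule O A)) :=
    Submodule.liftQ _ (p.comp e.toLinearMap) (by
      rintro _ ⟨x, -, rfl⟩
      refine Subtype.ext ((Submodule.Quotient.mk_eq_zero _).2 ⟨(e x : A), trivial, ?_⟩)
      exact congr_arg Subtype.val (e.map_smul f x).symm)
  have hq : Function.Surjective q := by
    intro y
    obtain ⟨x, rfl⟩ := hp y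
    exact ⟨Submodule.mkQ _ (e.symm x), congr_arg p (e.apply_symm_apply x)⟩
  exact (Module.length_le_of_surjective q hq).trans (length_ideal_quotient_smul_le hI hf)

lemma isNoetherian_quotient_smul (A : Submodule O F) {f : O} (hf : f ≠ 0) :
    _root_.IsNoetherian O (A ⧸ (f • ⊤ : Submodule O A)) := by
  obtain ⟨n, hn⟩ := ENat.ne_top_iff_exists.1 (Ring.ord_ne_top (mem_nonZeroDivisors_of_ne_zero hf))
  exact isNoetherian_of_length_fg_le n fun N hN => hn ▸ length_quotient_smul_le A hf N hN

/-- The Krull–Akizuki theorem. -/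
theorem isNoetherianRing_of_subalgebra (A : Subalgebra O F) : IsNoetherianRing A := by
  refine ⟨fun J => ?_⟩
  rcases eq_or_ne J ⊥ with rfl | hJ
  · exact Submodule.fg_bot
  obtain ⟨a, haJ, ha⟩ := Submodule.exists_mem_ne_zero_of_ne_bot hJ
  -- Clearing the denominator of a nonzero element of `J` gives a nonzero `b` of `O` in `J`. Then
  -- A/bA is Noetherian, and `J` is generated by `b` and finitely many further elements.
  obtain ⟨b, c, hc, hbc⟩ := IsFractionRing.div_surjective (A := O) (a : F)
  have hc0 : algebraMap O F c ≠ 0 :=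
    IsLocalization.to_map_ne_zero_of_mem_nonZeroDivisors F le_rfl hc
  have hb : algebraMap O A b = algebraMap O A c * a := Subtype.ext (by
    change algebraMap O F b = algebraMap O F c * a
    rw [← hbc, mul_div_cancel₀ _ hc0])
  have hbJ : algebraMap O A b ∈ J := hb ▸ Ideal.mul_mem_left J _ haJ
  have hb0 : b ≠ 0 := by
    rintro rfl
    rw [map_zero, eq_comm, mul_eq_zero] at hb
    refine hb.elim (fun h => hc0 (congr_arg Subtype.val h)) ha
  have hnoeth := isNoetherian_quotient_smul (F := F) (Subalgebra.toSubmodule A) hb0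
  let K : Ideal A := Ideal.span {algebraMap O A b}
  let q : (Subalgebra.toSubmodule A ⧸ (b • ⊤ : Submodule O (Subalgebra.toSubmodule A))) →ₗ[O]
      A ⧸ K :=
    Submodule.liftQ _ ((Ideal.Quotient.mkₐ O K).toLinearMap : A →ₗ[O] A ⧸ K) (by
      rintro _ ⟨x, -, rfl⟩
      refine Ideal.Quotient.eq_zero_iff_mem.2 ?_
      change b • (show A from x) ∈ K
      rw [Algebra.smul_def]
      exact K.mul_mem_right _ (Ideal.mem_span_singleton_self _))
  have hq : Function.Surjective q := by
    intro x
    obtain ⟨x, rfl⟩ := Ideal.Quotient.mk_surjective x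
    exact ⟨Submodule.mkQ _ x, rfl⟩
  have h₁ : _root_.IsNoetherian O (A ⧸ K) := isNoetherian_of_surjective q (LinearMap.range_eq_top.2 hq)
  have h₂ : _root_.IsNoetherian A (A ⧸ K) := isNoetherian_of_tower O h₁
  refine Submodule.fg_of_fg_map_of_fg_inf_ker (Submodule.mkQ K) (h₂.noetherian _) ?_
  rw [Submodule.ker_mkQ, inf_eq_right.2 ((Ideal.span_singleton_le_iff_mem _).2 hbJ)]
  exact ⟨{algebraMap O A b}, by rw [Finset.coe_singleton]⟩

end KrullAkizuki

/-! ### Valuation rings dominating a one-dimensional Noetherian domain. -/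

section Dominating

open scoped Pointwise

open Polynomial

variable {O F : Type*} [CommRing O] [Field F] [Algebra O F]

lemma mem_of_isIntegral {V : ValuationSubring F} (hO : ∀ o, algebraMap O F o ∈ V) {b : F}
    (hb : IsIntegral O b) : b ∈ V := by
  obtain ⟨P, hP, h⟩ := hb
  let g : O →+* V := (algebraMap O F).codRestrict V.toSubring hO
  obtain ⟨y, hy⟩ := IsIntegrallyClosed.isIntegral_iff (R := V) (K := F).1
    ⟨P.map g, hP.map g, by rw [Polynomial.eval₂_map]; exact h⟩
  exact hy ▸ y.2

variable [IsDomain O] [IsNoetherianRing O] [Ring.DimensionLEOne O] [IsFractionRing O F]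

/-- `V` is Noetherian by Krull–Akizuki, and a Noetherian Bézout ring is principal. -/
lemma isDiscreteValuationRing_of_algebraMap_mem (V : ValuationSubring F)
    (hO : ∀ o, algebraMap O F o ∈ V) (hV : V ≠ ⊤) : IsDiscreteValuationRing V := by
  let A : Subalgebra O F := { V.toSubring with algebraMap_mem' := hO }
  have hA : IsNoetherianRing V := isNoetherianRing_of_subalgebra A
  have hP : IsPrincipalIdealRing V := ((IsBezout.TFAE (R := V)).out 0 1).1 hA
  refine { not_a_field' := fun h => hV ?_ }
  refine (eq_top_iff).2 fun a _ => ?_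
  by_contra ha
  have ha' := (V.mem_or_inv_mem a).resolve_left ha
  have h₁ : (⟨a⁻¹, ha'⟩ : V) ∈ IsLocalRing.maximalIdeal V := by
    rw [IsLocalRing.mem_maximalIdeal, mem_nonunits_iff]
    intro hu
    obtain ⟨b, hb⟩ := hu.exists_right_inv
    have hb : a⁻¹ * (b : F) = 1 := congr_arg Subtype.val hb
    have ha0 : a ≠ 0 := fun h => by simp [h] at hb
    rw [inv_mul_eq_one₀ ha0] at hb
    exact ha (hb ▸ b.2)
  rw [h] at h₁
  have h₂ : a⁻¹ = 0 := congr_arg Subtype.val ((Submodule.mem_bot _).1 h₁)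
  exact ha (by rw [inv_eq_zero.1 h₂]; exact V.zero_mem)

lemma isDedekindDomain_integralClosure : IsDedekindDomain (integralClosure O F) := by
  have : IsNoetherianRing (integralClosure O F) := isNoetherianRing_of_subalgebra _
  have : IsIntegrallyClosed (integralClosure O F) :=
    integralClosure.isIntegrallyClosedOfFiniteExtension (R := O) (L := F) F
  exact { }

/-- The integral closure is a Dedekind domain, so its localization at p is a valuation ring and
contains `a` or its inverse. The alternatives are phrased without division. -/
lemma exists_integralClosure_mul_eq (p : Ideal (integralClosure O F)) [hp : p.IsPrime]
    (hp0 : p ≠ ⊥) (a : F) :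
    ∃ b s : integralClosure O F, s ∉ p ∧ (a * s = b ∨ a * b = s) := by
  have := isDedekindDomain_integralClosure (O := O) (F := F)
  have : IsFractionRing (integralClosure O F) F :=
    integralClosure.isFractionRing_of_finite_extension F F
  let A := Localization.subalgebra.ofField F p.primeCompl p.primeCompl_le_nonZeroDivisors
  have hloc : IsLocalization.AtPrime A p :=
    Localization.subalgebra.isLocalization_ofField F _ _
  have hdvr : IsDiscreteValuationRing A :=
    IsLocalization.AtPrime.isDiscreteValuationRing_of_dedekind_domain _ hp0 A
  have key (c : F) (hc : IsLocalization.IsInteger A c) :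
      ∃ b s : integralClosure O F, s ∉ p ∧ c * s = b := by
    obtain ⟨⟨_, b, s, hs, rfl⟩, rfl⟩ := hc
    refine ⟨b, s, hs, ?_⟩
    have hs0 : (s : F) ≠ 0 := fun h => hs (by
      rw [show s = 0 from Subtype.ext h]; exact p.zero_mem)
    exact inv_mul_cancel_right₀ hs0 _
  rcases ValuationRing.isInteger_or_isInteger A a with h | h
  · obtain ⟨b, s, hs, h⟩ := key a h
    exact ⟨b, s, hs, Or.inl h⟩
  · obtain ⟨b, s, hs, h⟩ := key _ h
    rcases eq_or_ne a 0 with rfl | ha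
    · exact ⟨0, 1, fun h => hp.ne_top ((Ideal.eq_top_iff_one _).2 h), Or.inl (by simp)⟩
    · exact ⟨b, s, hs, Or.inr (by rw [← h, mul_inv_cancel_left₀ ha])⟩

variable {L : Type*} [Field L]

/-- Such a homomorphism kills fB, where B is the integral closure, and B/fB is finitely generated
over `O` by the Krull–Akizuki bound. It is determined by its values on finitely many generators,
each a root of a fixed monic polynomial. -/
lemma finite_ringHom_integralClosure (ε : O →+* L) {f : O} (hf0 : f ≠ 0) (hf : ε f = 0) :
    {φ : integralClosure O F →+* L | ∀ o, φ (algebraMap O _ o) = ε o}.Finite := by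
  classical
  let B := integralClosure O F
  have hN := isNoetherian_quotient_smul (F := F) (Subalgebra.toSubmodule B) hf0
  obtain ⟨s, hs⟩ := hN.noetherian ⊤
  let q : B →ₗ[O] _ := Submodule.mkQ (f • ⊤ : Submodule O (Subalgebra.toSubmodule B))
  choose g hg using fun x => Submodule.mkQ_surjective
    (f • ⊤ : Submodule O (Subalgebra.toSubmodule B)) x
  have hint (b : B) : IsIntegral O (b : F) := b.2
  let S (x : s) : Set L := {l | l ∈ (((hint (g x)).choose.map ε).roots)}
  have hfin : {h : s → L | ∀ x, h x ∈ S x}.Finite := Set.Finite.pi' fun x => Multiset.finite_toSet _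
  refine Set.Finite.of_finite_image (f := fun φ (x : s) => φ (g x)) (hfin.subset ?_) ?_
  · rintro _ ⟨φ, hφ, rfl⟩ x
    have h := (hint (g x)).choose_spec
    have hm : ((hint (g x)).choose.map ε).Monic := h.1.map ε
    refine (Polynomial.mem_roots hm.ne_zero).2 ?_
    rw [Polynomial.IsRoot, Polynomial.eval_map,
      show ε = φ.comp (algebraMap O B) from RingHom.ext fun o => (hφ o).symm,
      ← Polynomial.hom_eval₂]
    have : (hint (g x)).choose.eval₂ (algebraMap O B) (g x : B) = 0 := Subtype.ext (by
      change (B.subtype : B →+* F) _ = 0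
      rw [Polynomial.hom_eval₂]
      exact h.2)
    rw [this, map_zero]
  · intro φ hφ φ' hφ' h
    have hlin (φ : B →+* L) (hφ : ∀ o, φ (algebraMap O _ o) = ε o) (o : O) (b : B) :
        φ (o • b) = ε o * φ b := by
      rw [Algebra.smul_def, map_mul, hφ]
    let E : Submodule O B :=
      { carrier := {b | φ b = φ' b}
        add_mem' := fun {a b} ha hb => by
          change φ (a + b) = φ' (a + b)
          rw [map_add, map_add, ha, hb]
        zero_mem' := by change φ 0 = φ' 0; rw [map_zero, map_zero]
        smul_mem' := fun o b hb => by
          change φ (o • b) = φ' (o • b)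
          rw [hlin φ hφ, hlin φ' hφ', hb] }
    have hker : (f • ⊤ : Submodule O B) ≤ E := by
      rintro _ ⟨b, -, rfl⟩
      change φ (f • b) = φ' (f • b)
      rw [hlin φ hφ, hlin φ' hφ', hf, zero_mul, zero_mul]
    have htop : E = ⊤ := by
      have h₁ : E.map q = ⊤ := by
        rw [eq_top_iff, ← hs, Submodule.span_le]
        intro x hx
        exact ⟨g x, congr_fun h ⟨x, hx⟩, hg x⟩
      have h₂ : (E.map q).comap q = E := by
        rw [Submodule.comap_map_eq]
        exact sup_eq_left.2 ((Submodule.ker_mkQ _).le.trans hker)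
      rw [← h₂, h₁, Submodule.comap_top]
    ext b
    exact htop.ge (show b ∈ ⊤ from trivial)

/-- Finitely many valuation rings dominate `O`, with finitely many embeddings of the residue
field. -/
theorem finite_dominating (ε : O →+* L) {f : O} (hf0 : f ≠ 0) (hf : ε f = 0) :
    {p : Σ V : ValuationSubring F, V →+* L | ∃ h : ∀ o, algebraMap O F o ∈ p.1,
      (∀ o, p.2 ⟨_, h o⟩ = ε o) ∧ IsLocalHom p.2}.Finite := by
  classical
  let B := integralClosure O F
  let P := {p : Σ V : ValuationSubring F, V →+* L | ∃ h : ∀ o, algebraMap O F o ∈ p.1,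
      (∀ o, p.2 ⟨_, h o⟩ = ε o) ∧ IsLocalHom p.2}
  have hB {p} (hp : p ∈ P) (b : B) : (b : F) ∈ p.1 := mem_of_isIntegral hp.1 b.2
  let r (p : P) : B →+* L := p.1.2.comp ((B.subtype : B →+* F).codRestrict p.1.1.toSubring (hB p.2))
  have hr (p : P) (b : B) : r p b = p.1.2 ⟨b, hB p.2 b⟩ := rfl
  -- The valuation ring is the localization of the integral closure at the kernel of the restricted
  -- homomorphism. The restriction therefore determines both the ring and its homomorphism to `L`.
  have key (p : P) (a : F) : a ∈ p.1.1 ↔ ∃ b s : B, r p s ≠ 0 ∧ a * s = b := by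
    have hl : IsLocalHom p.1.2 := p.2.2.2
    have hunit {b : B} : r p b ≠ 0 ↔ IsUnit (⟨b, hB p.2 b⟩ : p.1.1) := by
      rw [hr, ← isUnit_map_iff p.1.2, isUnit_iff_ne_zero]
    constructor
    · intro ha
      have : (RingHom.ker (r p)).IsPrime := RingHom.ker_isPrime _
      obtain ⟨b, s, hs, h⟩ := exists_integralClosure_mul_eq (RingHom.ker (r p)) (fun h0 => hf0 (by
        have h₁ : algebraMap O B f ∈ RingHom.ker (r p) := by
          rw [RingHom.mem_ker]
          exact (p.2.2.1 f).trans hf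
        rw [h0, Ideal.mem_bot] at h₁
        exact IsFractionRing.injective O F
          ((congr_arg Subtype.val h₁).trans (map_zero _).symm))) a
      rcases h with h | h
      · exact ⟨b, s, hs, h⟩
      · have h₁ : (⟨a, ha⟩ : p.1.1) * ⟨b, hB p.2 b⟩ = ⟨s, hB p.2 s⟩ := Subtype.ext h
        have h₂ : IsUnit ((⟨a, ha⟩ : p.1.1) * ⟨b, hB p.2 b⟩) := h₁ ▸ hunit.1 hs
        refine ⟨s, b, hunit.2 (isUnit_of_mul_isUnit_right h₂), h⟩
    · rintro ⟨b, s, hs, h⟩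
      obtain ⟨t, ht⟩ := (hunit.1 hs).exists_right_inv
      have ht : (s : F) * t = 1 := congr_arg Subtype.val ht
      have : a = b * t := by rw [← h, mul_assoc, ht, mul_one]
      rw [this]
      exact mul_mem (hB p.2 b) t.2
  have hinj : Function.Injective r := by
    rintro ⟨⟨V, τ⟩, hp⟩ ⟨⟨V', τ'⟩, hp'⟩ h
    have hV : V = V' := by
      ext a
      rw [key ⟨⟨V, τ⟩, hp⟩ a, key ⟨⟨V', τ'⟩, hp'⟩ a, h]
    subst hV
    have hτ : τ = τ' := by
      ext ⟨a, ha⟩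
      obtain ⟨b, s, hs, hbs⟩ := (key ⟨⟨V, τ⟩, hp⟩ a).1 ha
      have h₁ : (⟨a, ha⟩ : V) * ⟨s, hB hp s⟩ = ⟨b, hB hp b⟩ := Subtype.ext hbs
      have h₂ := congr_arg τ h₁
      have h₃ := congr_arg τ' h₁
      rw [map_mul] at h₂ h₃
      have e₁ (c : B) : τ' ⟨c, hB hp c⟩ = τ ⟨c, hB hp c⟩ := (DFunLike.congr_fun h c).symm
      rw [e₁, e₁, ← h₂] at h₃
      exact (mul_right_cancel₀ hs h₃).symm
    subst hτ
    rfl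
  have hfin := (finite_ringHom_integralClosure (F := F) ε hf0 hf).to_subtype
  exact Finite.of_injective (fun p : P => (⟨r p, p.2.2.1⟩ :
    {φ : B →+* L | ∀ o, φ (algebraMap O _ o) = ε o})) fun p p' h => hinj (congr_arg Subtype.val h)

end Dominating

/-! ### Points of consecutive dimensions. -/

section DimensionOfPoints

open TopologicalSpace

lemma topologicalKrullDim_add_one_le {T : Type*} [TopologicalSpace T] {Y Z : Set T}
    (hY : IsClosed Y) (hYirr : IsIrreducible Y) (hZ : IsIrreducible Z)
    (h : Y ⊂ Z) : topologicalKrullDim Y + 1 ≤ topologicalKrullDim Z := by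
  let ι : Y → Z := Set.inclusion h.subset
  have hι : Topology.IsInducing ι :=
    Topology.IsInducing.of_comp (continuous_inclusion _) continuous_subtype_val .subtypeVal
  have hZ' : IrreducibleSpace Z := Subtype.irreducibleSpace hZ
  have hY' : IrreducibleSpace Y := Subtype.irreducibleSpace hYirr
  let t : IrreducibleCloseds Z := ⟨Set.univ, IrreducibleSpace.isIrreducible_univ Z, isClosed_univ⟩
  have : Nonempty (IrreducibleCloseds Y) :=
    ⟨⟨Set.univ, IrreducibleSpace.isIrreducible_univ Y, isClosed_univ⟩⟩
  -- Every chain in `Y` is extended by `Z` itself, so the added top element accounts for the extra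
  -- 1.
  let φ : WithTop (IrreducibleCloseds Y) → IrreducibleCloseds Z := fun s =>
    s.recTopCoe t (IrreducibleCloseds.map ι hι.continuous)
  have hφ : StrictMono φ := by
    rw [WithTop.strictMono_iff]
    refine ⟨IrreducibleCloseds.map_strictMono_of_isInducing hι, fun s => ?_⟩
    obtain ⟨z, hz, hzY⟩ := Set.exists_of_ssubset h
    refine SetLike.lt_iff_le_and_exists.2 ⟨fun _ _ => trivial, ⟨z, hz⟩, trivial, fun hmem => hzY ?_⟩
    have h₁ : closure (ι '' s) ⊆ Subtype.val ⁻¹' Y :=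
      closure_minimal (by rintro _ ⟨y, -, rfl⟩; exact y.2) (hY.preimage continuous_subtype_val)
    exact h₁ hmem
  have := Order.krullDim_le_of_strictMono φ hφ
  rwa [Order.krullDim_WithTop] at this

variable {X : Scheme.{u}} {i : ℤ} {x y : X}

lemma dim_add_one_le {y z : X} (h : z ⤳ y) (hne : z ≠ y) :
    topologicalKrullDim (closure {y} : Set X) + 1 ≤ topologicalKrullDim (closure {z} : Set X) := by
  refine topologicalKrullDim_add_one_le isClosed_closure
    isIrreducible_singleton.closure isIrreducible_singleton.closure
    ((specializes_iff_closure_subset.1 h).ssubset_of_ne fun heq => hne ?_)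
  exact (Specializes.antisymm h (specializes_iff_closure_subset.2 heq.ge)).eq

lemma ne_of_mem_pointsOfDim (hx : x ∈ pointsOfDim X (i + 1)) (hy : y ∈ pointsOfDim X i) :
    x ≠ y := by
  rintro rfl
  obtain ⟨n, hn, hxn⟩ := hx
  obtain ⟨m, hm, hym⟩ := hy
  rw [hxn] at hym
  have : n = m := by exact_mod_cast hym
  omega

/-- There is no point strictly between points of consecutive dimensions. -/
lemma eq_or_eq_of_specializes (hx : x ∈ pointsOfDim X (i + 1)) (hy : y ∈ pointsOfDim X i) {z : X}
    (hxz : x ⤳ z) (hzy : z ⤳ y) : z = x ∨ z = y := by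
  by_contra! hc
  obtain ⟨n, hn, hxn⟩ := hx
  obtain ⟨m, hm, hym⟩ := hy
  have h₁ := dim_add_one_le hzy hc.2
  have h₂ := dim_add_one_le hxz hc.1.symm
  rw [hym] at h₁
  rw [hxn] at h₂
  have h₃ : (m : WithBot ℕ∞) + 1 + 1 ≤ n := (add_le_add_left h₁ 1).trans h₂
  have h₄ : m + 1 + 1 ≤ n := by exact_mod_cast h₃
  omega

/-- An open neighbourhood of `x` contains all but finitely many of the points of codimension one
in the closure of `x`. -/
lemma finite_pointsOfDim_notMem [NoetherianSpace X] (hx : x ∈ pointsOfDim X (i + 1)) {U : Set X}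
    (hU : IsOpen U) (hxU : x ∈ U) : {y ∈ pointsOfDim X i | x ⤳ y ∧ y ∉ U}.Finite := by
  -- The part of the closure of `x` outside `U` is a finite union of irreducible closed sets. The
  -- generic point of one containing `y` lies between `x` and `y`; it is not `x`, hence it is `y`.
  obtain ⟨S, hS, hcl, hirr, hZ⟩ := NoetherianSpace.exists_finite_set_isClosed_irreducible
    (isClosed_closure.inter hU.isClosed_compl : IsClosed (closure {x} ∩ Uᶜ : Set X))
  refine Set.Finite.of_finite_image (f := fun y => closure {y}) (hS.subset ?_) ?_
  · rintro _ ⟨y, ⟨hy, hxy, hyU⟩, rfl⟩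
    have hyZ : y ∈ closure {x} ∩ Uᶜ := ⟨specializes_iff_mem_closure.1 hxy, hyU⟩
    rw [hZ] at hyZ
    obtain ⟨C, hC, hyC⟩ := hyZ
    obtain ⟨z, hz⟩ := QuasiSober.sober (hirr C hC) (hcl C hC)
    have hzZ : z ∈ closure {x} ∩ Uᶜ := hZ ▸ ⟨C, hC, hz.mem⟩
    have hzy : z ⤳ y := specializes_iff_mem_closure.2 (hz.def.symm ▸ hyC)
    rcases eq_or_eq_of_specializes hx hy (specializes_iff_mem_closure.2 hzZ.1) hzy with rfl | rfl
    · exact absurd hxU hzZ.2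
    · change closure {z} ∈ S
      rwa [hz.def]
  · intro y _ z _ h
    exact (Specializes.antisymm
      (specializes_iff_closure_subset.2 (h : closure {y} = closure {z}).ge)
      (specializes_iff_closure_subset.2 (h : closure {y} = closure {z}).le)).eq

end DimensionOfPoints

/-! ### The local ring of the closure of x at y, as a subring of k(x). -/

section LocalRing

variable {X : Scheme.{u}} {x y : X}

/-- The homomorphism from the local ring at `y` to the residue field of a generization. -/
def stalkToResidueField (h : x ⤳ y) : X.presheaf.stalk y →+* X.residueField x :=
  (X.residue x).hom.comp (X.presheaf.stalkSpecializes h).hom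

lemma SpecMap_stalkToResidueField (h : x ⤳ y) :
    Spec.map (CommRingCat.ofHom (stalkToResidueField h)) ≫ X.fromSpecStalk y =
      X.fromSpecResidueField x := by
  have : CommRingCat.ofHom (stalkToResidueField h) =
    X.presheaf.stalkSpecializes h ≫ X.residue x := rfl
  rw [this, Spec.map_comp, Category.assoc, Scheme.SpecMap_stalkSpecializes_fromSpecStalk]
  rfl

lemma exists_fromSpecStalk_eq {V : Type u} [CommRing V] [IsLocalRing V]
    (t : Spec (.of V) ⟶ X) (h : t (IsLocalRing.closedPoint V) = y) :
    ∃ g : X.presheaf.stalk y →+* V, Spec.map (CommRingCat.ofHom g) ≫ X.fromSpecStalk y = t := by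
  subst h
  exact ⟨(Scheme.stalkClosedPointTo t).hom, Scheme.Spec_stalkClosedPointTo_fromSpecStalk t⟩

lemma apply_eq_of_fromSpecResidueField {Y : Scheme.{u}} {K : Type u} [Field K]
    {ι : Spec (.of K) ⟶ Y} {t : Y ⟶ X} {j : X.residueField x →+* K}
    (hx : ι ≫ t = Spec.map (CommRingCat.ofHom j) ≫ X.fromSpecResidueField x) (p : Spec (.of K)) :
    t (ι p) = x := by
  rw [← Scheme.Hom.comp_apply, hx, Scheme.Hom.comp_apply]
  exact Scheme.fromSpecResidueField_apply _ _

/-- A morphism from a local scheme factors through the local ring at the image of the closed point.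
The embeddings `j` and `l` are arbitrary so that both the rings of branches and their extensions to
the algebraic closure are covered. -/
lemma exists_stalk_ringHom {V K L : Type u} [CommRing V] [IsLocalRing V] [Field K] [Field L]
    {ι : V →+* K} {τ : V →+* L} [IsLocalHom τ] {j : X.residueField x →+* K}
    {l : X.residueField y →+* L} {t : Spec (.of V) ⟶ X}
    (hx : Spec.map (CommRingCat.ofHom ι) ≫ t =
      Spec.map (CommRingCat.ofHom j) ≫ X.fromSpecResidueField x)
    (hy : Spec.map (CommRingCat.ofHom τ) ≫ t =
      Spec.map (CommRingCat.ofHom l) ≫ X.fromSpecResidueField y) :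
    ∃ (h : x ⤳ y) (g : X.presheaf.stalk y →+* V),
      (∀ s, ι (g s) = j (stalkToResidueField h s)) ∧ ∀ s, τ (g s) = l (X.residue y s) := by
  have hy' : t (IsLocalRing.closedPoint V) = y := by
    have h₁ : Spec.map (CommRingCat.ofHom τ) (IsLocalRing.closedPoint L) =
      IsLocalRing.closedPoint V := IsLocalRing.comap_closedPoint τ
    exact (congr_arg t h₁).symm.trans (apply_eq_of_fromSpecResidueField hy _)
  have hx' : t (Spec.map (CommRingCat.ofHom ι) (IsLocalRing.closedPoint K)) = x :=
    apply_eq_of_fromSpecResidueField hx _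
  have h : x ⤳ y := by
    have := (IsLocalRing.specializes_closedPoint (R := V)
      (Spec.map (CommRingCat.ofHom ι) (IsLocalRing.closedPoint K))).map t.continuous
    rwa [hy', hx'] at this
  obtain ⟨g, rfl⟩ := exists_fromSpecStalk_eq t hy'
  refine ⟨h, g, ?_, ?_⟩
  · rw [← SpecMap_stalkToResidueField h, ← Category.assoc, ← Category.assoc, cancel_mono,
      ← Spec.map_comp, ← Spec.map_comp] at hx
    exact fun s => ConcreteCategory.congr_hom (Spec.map_injective hx) s
  · have e : X.fromSpecResidueField y = Spec.map (X.residue y) ≫ X.fromSpecStalk y := rfl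
    rw [e, ← Category.assoc, ← Category.assoc, cancel_mono,
      ← Spec.map_comp, ← Spec.map_comp] at hy
    exact fun s => ConcreteCategory.congr_hom (Spec.map_injective hy) s

end LocalRing

section LocalRing

variable {X : Scheme.{u}} {i : ℤ} {x y : X}

lemma germ_stalkToResidueField (h : x ⤳ y) {U : X.Opens} (hy : y ∈ U) (s : Γ(X, U)) :
    stalkToResidueField h (X.presheaf.germ U y hy s) =
      X.residue x (X.presheaf.germ U x (h.mem_open U.2 hy) s) :=
  congr_arg (X.residue x)
    (ConcreteCategory.congr_hom (TopCat.Presheaf.germ_stalkSpecializes X.presheaf hy h) s)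

lemma exists_germ_eq (c : X.residueField x) : ∃ (U : X.Opens) (hx : x ∈ U) (s : Γ(X, U)),
    X.residue x (X.presheaf.germ U x hx s) = c := by
  obtain ⟨z, rfl⟩ := X.residue_surjective x c
  obtain ⟨U, hx, s, rfl⟩ := TopCat.Presheaf.exists_germ_eq X.presheaf z
  exact ⟨U, hx, s, rfl⟩

lemma exists_stalkToResidueField_mul_eq (h : x ⤳ y) (c : X.residueField x) :
    ∃ a s, stalkToResidueField h s ≠ 0 ∧
      c * stalkToResidueField h s = stalkToResidueField h a := by
  obtain ⟨_, ⟨U, hU, rfl⟩, hyU, -⟩ :=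
    X.isBasis_affineOpens.exists_subset_of_mem_open (Set.mem_univ y) isOpen_univ
  have hxU : x ∈ U := h.mem_open U.2 hyU
  obtain ⟨z, rfl⟩ := X.residue_surjective x c
  let := TopCat.Presheaf.algebra_section_stalk X.presheaf ⟨x, hxU⟩
  have := hU.isLocalization_stalk ⟨x, hxU⟩
  obtain ⟨⟨a, s⟩, hz⟩ := IsLocalization.surj (hU.primeIdealOf ⟨x, hxU⟩).asIdeal.primeCompl z
  have hs := IsLocalization.map_units (X.presheaf.stalk x) s
  refine ⟨X.presheaf.germ U y hyU a, X.presheaf.germ U y hyU s, ?_, ?_⟩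
  · rw [germ_stalkToResidueField]
    exact (hs.map (X.residue x).hom).ne_zero
  · rw [germ_stalkToResidueField, germ_stalkToResidueField]
    exact (map_mul (X.residue x).hom _ _).symm.trans (congr_arg (X.residue x).hom hz)

instance (h : x ⤳ y) : IsFractionRing (stalkToResidueField h).range (X.residueField x) :=
  IsFractionRing.of_field _ _ fun c => by
    obtain ⟨a, s, hs, hc⟩ := exists_stalkToResidueField_mul_eq h c
    exact ⟨⟨_, a, rfl⟩, ⟨_, s, rfl⟩, ((div_eq_iff hs).2 hc.symm).symm⟩

instance (h : x ⤳ y) [IsLocallyNoetherian X] : IsNoetherianRing (stalkToResidueField h).range :=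
  isNoetherianRing_range _

/-- The point of the spectrum of the local ring at `y` that corresponds to a generization. -/
lemma fromSpecStalk_ker (h : x ⤳ y) :
    X.fromSpecStalk y ⟨RingHom.ker (stalkToResidueField h), RingHom.ker_isPrime _⟩ = x :=
  apply_eq_of_fromSpecResidueField (K := X.residueField x)
    (ι := Spec.map (CommRingCat.ofHom (stalkToResidueField h))) (t := X.fromSpecStalk y)
    (j := RingHom.id _) (by
      rw [SpecMap_stalkToResidueField]
      change _ = Spec.map (𝟙 _) ≫ _
      rw [Spec.map_id, Category.id_comp]) ⟨⊥, Ideal.isPrime_bot⟩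

/-- Primes of the local ring above the kernel are points between `x` and `y`, and consecutive
dimensions leave no room strictly between. -/
lemma ker_eq_or_eq_maximalIdeal (hx : x ∈ pointsOfDim X (i + 1)) (hy : y ∈ pointsOfDim X i)
    (h : x ⤳ y) {Q : Ideal (X.presheaf.stalk y)} (hQ : Q.IsPrime)
    (hle : RingHom.ker (stalkToResidueField h) ≤ Q) :
    Q = RingHom.ker (stalkToResidueField h) ∨ Q = IsLocalRing.maximalIdeal _ := by
  let f := X.fromSpecStalk y
  have hf : Function.Injective f := f.isEmbedding.injective
  let q : Spec (X.presheaf.stalk y) := ⟨Q, hQ⟩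
  let q₀ : Spec (X.presheaf.stalk y) := ⟨RingHom.ker (stalkToResidueField h), RingHom.ker_isPrime _⟩
  have hq₀ : f q₀ = x := fromSpecStalk_ker h
  have hcl : f (IsLocalRing.closedPoint _) = y := Scheme.fromSpecStalk_closedPoint
  have h₁ : x ⤳ f q := by
    rw [← hq₀]
    exact ((PrimeSpectrum.le_iff_specializes q₀ q).1 hle).map f.continuous
  have h₂ : f q ⤳ y := by
    conv_rhs => rw [← hcl]
    exact (IsLocalRing.specializes_closedPoint (R := X.presheaf.stalk y) q).map f.continuous
  rcases eq_or_eq_of_specializes hx hy h₁ h₂ with h₃ | h₃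
  · exact Or.inl (congr_arg PrimeSpectrum.asIdeal (hf (h₃.trans hq₀.symm)))
  · exact Or.inr (congr_arg PrimeSpectrum.asIdeal (hf (h₃.trans hcl.symm)))

lemma ker_ne_maximalIdeal (hxy : x ≠ y) (h : x ⤳ y) :
    RingHom.ker (stalkToResidueField h) ≠ IsLocalRing.maximalIdeal _ := by
  intro heq
  have hcl : X.fromSpecStalk y (IsLocalRing.closedPoint _) = y := Scheme.fromSpecStalk_closedPoint
  refine hxy ((fromSpecStalk_ker h).symm.trans (Eq.trans (congr_arg (X.fromSpecStalk y) ?_) hcl))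
  exact PrimeSpectrum.ext heq

lemma dimensionLEOne_range (hx : x ∈ pointsOfDim X (i + 1)) (hy : y ∈ pointsOfDim X i)
    (h : x ⤳ y) : Ring.DimensionLEOne (stalkToResidueField h).range where
  maximalOfPrime {P} hP0 hP := by
    let r := (stalkToResidueField h).rangeRestrict
    have hr : Function.Surjective r := (stalkToResidueField h).rangeRestrict_surjective
    have hle : RingHom.ker (stalkToResidueField h) ≤ P.comap r := by
      intro s hs
      have : r s = 0 := Subtype.ext hs
      rw [Ideal.mem_comap, this]
      exact P.zero_mem
    have hmap : (P.comap r).map r = P := Ideal.map_comap_of_surjective r hr P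
    rcases ker_eq_or_eq_maximalIdeal hx hy h (hP.comap r) hle with h₁ | h₁
    · refine absurd (eq_bot_iff.2 fun p hp => ?_) hP0
      obtain ⟨s, rfl⟩ := hr p
      have : s ∈ P.comap r := hp
      rw [h₁] at this
      exact Subtype.ext this
    · have : (P.comap r).IsMaximal := h₁ ▸ IsLocalRing.maximalIdeal.isMaximal _
      rw [← hmap]
      refine (Ideal.map_eq_top_or_isMaximal_of_surjective r hr this).resolve_left fun ht => ?_
      exact hP.ne_top (hmap.symm.trans ht)

lemma ker_stalkToResidueField_le (h : x ⤳ y) :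
    RingHom.ker (stalkToResidueField h) ≤ RingHom.ker (X.residue y).hom := fun s hs => by
  have h₁ : s ∈ IsLocalRing.maximalIdeal (X.presheaf.stalk y) :=
    IsLocalRing.le_maximalIdeal (RingHom.ker_ne_top _) hs
  exact (IsLocalRing.residue_eq_zero_iff s).2 h₁

/-- The reduction homomorphism on the image of the local ring. -/
def rangeResidue (h : x ⤳ y) : (stalkToResidueField h).range →+* X.residueField y :=
  (stalkToResidueField h).rangeRestrict.liftOfSurjective
    (stalkToResidueField h).rangeRestrict_surjective ⟨(X.residue y).hom, by
      rw [RingHom.ker_rangeRestrict]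
      exact ker_stalkToResidueField_le h⟩

lemma rangeResidue_apply (h : x ⤳ y) (s : X.presheaf.stalk y) :
    rangeResidue h ⟨_, s, rfl⟩ = X.residue y s :=
  RingHom.liftOfRightInverse_comp_apply _ _ _ _ s

lemma exists_rangeResidue_eq_zero (hxy : x ≠ y) (h : x ⤳ y) : ∃ f, f ≠ 0 ∧ rangeResidue h f = 0 := by
  obtain ⟨s, hs, hs'⟩ := SetLike.exists_of_lt (lt_of_le_of_ne
    (IsLocalRing.le_maximalIdeal (RingHom.ker_ne_top (stalkToResidueField h)))
    (ker_ne_maximalIdeal hxy h))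
  refine ⟨⟨_, s, rfl⟩, fun h0 => hs' (congr_arg Subtype.val h0), ?_⟩
  rw [rangeResidue_apply]
  exact (IsLocalRing.residue_eq_zero_iff s).2 hs

end LocalRing

/-! ### Branches: discreteness and finiteness. -/

section Branches

variable {X : Scheme.{u}} {i : ℤ} {x y : X}

/-- The image of `b.τ` is a field, so a nonzero value has an inverse in the image. Lifting this
inverse gives a product congruent to 1 modulo the maximal ideal. -/
lemma Branch.isLocalHom (b : Branch x y) : IsLocalHom b.τ := by
  refine ⟨fun v hv => ?_⟩
  obtain ⟨w, hw⟩ : (b.τ v)⁻¹ ∈ Set.range b.τ := by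
    rw [b.range_eq]
    exact inv_mem (b.range_eq.le ⟨v, rfl⟩ : b.τ v ∈ b.L)
  have h₁ : b.τ (v * w - 1) = 0 := by
    rw [map_sub, map_mul, hw, mul_inv_cancel₀ hv.ne_zero, map_one, sub_self]
  have h₂ : v * w - 1 ∈ IsLocalRing.maximalIdeal b.V :=
    IsLocalRing.le_maximalIdeal (RingHom.ker_ne_top b.τ) h₁
  have h₃ : IsUnit (v * w) := by
    by_contra hc
    have h₄ := (IsLocalRing.maximalIdeal b.V).sub_mem (a := v * w) hc h₂
    rw [sub_sub_cancel] at h₄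
    exact (Ideal.ne_top_iff_one _).1 (IsLocalRing.maximalIdeal.isMaximal _).ne_top h₄
  exact isUnit_of_mul_isUnit_left h₃

lemma Branch.exists_stalk_ringHom (b : Branch x y) :
    ∃ (h : x ⤳ y) (g : X.presheaf.stalk y →+* b.V),
      (∀ s, (g s : X.residueField x) = stalkToResidueField h s) ∧
        ∀ s, b.τ (g s) = algebraMap _ (Om y) (X.residue y s) := by
  obtain ⟨t, hx, hy⟩ := b.center
  have := b.isLocalHom
  refine TwistedChow.exists_stalk_ringHom (ι := b.V.subtype) (j := RingHom.id _) (t := t) ?_ hy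
  rw [hx]
  change _ = Spec.map (𝟙 _) ≫ _
  rw [Spec.map_id, Category.id_comp]

lemma Branch.range_le (b : Branch x y) (h : x ⤳ y) (o : (stalkToResidueField h).range) :
    ∃ ho : algebraMap _ (X.residueField x) o ∈ b.V,
      b.τ ⟨_, ho⟩ = algebraMap _ (Om y) (rangeResidue h o) := by
  obtain ⟨_, g, hg, hg'⟩ := b.exists_stalk_ringHom
  obtain ⟨_, s, rfl⟩ := o
  have ho : stalkToResidueField h s ∈ b.V := hg s ▸ (g s).2
  refine ⟨ho, ?_⟩
  rw [rangeResidue_apply, ← hg']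
  exact congr_arg b.τ (Subtype.ext (hg s).symm)

variable [IsLocallyNoetherian X]

lemma Branch.isDiscreteValuationRing (hx : x ∈ pointsOfDim X (i + 1)) (hy : y ∈ pointsOfDim X i)
    (b : Branch x y) : IsDiscreteValuationRing b.V := by
  obtain ⟨h, -⟩ := b.exists_stalk_ringHom
  have := dimensionLEOne_range hx hy h
  refine isDiscreteValuationRing_of_algebraMap_mem (O := (stalkToResidueField h).range) b.V
    (fun o => (b.range_le h o).choose) fun htop => ?_
  obtain ⟨f, hf0, hf⟩ := exists_rangeResidue_eq_zero (ne_of_mem_pointsOfDim hx hy) h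
  obtain ⟨hfV, hτ⟩ := b.range_le h f
  rw [hf, map_zero] at hτ
  have hinv : (f : X.residueField x)⁻¹ ∈ b.V := htop ▸ trivial
  have h₁ : (⟨_, hfV⟩ : b.V) * ⟨_, hinv⟩ = 1 :=
    Subtype.ext (mul_inv_cancel₀ fun h0 => hf0 (Subtype.ext h0))
  have h₂ := congr_arg b.τ h₁
  rw [map_mul, hτ, zero_mul, map_one] at h₂
  exact zero_ne_one h₂

/-- A branch is determined by `V` and `τ`, since `L` is the image of `τ`. These pairs dominate the
one-dimensional local ring of the closure of `x` at `y`, so `finite_dominating` applies. -/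
lemma finite_branch (hx : x ∈ pointsOfDim X (i + 1)) (hy : y ∈ pointsOfDim X i) :
    Finite (Branch x y) := by
  rcases isEmpty_or_nonempty (Branch x y) with _ | ⟨⟨b₀⟩⟩
  · infer_instance
  obtain ⟨h, -⟩ := b₀.exists_stalk_ringHom
  have := dimensionLEOne_range hx hy h
  obtain ⟨f, hf0, hf⟩ := exists_rangeResidue_eq_zero (ne_of_mem_pointsOfDim hx hy) h
  have hfin := (finite_dominating (F := X.residueField x)
    ((algebraMap (X.residueField y) (Om y)).comp (rangeResidue h)) hf0
    (by rw [RingHom.comp_apply, hf, map_zero]))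
  let r (b : Branch x y) : Σ V : ValuationSubring (X.residueField x), V →+* Om y := ⟨b.V, b.τ⟩
  refine Set.finite_univ_iff.1 (Set.Finite.of_finite_image (f := r) (hfin.subset ?_) ?_)
  · rintro _ ⟨b, -, rfl⟩
    exact ⟨fun o => (b.range_le h o).choose, fun o => (b.range_le h o).choose_spec, b.isLocalHom⟩
  intro b _ b' _ hb
  obtain ⟨V, L, τ, hL, hc⟩ := b
  obtain ⟨V', L', τ', hL', hc'⟩ := b'
  obtain ⟨rfl, hτ⟩ := Sigma.mk.inj_iff.1 hb
  obtain rfl := eq_of_heq hτ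
  obtain rfl : L = L' := SetLike.coe_injective (hL.symm.trans hL')
  rfl

end Branches

/-! ### Integrality of algebraic elements near x. -/

section GoodLocus

open Polynomial

variable {X : Scheme.{u}} {x : X}

/-- An algebraic element over the residue field is integral over the local rings at all points near
`x`. -/
lemma exists_isOpen_mem (ξ : Om x) : ∃ U : X.Opens, x ∈ U ∧ ∀ y ∈ U,
    ∀ (W : ValuationSubring (Om x)) (τ : W →+* Om y) (_ : IsLocalHom τ) (t : Spec (.of W) ⟶ X),
      Spec.map (CommRingCat.ofHom W.subtype) ≫ t = geomPoint x →
      Spec.map (CommRingCat.ofHom τ) ≫ t = geomPoint y → ξ ∈ W := by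
  have hξ : IsIntegral (X.residueField x) ξ := Algebra.IsIntegral.isIntegral ξ
  let P := minpoly (X.residueField x) ξ
  -- The coefficients of the minimal polynomial are regular near `x`, so at points there they map
  -- into `W`, which is integrally closed.
  choose U hxU s hs using fun n => exists_germ_eq (P.coeff n)
  let I : Finset ℕ := Finset.range (P.natDegree + 1)
  refine ⟨I.inf U, ?_, fun y hy W τ _ t htx hty => ?_⟩
  · rw [← SetLike.mem_coe, TopologicalSpace.Opens.coe_finset_inf]
    simpa using fun n _ => hxU n
  · obtain ⟨h, g, hg, -⟩ := exists_stalk_ringHom (ι := W.subtype) (j := algebraMap _ (Om x)) htx hty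
    have hP : P.map (algebraMap _ (Om x)) ∈ lifts (algebraMap W (Om x)) := by
      rw [lifts_iff_coeff_lifts]
      intro n
      rw [coeff_map]
      by_cases hn : n ∈ I
      · have hyU : y ∈ U n := (Finset.inf_le hn : I.inf U ≤ U n) hy
        refine ⟨g (X.presheaf.germ (U n) y hyU (s n)), ?_⟩
        rw [← hs n, ← germ_stalkToResidueField h hyU]
        exact hg _
      · have hn' : P.natDegree < n := by
          rw [Finset.mem_range] at hn
          omega
        rw [Polynomial.coeff_eq_zero_of_natDegree_lt hn', map_zero]
        exact ⟨0, map_zero _⟩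
    obtain ⟨q, hq, -, hqm⟩ := lifts_and_natDegree_eq_and_monic hP ((minpoly.monic hξ).map _)
    have hO (o : W) : algebraMap W (Om x) o ∈ W := SetLike.coe_mem o
    refine mem_of_isIntegral (V := W) hO ⟨q, hqm, ?_⟩
    rw [← Polynomial.eval_map, hq, Polynomial.eval_map]
    exact minpoly.aeval _ _

end GoodLocus

/-! ### Local residues: uniqueness, lifting, vanishing near x. -/

section LocalResidues

variable {X : Scheme.{u}} {x y : X} {E : EtaleSheaf X}

lemma isLocalHom_of_extends {b : Branch x y} {W : ValuationSubring (Om x)} {τ : W →+* Om y}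
    (hW : W.comap (algebraMap (X.residueField x) (Om x)) = b.V)
    (hτ : ∀ (a : b.V) (ha : algebraMap (X.residueField x) (Om x) a ∈ W), τ ⟨_, ha⟩ = b.τ a) :
    IsLocalHom τ := by
  have hVW : ∀ v ∈ b.V, algebraMap (X.residueField x) (Om x) v ∈ W := fun v hv => hW.ge hv
  refine isLocalHom_of_eq_zero hVW τ fun v hv => ?_
  rw [hτ]
  by_contra h0
  have := b.isLocalHom
  exact hv ((isUnit_map_iff b.τ v).1 (IsUnit.mk0 _ h0))

lemma Cospecializes.exists_hom {W : ValuationSubring (Om x)} {τ : W →+* Om y} {e : stalk E y}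
    {e₀ : stalk E x} (h : Cospecializes E W τ e e₀) :
    ∃ t : Spec (.of W) ⟶ X, genPt W ≫ t = geomPoint x ∧ closedPt W τ ≫ t = geomPoint y := by
  obtain ⟨U, w, hx, hy, -⟩ := h
  exact ⟨w ≫ U.hom, (Category.assoc _ _ _).symm.trans hx, (Category.assoc _ _ _).symm.trans hy⟩

lemma Cospecializes.zero {W : ValuationSubring (Om x)} {τ : W →+* Om y} {E' : EtaleSheaf X}
    {e : stalk E y} {e₀ : stalk E x} (h : Cospecializes E W τ e e₀) :
    Cospecializes E' W τ 0 0 := by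
  obtain ⟨U, w, hx, hy, -⟩ := h
  exact ⟨U, w, hx, hy, 0, map_zero _, map_zero _⟩

lemma IsLocallyConstantSheaf.stalkRep_eq_self_of_mem_inertia (hE : IsLocallyConstantSheaf E)
    {W : ValuationSubring (Om x)} {τ : W →+* Om y} [IsLocalHom τ] {t : Spec (.of W) ⟶ X}
    (hx : genPt W ≫ t = geomPoint x) (hy : closedPt W τ ≫ t = geomPoint y)
    {σ : Gam (X.residueField x)} (hσ : σ ∈ inertia W) (e : stalk E x) : stalkRep E x σ e = e := by
  obtain ⟨h₁, h₂⟩ := mem_inertia_iff.1 hσ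
  refine hE.stalkRep_eq_self W τ t hx hy σ
    (((σ : Om x →+* Om x).comp W.subtype).codRestrict W.toSubring fun a => (h₁ a).2 a.2)
    (fun a => rfl) (fun a => ?_) e
  rw [← sub_eq_zero, ← map_sub]
  by_contra h0
  have h₃ := valuation_coe_isUnit ((isUnit_map_iff τ _).1 (IsUnit.mk0 _ h0))
  exact (h₂ a a.2).ne h₃

lemma germ_congr {U : X.Etale} {v v' : Spec (.of (Om x)) ⟶ U.left} (h : v = v')
    (hv : v ≫ U.hom = geomPoint x) (hv' : v' ≫ U.hom = geomPoint x) (s : E.obj.obj (op U)) :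
    germ E x U v hv s = germ E x U v' hv' s := by
  subst h
  rfl

lemma Cospecializes.smul_right {W W' : ValuationSubring (Om x)} {τ : W →+* Om y}
    {τ' : W' →+* Om y} {σ : Gam (X.residueField x)} (hσ : ∀ a, σ a ∈ W' ↔ a ∈ W)
    (hτ : ∀ a (ha : a ∈ W), τ' ⟨σ a, (hσ a).2 ha⟩ = τ ⟨a, ha⟩) {e : stalk E y} {e₀ : stalk E x}
    (h : Cospecializes E W τ e e₀) : Cospecializes E W' τ' e (stalkRep E x σ e₀) := by
  obtain ⟨U, w, hx, hy, s, rfl, rfl⟩ := h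
  let g : W →+* W' :=
    ((σ : Om x →+* Om x).comp W.subtype).codRestrict W'.toSubring fun a => (hσ a).2 a.2
  have h₁ : Spec.map (CommRingCat.ofHom W'.subtype) ≫ Spec.map (CommRingCat.ofHom g) ≫ w =
      Spec.map (CommRingCat.ofHom (σ : Om x →+* Om x)) ≫
        Spec.map (CommRingCat.ofHom W.subtype) ≫ w := by
    rw [← Category.assoc, ← Category.assoc, ← Spec.map_comp, ← Spec.map_comp]
    rfl
  have h₂ : Spec.map (CommRingCat.ofHom τ') ≫ Spec.map (CommRingCat.ofHom g) ≫ w =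
      Spec.map (CommRingCat.ofHom τ) ≫ w := by
    rw [← Category.assoc, ← Spec.map_comp]
    congr 2
    exact CommRingCat.hom_ext (RingHom.ext fun a => hτ a a.2)
  have hx' : (Spec.map (CommRingCat.ofHom (σ : Om x →+* Om x)) ≫
      Spec.map (CommRingCat.ofHom W.subtype) ≫ w) ≫ U.hom = geomPoint x := by
    rw [Category.assoc, hx, specMap_geomPoint]
  refine ⟨U, Spec.map (CommRingCat.ofHom g) ≫ w, h₁ ▸ hx', h₂ ▸ hy, s, ?_, ?_⟩
  · exact germ_congr h₂ _ _ s
  · rw [stalkRep_germ E x σ _ hx hx']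
    exact germ_congr h₁ _ _ s

lemma Cospecializes.smul_left {W : ValuationSubring (Om x)} {τ : W →+* Om y}
    (σ : Gam (X.residueField y)) {e : stalk E y} {e₀ : stalk E x}
    (h : Cospecializes E W τ e e₀) :
    Cospecializes E W ((σ : Om y →+* Om y).comp τ) (stalkRep E y σ e) e₀ := by
  obtain ⟨U, w, hx, hy, s, rfl, rfl⟩ := h
  have h₂ : Spec.map (CommRingCat.ofHom ((σ : Om y →+* Om y).comp τ)) ≫ w =
      Spec.map (CommRingCat.ofHom (σ : Om y →+* Om y)) ≫ Spec.map (CommRingCat.ofHom τ) ≫ w := by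
    rw [← Category.assoc, ← Spec.map_comp]
    rfl
  have hy' : (Spec.map (CommRingCat.ofHom (σ : Om y →+* Om y)) ≫
      Spec.map (CommRingCat.ofHom τ) ≫ w) ≫ U.hom = geomPoint y := by
    rw [Category.assoc, hy, specMap_geomPoint]
  refine ⟨U, w, hx, h₂ ▸ hy', s, ?_, rfl⟩
  rw [stalkRep_germ E y σ _ hy hy']
  exact germ_congr h₂ _ _ s

lemma IsResidueOf.congr_uniformizer {F : Type u} [Field F] {M : Type u} [AddCommGroup M]
    {ρ : Representation ℤ (Gam F) M} {W : ValuationSubring (AlgebraicClosure F)} {π π' : F}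
    {z : (M ⊗[ℤ] ResZero F) × (Gam F → M ⊗[ℤ] ResOne F)} {e : M} (h : IsResidueOf ρ W π z e)
    (hπ : W.valuation (algebraMap F (AlgebraicClosure F) π) =
      W.valuation (algebraMap F (AlgebraicClosure F) π')) : IsResidueOf ρ W π' z e := by
  obtain ⟨κ, q, ord, h1, h2, h3, h4, h5⟩ := h
  exact ⟨κ, q, ord, h1, h2, h3, fun a ha => hπ ▸ h4 a ha, h5⟩

lemma valuation_eq_of_irreducible {F : Type u} [Field F] {V : ValuationSubring F}
    [IsDiscreteValuationRing V] {W : ValuationSubring (AlgebraicClosure F)}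
    (hW : W.comap (algebraMap F _) = V) {π π' : V} (hπ : Irreducible π) (hπ' : Irreducible π') :
    W.valuation (algebraMap F (AlgebraicClosure F) π) =
      W.valuation (algebraMap F (AlgebraicClosure F) π') := by
  obtain ⟨u, hu⟩ := IsDiscreteValuationRing.associated_of_irreducible V hπ hπ'
  let g : V →+* W := ((algebraMap F (AlgebraicClosure F)).comp V.subtype).codRestrict
    W.toSubring fun v => hW.ge v.2
  have h₁ : W.valuation (algebraMap F (AlgebraicClosure F) (u : V)) = 1 :=
    valuation_coe_isUnit (u.isUnit.map g)
  rw [← hu]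
  change _ = W.valuation (algebraMap F _ ((π : F) * ((u : V) : F)))
  rw [map_mul, map_mul, h₁, mul_one]

lemma HOne.mk_surjective {F : Type u} [Field F] {M : Type u} [AddCommGroup M]
    {ρ : Representation ℤ (Gam F) M} : Function.Surjective (HOne.mk ρ) :=
  QuotientAddGroup.mk'_surjective _

lemma exists_coboundary_of_mk_eq {F : Type u} [Field F] {M : Type u} [AddCommGroup M]
    {ρ : Representation ℤ (Gam F) M} {z z' : hyperCocycles ρ} (h : HOne.mk ρ z = HOne.mk ρ z') :
    ∃ k, (z : (M ⊗[ℤ] ResZero F) × (Gam F → M ⊗[ℤ] ResOne F)) + hyperCoboundary ρ k = z' := by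
  obtain ⟨k, hk⟩ := QuotientAddGroup.eq.1 h
  refine ⟨k, ?_⟩
  rw [hk]
  change (z : (M ⊗[ℤ] ResZero F) × (Gam F → M ⊗[ℤ] ResOne F)) + (-z + z') = z'
  abel

/-- Two choices of (W, τ) are conjugate under the Galois group of k(x). Moving one computation to
the other changes the hypercocycle by a coboundary and the uniformizer by a unit, and translates the
residue in the stalk at `x`. Inertia acts trivially there, so that residue is unique, and
cospecialization to `y` is unique as well. -/
theorem IsLocalResidue.unique (hE : IsLocallyConstantSheaf E) {b : Branch x y}
    [IsDiscreteValuationRing b.V] {α : HOneAt E x} {e e' : stalk E y}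
    (h : IsLocalResidue E b α e) (h' : IsLocalResidue E b α e') : e = e' := by
  obtain ⟨z, W, τ, π, e₀, hz, hW, hτ, hπ, hr, hc⟩ := h
  obtain ⟨z', W', τ', π', e₀', hz', hW', hτ', hπ', hr', hc'⟩ := h'
  have := isLocalHom_of_extends hW hτ
  have := isLocalHom_of_extends hW' hτ'
  obtain ⟨σ, hσ, hστ⟩ := exists_algEquiv_of_comap_eq hW hW' τ τ' fun v hv hv' =>
    (hτ ⟨v, hW.le hv⟩ hv).trans (hτ' ⟨v, hW.le hv⟩ hv').symm
  obtain ⟨t, htx, hty⟩ := hc'.exists_hom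
  obtain ⟨O⟩ := nonempty_unramifiedOrder_of_irreducible hπ' hW' τ'
  obtain ⟨k, hk⟩ := exists_coboundary_of_mk_eq (hz.trans hz'.symm)
  have h₁ := ((hr.conj z.2 σ hσ).congr_uniformizer
    (valuation_eq_of_irreducible hW' hπ hπ')).add_coboundary k
  rw [hk] at h₁
  have h₂ : stalkRep E x σ e₀ = e₀' := h₁.unique O
    (fun σ hσ m => hE.stalkRep_eq_self_of_mem_inertia htx hty hσ m) hr'
  exact hE.cospecializes_unique W' τ' (hc.smul_right hσ hστ) (h₂ ▸ hc')

/-- The extension (W, τ) used for the quotient serves again. Flatness of the stalk of the subsheaf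
lifts the residue in the stalk at `x`, and local constancy of the middle sheaf moves it to `y`. -/
theorem exists_isLocalResidue {S : ShortComplex (EtaleSheaf X)} (hS : S.ShortExact)
    (hB : IsLocallyConstantSheaf S.X₂) [Module.Flat ℤ (stalk S.X₁ x)] {b : Branch x y}
    [IsDiscreteValuationRing b.V] {β : HOneAt S.X₂ x} {e : stalk S.X₃ y}
    (h : IsLocalResidue S.X₃ b (HOne.map (stalkMap S.g x) β) e) :
    ∃ e', IsLocalResidue S.X₂ b β e' := by
  obtain ⟨z, W, τ, π, e₀, hz, hW, hτ, hπ, hr, hc⟩ := h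
  obtain ⟨zB, hzB⟩ := HOne.mk_surjective β
  rw [← hzB, HOne.map_mk] at hz
  have := isLocalHom_of_extends hW hτ
  obtain ⟨t, htx, hty⟩ := hc.exists_hom
  obtain ⟨O⟩ := nonempty_unramifiedOrder_of_irreducible hπ hW τ
  obtain ⟨k, hk⟩ := exists_coboundary_of_mk_eq hz
  have h₁ := hr.add_coboundary k
  rw [hk] at h₁
  obtain ⟨e₁, he₁⟩ := exists_isResidueOf (stalkMap S.f x) (stalkMap S.g x)
    (stalkMap_injective hS x) (stalkMap_surjective hS x) (stalkMap_exact hS x) O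
    (fun σ hσ m => hB.stalkRep_eq_self_of_mem_inertia htx hty hσ m) zB.2 h₁
  obtain ⟨e', he'⟩ := hB.exists_cospecializes W τ t htx hty e₁
  exact ⟨e', zB, W, τ, π, e₁, hzB, hW, hτ, hπ, he₁, he'⟩

/-- At all points near `x`, the residues of a class vanish. -/
theorem exists_isOpen_isLocalResidue_zero (α : HOneAt E x) :
    ∃ U : X.Opens, x ∈ U ∧ ∀ y ∈ U, ∀ (b : Branch x y) (E' : EtaleSheaf X) (α' : HOneAt E' x)
      (e : stalk E' y), IsLocalResidue E' b α' e → IsLocalResidue E b α 0 := by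
  obtain ⟨z, hz⟩ := HOne.mk_surjective α
  obtain ⟨T, hT, -, hT'⟩ := exists_finite_isResidueOf_zero z.2
  choose U hxU hU using exists_isOpen_mem (X := X) (x := x)
  refine ⟨hT.toFinset.inf fun ξ => U ξ ⊓ U ξ⁻¹, ?_, fun y hy b E' α' e h => ?_⟩
  · rw [← SetLike.mem_coe, TopologicalSpace.Opens.coe_finset_inf]
    simpa using fun ξ _ => ⟨hxU ξ, hxU ξ⁻¹⟩
  -- A residue of any class in any sheaf supplies an extension of the branch to the algebraic
  -- closure, together with a morphism from `Spec W` to `X`.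
  · obtain ⟨-, W, τ, π, e₀, -, hW, hτ, hπ, -, hc⟩ := h
    have hl := isLocalHom_of_extends hW hτ
    obtain ⟨t, htx, hty⟩ := hc.exists_hom
    refine ⟨z, W, τ, π, 0, hz, hW, hτ, hπ, hT' W _ fun ξ hξ => ?_, hc.zero⟩
    have hle : hT.toFinset.inf (fun ξ => U ξ ⊓ U ξ⁻¹) ≤ U ξ ⊓ U ξ⁻¹ :=
      Finset.inf_le (hT.mem_toFinset.2 hξ)
    exact ⟨hU ξ y (hle hy).1 W τ hl t htx hty, hU ξ⁻¹ y (hle hy).2 W τ hl t htx hty⟩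

end LocalResidues

/-! ### Global residues of a class. -/

section Boundaries

variable {X : Scheme.{u}} {i : ℤ} {x y : X} {E : EtaleSheaf X}

lemma Branch.ext_of_eq {b b' : Branch x y} (hV : b.V = b'.V)
    (hτ : ∀ a (h : a ∈ b.V) (h' : a ∈ b'.V), b.τ ⟨a, h⟩ = b'.τ ⟨a, h'⟩) : b = b' := by
  obtain ⟨V, L, τ, hL, hc⟩ := b
  obtain ⟨V', L', τ', hL', hc'⟩ := b'
  obtain rfl : V = V' := hV
  obtain rfl : τ = τ' := RingHom.ext fun a => hτ a a.2 a.2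
  obtain rfl : L = L' := SetLike.coe_injective (hL.symm.trans hL')
  rfl

/-- The action of the Galois group of `k(y)` on the branches along `y`. -/
def Branch.smul (σ : Gam (X.residueField y)) (b : Branch x y) : Branch x y where
  V := b.V
  L := b.L.map σ.toAlgHom
  τ := (σ : Om y →+* Om y).comp b.τ
  range_eq := by
    rw [IntermediateField.coe_map, ← b.range_eq, ← Set.range_comp]
    rfl
  center := by
    obtain ⟨t, hx, hy⟩ := b.center
    refine ⟨t, hx, ?_⟩
    rw [CommRingCat.ofHom_comp, Spec.map_comp, Category.assoc, hy, specMap_geomPoint]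

/-- The permutation of the branches along `y` given by an element of the Galois group of `k(y)`. -/
def Branch.smulEquiv (σ : Gam (X.residueField y)) : Branch x y ≃ Branch x y where
  toFun := Branch.smul σ
  invFun := Branch.smul σ⁻¹
  left_inv b := Branch.ext_of_eq rfl fun a h _ => σ.symm_apply_apply (b.τ ⟨a, h⟩)
  right_inv b := Branch.ext_of_eq rfl fun a h _ => σ.apply_symm_apply (b.τ ⟨a, h⟩)

lemma Branch.finInsepDegree_smul (σ : Gam (X.residueField y)) (b : Branch x y) :
    Field.finInsepDegree (X.residueField y) (b.smul σ).L =
      Field.finInsepDegree (X.residueField y) b.L :=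
  (Field.finInsepDegree_eq_of_equiv _ _ _ (IntermediateField.intermediateFieldMap σ b.L)).symm

lemma IsLocalResidue.smul {b : Branch x y} {α : HOneAt E x} {e : stalk E y}
    (h : IsLocalResidue E b α e) (σ : Gam (X.residueField y)) :
    IsLocalResidue E (b.smul σ) α (stalkRep E y σ e) := by
  obtain ⟨z, W, τ, π, e₀, hz, hW, hτ, hπ, hr, hc⟩ := h
  exact ⟨z, W, (σ : Om y →+* Om y).comp τ, π, e₀, hz, hW, fun a ha => congr_arg σ (hτ a ha), hπ, hr,
    hc.smul_left σ⟩

/-- The sum over the branches of the residues, weighted by the inseparable degrees, is invariant. -/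
lemma finsum_mem_invariants (hE : IsLocallyConstantSheaf E) [Finite (Branch x y)]
    (hV : ∀ b : Branch x y, IsDiscreteValuationRing b.V) {α : HOneAt E x}
    {r : Branch x y → stalk E y} (hr : ∀ b, IsLocalResidue E b α (r b)) :
    ∑ᶠ b, Field.finInsepDegree (X.residueField y) b.L • r b ∈ (stalkRep E y).invariants := by
  intro σ
  have h₁ (b : Branch x y) : stalkRep E y σ (r b) = r (b.smul σ) :=
    have := hV (b.smul σ)
    ((hr b).smul σ).unique hE (hr (b.smul σ))
  refine (AddMonoidHom.map_finsum (stalkRep E y σ).toAddMonoidHom (Set.toFinite _)).trans ?_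
  refine Eq.trans (finsum_congr fun b => ?_) (finsum_comp_equiv (Branch.smulEquiv σ)
    (f := fun b => Field.finInsepDegree (X.residueField y) b.L • r b))
  refine (map_nsmul (stalkRep E y σ).toAddMonoidHom _ _).trans ?_
  exact congr_arg₂ (· • ·) (b.finInsepDegree_smul σ).symm (h₁ b)

variable [IsLocallyNoetherian X]

lemma IsBoundary.unique (hE : IsLocallyConstantSheaf E) (hx : x ∈ pointsOfDim X (i + 1))
    {α : HOneAt E x} {z z' : Cycles E i} (h : IsBoundary E i x α z) (h' : IsBoundary E i x α z') :
    z = z' := by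
  obtain ⟨r, hr⟩ := h
  obtain ⟨r', hr'⟩ := h'
  refine DFinsupp.ext fun y => Subtype.ext ?_
  rw [(hr y).2.2, (hr' y).2.2]
  refine finsum_congr fun b => ?_
  have := b.isDiscreteValuationRing hx y.2
  rw [((hr y).1 b).unique hE ((hr' y).1 b)]

/-- Each component is a finite sum over branches, invariant by uniqueness of residues. Components
are zero at points of an open neighbourhood of `x` and at points that do not specialize `x`, which
leaves finitely many points. -/
lemma exists_isBoundary_of_isLocalResidue [TopologicalSpace.NoetherianSpace X]
    (hE : IsLocallyConstantSheaf E) (hx : x ∈ pointsOfDim X (i + 1)) {α : HOneAt E x}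
    (h : ∀ (y : pointsOfDim X i) (b : Branch x y.1), ∃ e, IsLocalResidue E b α e) :
    ∃ z, IsBoundary E i x α z := by
  classical
  choose r hr using h
  obtain ⟨U, hxU, hU⟩ := exists_isOpen_isLocalResidue_zero α
  have hfin (y : pointsOfDim X i) : Finite (Branch x y.1) := finite_branch hx y.2
  have hV (y : pointsOfDim X i) (b : Branch x y.1) : IsDiscreteValuationRing b.V :=
    b.isDiscreteValuationRing hx y.2
  have hT : {y : pointsOfDim X i | x ⤳ y.1 ∧ y.1 ∉ U}.Finite := by
    refine Set.Finite.of_finite_image ((finite_pointsOfDim_notMem hx U.2 hxU).subset ?_)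
      Subtype.val_injective.injOn
    rintro _ ⟨y, hy, rfl⟩
    exact ⟨y.2, hy⟩
  let c (y : pointsOfDim X i) : HZeroAt E y.1 :=
    ⟨_, finsum_mem_invariants hE (hV y) (hr y)⟩
  let z : Cycles E i := DirectSum.mk _ hT.toFinset fun y => c y
  have hz (y : pointsOfDim X i) : z y = c y := by
    by_cases hy : y ∈ hT.toFinset
    · exact DirectSum.mk_apply_of_mem hy
    · refine (DirectSum.mk_apply_of_notMem hy).trans (Subtype.ext ?_)
      refine (finsum_eq_zero_of_forall_eq_zero fun b => ?_).symm
      have hxy : x ⤳ y.1 := b.exists_stalk_ringHom.choose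
      have hyU : y.1 ∈ U := by
        by_contra hc
        exact hy (hT.mem_toFinset.2 ⟨hxy, hc⟩)
      have := hV y b
      rw [(hr y b).unique hE (hU y hyU b E α _ (hr y b)), smul_zero]
  refine ⟨z, r, fun y => ⟨hr y, Set.toFinite _, ?_⟩⟩
  rw [hz]

/-- The residue of a class in the quotient sheaf lifts to a residue. -/
lemma exists_isBoundary_map_eq [TopologicalSpace.NoetherianSpace X] {S : ShortComplex (EtaleSheaf X)}
    (hS : S.ShortExact) (hB : IsLocallyConstantSheaf S.X₂) (hC : IsLocallyConstantSheaf S.X₃)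
    (hflat : Module.Flat ℤ (stalk S.X₁ x))
    (hx : x ∈ pointsOfDim X (i + 1)) (hsurj : Function.Surjective (HOne.map (stalkMap S.g x)))
    {α : HOneAt S.X₃ x} {z : Cycles S.X₃ i} (h : IsBoundary S.X₃ i x α z) :
    ∃ β z', IsBoundary S.X₂ i x β z' ∧ cyclesMap S.g i z' = z := by
  obtain ⟨β, rfl⟩ := hsurj α
  obtain ⟨z', hz'⟩ := exists_isBoundary_of_isLocalResidue hB hx (α := β) fun y b => by
    obtain ⟨r, hr⟩ := h
    have := b.isDiscreteValuationRing hx y.2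
    exact exists_isLocalResidue hS hB ((hr y).1 b)
  -- By functoriality the image of `z'` is a residue of the original class, so uniqueness identifies
  -- it with `z`.
  exact ⟨β, z', hz', (hz'.map S.g).unique hC hx h⟩

end Boundaries

/-! ### From cycles to Chow groups. -/

section Cycles

variable {X : Scheme.{u}} {S : ShortComplex (EtaleSheaf X)} (i : ℤ)

lemma cyclesMap_surjective
    (h : ∀ x, Function.Surjective (invMap (stalkMap S.g x))) :
    Function.Surjective (cyclesMap S.g i) :=
  DirectSum.map_surjective _ |>.2 fun x => h x.1

lemma cyclesMap_exact (hS : S.ShortExact) : Function.Exact (cyclesMap S.f i) (cyclesMap S.g i) := by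
  classical
  intro z
  constructor
  · intro hz
    have h (y : pointsOfDim X i) : ∃ a, invMap (stalkMap S.f y.1) a = z y := by
      have hy : (stalkMap S.g y.1).toLinearMap (z y : stalk S.X₂ y.1) = 0 :=
        congr_arg Subtype.val (DFunLike.congr_fun hz y)
      obtain ⟨a, ha⟩ := (stalkMap_exact hS y.1 _).1 hy
      refine ⟨⟨a, fun σ => stalkMap_injective hS y.1 ?_⟩, Subtype.ext ha⟩
      refine (LinearMap.congr_fun ((stalkMap S.f y.1).isIntertwining' σ) a).trans ?_
      exact (congr_arg (stalkRep S.X₂ y.1 σ) ha).trans (((z y).2 σ).trans ha.symm)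
    choose a ha using h
    refine ⟨DirectSum.mk _ (DFinsupp.support z) fun y => a y, DFinsupp.ext fun y => ?_⟩
    refine (DirectSum.map_apply _ _ _).trans ?_
    by_cases hy : y ∈ DFinsupp.support z
    · rw [DirectSum.mk_apply_of_mem hy, ha]
    · rw [DirectSum.mk_apply_of_notMem hy, map_zero]
      exact (DFinsupp.notMem_support_iff.1 hy).symm
  · rintro ⟨w, rfl⟩
    refine DFinsupp.ext fun y => Subtype.ext ?_
    exact (stalkMap_exact hS y.1).apply_apply_eq_zero (w y : stalk S.X₁ y.1)

lemma CH.map_surjective (h : Function.Surjective (cyclesMap S.g i)) :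
    Function.Surjective (CH.map S.g i) := by
  intro c
  obtain ⟨z, rfl⟩ := QuotientAddGroup.mk'_surjective _ c
  obtain ⟨z, rfl⟩ := h z
  exact ⟨QuotientAddGroup.mk' _ z, rfl⟩

/-- A cycle on `S.X₂` whose image is a boundary can be changed by a boundary so that its image is
zero, and it then comes from `S.X₁`. -/
lemma CH.map_exact (h : Function.Exact (cyclesMap S.f i) (cyclesMap S.g i))
    (hb : ∀ z ∈ boundaries S.X₃ i, ∃ z' ∈ boundaries S.X₂ i, cyclesMap S.g i z' = z) :
    Function.Exact (CH.map S.f i) (CH.map S.g i) := by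
  intro c
  constructor
  · intro hc
    obtain ⟨z, rfl⟩ := QuotientAddGroup.mk'_surjective _ c
    have hz : cyclesMap S.g i z ∈ boundaries S.X₃ i := (QuotientAddGroup.eq_zero_iff _).1 hc
    obtain ⟨z', hz', h'⟩ := hb _ hz
    obtain ⟨w, hw⟩ := (h (z - z')).1 (by rw [map_sub, h', sub_self])
    refine ⟨QuotientAddGroup.mk' _ w, ?_⟩
    refine QuotientAddGroup.eq.2 ?_
    change -cyclesMap S.f i w + z ∈ _
    rw [hw]
    simpa using hz'
  · rintro ⟨d, rfl⟩
    obtain ⟨w, rfl⟩ := QuotientAddGroup.mk'_surjective _ d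
    refine (QuotientAddGroup.eq_zero_iff _).2 ?_
    rw [(h _).2 ⟨w, rfl⟩]
    exact zero_mem _

lemma exists_mem_boundaries [IsLocallyNoetherian X] [TopologicalSpace.NoetherianSpace X]
    (hS : S.ShortExact) (hB : IsLocallyConstantSheaf S.X₂) (hC : IsLocallyConstantSheaf S.X₃)
    (hflat : ∀ x, Module.Flat ℤ (stalk S.X₁ x))
    (hsurj : ∀ x, Function.Surjective (HOne.map (stalkMap S.g x)))
    {z : Cycles S.X₃ i} (hz : z ∈ boundaries S.X₃ i) :
    ∃ z' ∈ boundaries S.X₂ i, cyclesMap S.g i z' = z := by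
  refine AddSubgroup.closure_induction (p := fun z _ => ∃ z' ∈ boundaries S.X₂ i,
    cyclesMap S.g i z' = z) ?_ ⟨0, zero_mem _, map_zero _⟩ ?_ ?_ hz
  · rintro z ⟨x, hx, α, h⟩
    obtain ⟨β, z', hz', h'⟩ := exists_isBoundary_map_eq hS hB hC (hflat x) hx (hsurj x) h
    exact ⟨z', AddSubgroup.subset_closure ⟨x, hx, β, hz'⟩, h'⟩
  · rintro _ _ _ _ ⟨a, ha, rfl⟩ ⟨b, hb, rfl⟩
    exact ⟨a + b, add_mem ha hb, map_add _ _ _⟩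
  · rintro _ _ ⟨a, ha, rfl⟩
    exact ⟨-a, neg_mem ha, map_neg _ _⟩

end Cycles

end TwistedChow

end

theorem theorem3p1 {k : Type u} [Field k] (X : AlgebraicGeometry.Scheme.{u})
    (str : X ⟶ AlgebraicGeometry.Spec (.of k)) [AlgebraicGeometry.LocallyOfFiniteType str]
    [AlgebraicGeometry.QuasiCompact str] [AlgebraicGeometry.IsSeparated str]
    (S : CategoryTheory.ShortComplex (TwistedChow.EtaleSheaf X)) (hS : S.ShortExact)
    (hA : TwistedChow.IsLocallyConstantSheaf S.X₁) (hB : TwistedChow.IsLocallyConstantSheaf S.X₂)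
    (hC : TwistedChow.IsLocallyConstantSheaf S.X₃)
    (R : Type u) [CommRing R] [IsDedekindDomain R] [Module.IsTorsionFree ℤ R] (i : ℤ) :
    (TwistedChow.IsCoflasque R S.X₁ →
      Function.Surjective (TwistedChow.CH.map S.g i)) ∧
    (TwistedChow.IsInvertible R S.X₁ →
      Function.Exact (TwistedChow.CH.map S.f i) (TwistedChow.CH.map S.g i) ∧
      Function.Surjective (TwistedChow.CH.map S.g i)) := by
  -- Finite type over a field makes `X` Noetherian, which the finiteness of branches and of the
  -- support of a residue requires.
  have : IsLocallyNoetherian X := LocallyOfFiniteType.isLocallyNoetherian str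
  have : CompactSpace X := QuasiCompact.compactSpace_of_compactSpace str
  have : IsNoetherian X := {}
  have hsurj (h : ∀ x, TwistedChow.HasTrivialHOne (TwistedChow.stalkRep S.X₁ x)) :
      Function.Surjective (TwistedChow.cyclesMap S.g i) :=
    TwistedChow.cyclesMap_surjective i fun x => TwistedChow.invMap_surjective _ _ (h x)
      (TwistedChow.isDiscreteRep_stalkRep _ x) (TwistedChow.stalkMap_injective hS x)
      (TwistedChow.stalkMap_surjective hS x) (TwistedChow.stalkMap_exact hS x)
  refine ⟨fun h => TwistedChow.CH.map_surjective i (hsurj h.hasTrivialHOne), fun h => ⟨?_,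
    TwistedChow.CH.map_surjective i (hsurj h.hasTrivialHOne)⟩⟩
  refine TwistedChow.CH.map_exact i (TwistedChow.cyclesMap_exact i hS) fun z hz =>
    TwistedChow.exists_mem_boundaries i hS hB hC h.flat_stalk (fun x => ?_) hz
  have := h.flat_stalk x
  exact TwistedChow.HOne.map_surjective _ _ (h.hasTrivialHOne_tprod x)
    (TwistedChow.isDiscreteRep_stalkRep _ x) (TwistedChow.isDiscreteRep_stalkRep _ x)
    (TwistedChow.stalkMap_injective hS x) (TwistedChow.stalkMap_surjective hS x)
    (TwistedChow.stalkMap_exact hS x)
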